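/- **Setting.** Let $\mathcal X$ be a finite or countable set and $P$ a transition kernel on $\mathcal X$ that is ergodic (for all $x,y$ there is $m$ with $P^n(x,y)>0$ for all $n\ge m$), with stationary probability distribution $\mu$. Let $\gamma,\lambda\in(0,1)$, let $r:\mathcal X\to\mathbb R$ satisfy $|r|\le R_{\max}$, put $V_{\max}=R_{\max}/(1-\gamma)$, and let $\phi=(\phi_1,\dots,\phi_d)^T:\mathcal X\to\mathbb R^d$ have linearly independent components with $|\phi_j|\le L$, $d\ge1$. Write $\Phi$ for the matrix with rows $\phi(x)^T$, $D_\mu$ for the diagonal matrix of $\mu$, $\|f\|_\mu=(\sum_x|f(x)|^2\mu(x))^{1/2}$, and $\nu$ for the smallest eigenvalue of $\Phi^TD_\mu\Phi$. Let $\Pi$ be the $\|\cdot\|_\mu$-orthogonal projection onto $\mathrm{span}(\phi_1,\dots,\phi_d)$, $Tv(x)=r(x)+\gamma\sum_yP(x,y)v(y)$, and $T^\lambda v=(1-\lambda)\sum_{i\ge0}\lambda^iT^{i+1}v$. Let $(X_i)_{i\ge1}$ be a Markov chain with kernel $P$ and $X_1\sim\mu$, whose $\beta$-mixing coefficients $$\beta_i=\sup_{t\ge1}\mathbb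 E\Big[\sup_{B\in\sigma(X_{t+i},X_{t+i+1},\dots)}\big|\mathbb P(B\mid\sigma(X_1,\dots,X_t))-\mathbb P(B)\big|\Big]$$ satisfy $\beta_i\le\bar\beta e^{-bi^\kappa}$ for all $i\ge1$, where $\bar\beta,b,\kappa>0$. For $n\ge2$ let $z_i=\sum_{k=1}^i(\lambda\gamma)^{i-k}\phi(X_k)$, $$\hat A=\frac1{n-1}\sum_{i=1}^{n-1}z_i(\phi(X_i)-\gamma\phi(X_{i+1}))^T,\qquad \hat b=\frac1{n-1}\sum_{i=1}^{n-1}z_ir(X_i),$$ and $\hat v_{LSTD(\lambda)}=\Phi\hat A^{-1}\hat b$ when $\hat A$ is invertible. For $n\ge1$ and $\delta\in(0,1)$ put $$\Lambda(n,\delta)=\log\frac{8n^2}{\delta}+\log\max\{4e^2,n\bar\beta\},\qquad I(n,\delta)=32\,\Lambda(n,\delta)\max\Big\{\frac{\Lambda(n,\delta)}b,1\Big\}^{1/\kappa},$$ and, for $n\ge2$, $m_n=\Big\lceil\frac{\log(n-1)}{\log(1/(\lambda\gamma))}\Big\rceil$. Let $n_0(\delta)$ be the smallest integer $\ge2$ such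 that for all $n\ge n_0(\delta)$ $$\frac{2dL^2}{(1-\gamma)\nu}\left[\frac2{\sqrt{n-1}}\sqrt{(m_n+1)\,I(n-1,\delta)}+\frac1{(n-1)(1-\lambda\gamma)}+\frac{2m_n}{n-1}\right]<1 .$$ **Theorem.** The equation $v=\Pi T^\lambda v$ has exactly one solution $v_{LSTD(\lambda)}$. There is a function $h(n,\delta)$, depending only on $n$, $\delta$ and the parameters $d,L,R_{\max},\gamma,\lambda,\nu,\bar\beta,b,\kappa$, such that for every $\delta\in(0,1)$ one has $h(n,\delta)=\tilde O(1/n)$ as $n\to\infty$ (that is, $h(n,\delta)=O(\log^k(n)/n)$ for some $k\ge0$), and such that for every $\delta\in(0,1)$, with probability at least $1-\delta$, simultaneously for all $n\ge n_0(\delta)$, the matrix $\hat A$ is invertible and $$\|v_{LSTD(\lambda)}-\hat v_{LSTD(\lambda)}\|_\mu\le\frac{4V_{\max}dL^2}{\sqrt{n-1}\,(1-\gamma)\,\nu}\sqrt{(1+m_n)\,I(n-1,\delta)}+h(n,\delta).$$ -/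

import Mathlib

open MeasureTheory ProbabilityTheory Filter

open scoped ENNReal Matrix

noncomputable section

/-- `f = Õ(g)`: there is some `k ≥ 0` with `f(n) = O(g(n) log^k g(n))` as `n → ∞`. -/
def IsSoftO (f g : ℕ → ℝ) : Prop :=
  ∃ k : ℕ, f =O[atTop] fun n => g n * (Real.log (g n)) ^ k

section MarkovChain

variable {S : Type*} [MeasurableSpace S] {Ω : Type*} [MeasurableSpace Ω]

/-- Ergodicity of a transition kernel on a countable state space, in the form
"aperiodic and irreducible": for all `x, y` one has `P^n(x, y) > 0` for all large `n`. -/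
def IsErgodicKernel (P : Kernel S S) : Prop :=
  ∀ x y : S, ∃ m : ℕ, ∀ n ≥ m, 0 < (P ^ n) x {y}

/-- `X 1, X 2, …` is a Markov chain on a countable state space with transition kernel `P`
and initial law `X 1 ∼ μ`. (Time starts at `1`; the value `X 0` plays no role.) -/
structure IsMarkovChain (Pr : Measure Ω) (P : Kernel S S) (μ : Measure S) (X : ℕ → Ω → S) :
    Prop where
  measurable : ∀ i ≥ 1, Measurable (X i)
  initial : Pr.map (X 1) = μ
  markov : ∀ n ≥ 1, ∀ x : ℕ → S,
    Pr {ω | ∀ i ∈ Finset.Icc 1 (n + 1), X i ω = x i} =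
      Pr {ω | ∀ i ∈ Finset.Icc 1 n, X i ω = x i} * P (x n) {x (n + 1)}

/-- The sigma-algebra generated by `X 1, …, X t`. -/
@[reducible] def pastSigma (X : ℕ → Ω → S) (t : ℕ) : MeasurableSpace Ω :=
  ⨆ i ∈ Set.Icc 1 t, MeasurableSpace.comap (X i) inferInstance

/-- The sigma-algebra generated by `X t, X (t + 1), …`. -/
@[reducible] def futureSigma (X : ℕ → Ω → S) (t : ℕ) : MeasurableSpace Ω :=
  ⨆ i ∈ Set.Ici t, MeasurableSpace.comap (X i) inferInstance

/-- The `i`-th beta-mixing coefficient of the process `(X n)_{n ≥ 1}`,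
`sup_{t ≥ 1} E [ sup_{B ∈ σ(X_{t+i}, X_{t+i+1}, …)} |P(B | σ(X_1, …, X_t)) - P(B)| ]`. -/
def betaCoeff (Pr : Measure Ω) (X : ℕ → Ω → S) (i : ℕ) : ℝ≥0∞ :=
  ⨆ (t : ℕ) (_ : 1 ≤ t), ∫⁻ ω, ⨆ (B : Set Ω) (_ : MeasurableSet[futureSigma X (t + i)] B),
    ENNReal.ofReal |(Pr⟦B | pastSigma X t⟧) ω - Pr.real B| ∂Pr

end MarkovChain

section LSTD

variable {S : Type*} [MeasurableSpace S] {Ω : Type*} {d : ℕ}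

/-- The weighted quadratic norm `‖f‖_μ = (∑ₓ |f x|² μ(x))^{1/2}`. -/
def muNorm (μ : Measure S) (f : S → ℝ) : ℝ :=
  Real.sqrt (∫ x, |f x| ^ 2 ∂μ)

/-- The Gram matrix `Φᵀ D_μ Φ`. -/
def gramMatrix (μ : Measure S) (φ : S → Fin d → ℝ) : Matrix (Fin d) (Fin d) ℝ :=
  Matrix.of fun j k => ∫ x, φ x j * φ x k ∂μ

/-- The space of functions spanned by the features `φ₁, …, φ_d`. -/
def featureSpace (φ : S → Fin d → ℝ) : Submodule ℝ (S → ℝ) :=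
  Submodule.span ℝ (Set.range fun (j : Fin d) (x : S) => φ x j)

/-- `g` is the `μ`-orthogonal projection of `f` onto the feature space: `g = Π f`. -/
def IsMuProjection (μ : Measure S) (φ : S → Fin d → ℝ) (f g : S → ℝ) : Prop :=
  g ∈ featureSpace φ ∧ ∀ s ∈ featureSpace φ, ∫ x, (f x - g x) * s x ∂μ = 0

/-- The Bellman operator `(T v)(x) = r(x) + γ E[v(X₁) | X₀ = x]`. -/
def bellman (P : Kernel S S) (r : S → ℝ) (γ : ℝ) (v : S → ℝ) : S → ℝ :=
  fun x => r x + γ * ∫ y, v y ∂(P x)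

/-- The operator `T^λ v = (1 - λ) ∑_{i ≥ 0} λ^i T^{i+1} v`. -/
def bellmanLam (P : Kernel S S) (r : S → ℝ) (γ lam : ℝ) (v : S → ℝ) : S → ℝ :=
  fun x => (1 - lam) * ∑' i : ℕ, lam ^ i * ((bellman P r γ)^[i + 1] v) x

/-- `v` solves the equation `v = Π T^λ v` that defines `v_LSTD(λ)`. -/
def IsLSTDLimit (P : Kernel S S) (μ : Measure S) (φ : S → Fin d → ℝ) (r : S → ℝ)
    (γ lam : ℝ) (v : S → ℝ) : Prop :=
  IsMuProjection μ φ (bellmanLam P r γ lam v) v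

/-- The eligibility trace `z_i = ∑_{k=1}^i (λγ)^{i-k} φ(X_k)`. -/
def eligTrace (φ : S → Fin d → ℝ) (γ lam : ℝ) (X : ℕ → Ω → S) (i : ℕ) (ω : Ω) : Fin d → ℝ :=
  ∑ k ∈ Finset.Icc 1 i, (lam * γ) ^ (i - k) • φ (X k ω)

/-- `Â = (n-1)⁻¹ ∑_{i=1}^{n-1} z_i (φ(X_i) - γ φ(X_{i+1}))ᵀ`, from the samples `X_1, …, X_n`. -/
def AHat (φ : S → Fin d → ℝ) (γ lam : ℝ) (X : ℕ → Ω → S) (n : ℕ) (ω : Ω) :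
    Matrix (Fin d) (Fin d) ℝ :=
  (1 / ((n : ℝ) - 1)) • ∑ i ∈ Finset.Icc 1 (n - 1),
    Matrix.vecMulVec (eligTrace φ γ lam X i ω) (φ (X i ω) - γ • φ (X (i + 1) ω))

/-- `b̂ = (n-1)⁻¹ ∑_{i=1}^{n-1} z_i r(X_i)`. -/
def bHat (φ : S → Fin d → ℝ) (r : S → ℝ) (γ lam : ℝ) (X : ℕ → Ω → S) (n : ℕ) (ω : Ω) :
    Fin d → ℝ :=
  (1 / ((n : ℝ) - 1)) • ∑ i ∈ Finset.Icc 1 (n - 1), r (X i ω) • eligTrace φ γ lam X i ω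

/-- The output of the algorithm, `v̂_LSTD(λ) = Φ Â⁻¹ b̂` (meaningful when `Â` is invertible). -/
def vHat (φ : S → Fin d → ℝ) (r : S → ℝ) (γ lam : ℝ) (X : ℕ → Ω → S) (n : ℕ) (ω : Ω) :
    S → ℝ :=
  fun x => φ x ⬝ᵥ ((AHat φ γ lam X n ω)⁻¹ *ᵥ bHat φ r γ lam X n ω)

end LSTD

/-- `Λ(x, δ) = log(8x²/δ) + log(max{4e², xβ̄})`. -/
def mixLambda (βbar x δ : ℝ) : ℝ :=
  Real.log (8 * x ^ 2 / δ) + Real.log (max (4 * Real.exp 1 ^ 2) (x * βbar))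

/-- `I(x, δ) = 32 Λ(x, δ) max{Λ(x, δ)/b, 1}^{1/κ}`. -/
def mixI (βbar b κ x δ : ℝ) : ℝ :=
  32 * mixLambda βbar x δ * (max (mixLambda βbar x δ / b) 1) ^ (1 / κ)

/-- The truncation length `⌈log(n-1) / log(1/(λγ))⌉`. -/
def truncLen (γ lam : ℝ) (n : ℕ) : ℝ :=
  (⌈Real.log ((n : ℝ) - 1) / Real.log (1 / (lam * γ))⌉ : ℤ)

/-- The left-hand side of the inequality that determines `n₀(δ)`. -/
def burnInLHS (d : ℕ) (L γ lam ν βbar b κ δ : ℝ) (n : ℕ) : ℝ :=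
  2 * d * L ^ 2 / ((1 - γ) * ν) *
    (2 / Real.sqrt ((n : ℝ) - 1) *
        Real.sqrt ((truncLen γ lam n + 1) * mixI βbar b κ ((n : ℝ) - 1) δ)
      + 1 / (((n : ℝ) - 1) * (1 - lam * γ))
      + 2 / ((n : ℝ) - 1) * truncLen γ lam n)

/-- `n₀(δ)`: the smallest integer from which on `burnInLHS < 1`. (The formula divides by
`n - 1`, so only integers `≥ 2` are considered.) -/
def burnIn (d : ℕ) (L γ lam ν βbar b κ δ : ℝ) : ℕ :=
  sInf {N : ℕ | 2 ≤ N ∧ ∀ n ≥ N, burnInLHS d L γ lam ν βbar b κ δ n < 1}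

/-- The leading term of the estimation error bound, where `Vmax = Rmax / (1 - γ)`. -/
def leadingTerm (d : ℕ) (L Rmax γ lam ν βbar b κ δ : ℝ) (n : ℕ) : ℝ :=
  4 * (Rmax / (1 - γ)) * d * L ^ 2 / (Real.sqrt ((n : ℝ) - 1) * (1 - γ) * ν) *
    Real.sqrt ((1 + truncLen γ lam n) * mixI βbar b κ ((n : ℝ) - 1) δ)

end

theorem cosh_sqrt_le_of_abs_le_one {x c w : ℝ} (hw : |w| ≤ 1) :
    Real.cosh (Real.sqrt (x ^ 2 + c ^ 2 + 2 * x * c * w)) ≤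
      Real.cosh x * Real.cosh c + w * (Real.sinh x * Real.sinh c) := by
  obtain ⟨hw1, hw2⟩ := abs_le.mp hw
  set u := x ^ 2 + c ^ 2 + 2 * x * c * w
  have hu : u = (1 + w) / 2 * (x + c) ^ 2 + (1 - w) / 2 * (x - c) ^ 2 := by
    simp only [u]; ring
  have hu0 : 0 ≤ u := by
    rw [hu]
    exact add_nonneg (mul_nonneg (by linarith) (sq_nonneg _)) (mul_nonneg (by linarith) (sq_nonneg _))
  have h1 := Real.hasSum_cosh (Real.sqrt u)
  have h2 := ((Real.hasSum_cosh (x + c)).mul_left ((1 + w) / 2)).add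
    ((Real.hasSum_cosh (x - c)).mul_left ((1 - w) / 2))
  have h3 := hasSum_le (fun n => ?_) h1 h2
  · refine h3.trans (le_of_eq ?_)
    rw [Real.cosh_add, Real.cosh_sub]; ring
  · have hcv : ConvexOn ℝ (Set.Ici 0) fun y : ℝ => y ^ n := convexOn_pow n
    have hp : 0 ≤ (1 + w) / 2 := by linarith
    have hm : 0 ≤ (1 - w) / 2 := by linarith
    have hc := hcv.2 (Set.mem_Ici.mpr (sq_nonneg (x + c)))
      (Set.mem_Ici.mpr (sq_nonneg (x - c))) hp hm (by ring)
    simp only [smul_eq_mul] at hc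
    rw [← hu] at hc
    have hf : (0 : ℝ) < ((2 * n).factorial : ℝ) := by positivity
    rw [pow_mul, Real.sq_sqrt hu0, pow_mul, pow_mul, ← mul_div_assoc, ← mul_div_assoc, ← add_div]
    exact div_le_div_of_nonneg_right hc hf.le

section Pinelis

variable {E : Type*} [NormedAddCommGroup E] [InnerProductSpace ℝ E]

/-- The multiplier `sinh ‖x‖ sinh C / (‖x‖ C)`. -/
noncomputable def coshSlope (C : ℝ) (x : E) : ℝ :=
  Real.sinh ‖x‖ * Real.sinh C / (‖x‖ * C)

theorem cosh_norm_add_le {C : ℝ} (hC : 0 < C) (x y : E) (hy : ‖y‖ ≤ C) :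
    Real.cosh ‖x + y‖ ≤ Real.cosh ‖x‖ * Real.cosh C + inner ℝ (coshSlope C x • x) y := by
  rcases eq_or_ne x 0 with rfl | hx
  · simp only [zero_add, norm_zero, Real.cosh_zero, one_mul, smul_zero, inner_zero_left, add_zero]
    exact Real.cosh_le_cosh.mpr (by rwa [abs_of_nonneg (norm_nonneg _), abs_of_pos hC])
  have hx' : 0 < ‖x‖ := norm_pos_iff.mpr hx
  set w := inner ℝ x y / (‖x‖ * C)
  have hw : |w| ≤ 1 := by
    rw [abs_div, abs_of_pos (mul_pos hx' hC), div_le_one (mul_pos hx' hC)]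
    exact (abs_real_inner_le_norm x y).trans (mul_le_mul_of_nonneg_left hy hx'.le)
  have h := cosh_sqrt_le_of_abs_le_one (x := ‖x‖) (c := C) hw
  have hle : Real.cosh ‖x + y‖ ≤
      Real.cosh (Real.sqrt (‖x‖ ^ 2 + C ^ 2 + 2 * ‖x‖ * C * w)) := by
    refine Real.cosh_le_cosh.mpr ?_
    rw [abs_of_nonneg (norm_nonneg _), abs_of_nonneg (Real.sqrt_nonneg _)]
    refine Real.le_sqrt_of_sq_le ?_
    rw [norm_add_sq_real]
    have : 2 * ‖x‖ * C * w = 2 * inner ℝ x y := by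
      simp only [w]; field_simp
    rw [this]
    have := pow_le_pow_left₀ (norm_nonneg y) hy 2
    linarith
  refine hle.trans (h.trans (le_of_eq ?_))
  rw [real_inner_smul_left, coshSlope]
  simp only [w]
  field_simp

variable {Ω : Type*} {m0 : MeasurableSpace Ω} {Pr : Measure Ω} [IsProbabilityMeasure Pr]

theorem stronglyMeasurable_coshSlope_smul {m : MeasurableSpace Ω} {C : ℝ} {M : Ω → E}
    (hM : StronglyMeasurable[m] M) : StronglyMeasurable[m] fun ω => coshSlope C (M ω) • M ω := by
  have hn : StronglyMeasurable[m] fun ω => ‖M ω‖ := hM.norm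
  have h1 : Measurable fun r : ℝ => Real.sinh r * Real.sinh C / (r * C) := by fun_prop
  exact ((h1.comp hn.measurable).stronglyMeasurable).smul hM

theorem norm_coshSlope_smul_le {C B : ℝ} (hC : 0 < C) {x : E} (hx : ‖x‖ ≤ B) :
    ‖coshSlope C x • x‖ ≤ Real.sinh B * Real.sinh C / C := by
  rw [norm_smul, coshSlope, Real.norm_of_nonneg]
  · rcases eq_or_ne ‖x‖ 0 with h | h
    · rw [h]; simp only [mul_zero]
      have : 0 ≤ Real.sinh B := Real.sinh_nonneg_iff.mpr ((norm_nonneg x).trans hx)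
      have := Real.sinh_nonneg_iff.mpr hC.le
      positivity
    · have : Real.sinh ‖x‖ * Real.sinh C / (‖x‖ * C) * ‖x‖ = Real.sinh ‖x‖ * Real.sinh C / C := by
        field_simp
      rw [this]
      have := Real.sinh_nonneg_iff.mpr hC.le
      have := Real.sinh_le_sinh.mpr hx
      gcongr
  · have := Real.sinh_nonneg_iff.mpr hC.le
    have := Real.sinh_nonneg_iff.mpr (norm_nonneg x)
    positivity

variable [CompleteSpace E]

omit [InnerProductSpace ℝ E] [CompleteSpace E] in
theorem integrable_cosh_norm {M : Ω → E} (hM : AEStronglyMeasurable M Pr) {B : ℝ}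
    (hB : ∀ᵐ ω ∂Pr, ‖M ω‖ ≤ B) : Integrable (fun ω => Real.cosh ‖M ω‖) Pr := by
  refine Integrable.of_bound (C := Real.cosh B)
    (Real.continuous_cosh.comp_aestronglyMeasurable hM.norm) ?_
  filter_upwards [hB] with ω h
  rw [Real.norm_of_nonneg (Real.cosh_pos _).le]
  exact Real.cosh_le_cosh.mpr (abs_le_abs_of_nonneg (norm_nonneg _) h)

theorem integral_inner_eq_zero_of_condExp {m : MeasurableSpace Ω} (hm : m ≤ m0) {ξ D : Ω → E}
    (hξ : StronglyMeasurable[m] ξ) {B : ℝ} (hB : ∀ᵐ ω ∂Pr, ‖ξ ω‖ ≤ B) (hD : Integrable D Pr)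
    (hD0 : Pr[D | m] =ᵐ[Pr] 0) : ∫ ω, inner ℝ (ξ ω) (D ω) ∂Pr = 0 := by
  have h := condExp_stronglyMeasurable_bilin_of_bound
    (isBoundedBilinearMap_inner (𝕜 := ℝ) (E := E)).toContinuousLinearMap hm hξ hD B hB
  rw [← integral_condExp hm (f := fun ω => inner ℝ (ξ ω) (D ω))]
  refine integral_eq_zero_of_ae ?_
  refine EventuallyEq.trans h ?_
  filter_upwards [hD0] with ω hω
  simp [hω]

theorem integral_cosh_norm_add_le {m : MeasurableSpace Ω} (hm : m ≤ m0) {M D : Ω → E} {B C : ℝ}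
    (hC : 0 < C) (hM : StronglyMeasurable[m] M) (hMB : ∀ᵐ ω ∂Pr, ‖M ω‖ ≤ B)
    (hD : AEStronglyMeasurable[m0] D Pr) (hDC : ∀ᵐ ω ∂Pr, ‖D ω‖ ≤ C) (hD0 : Pr[D | m] =ᵐ[Pr] 0) :
    ∫ ω, Real.cosh ‖M ω + D ω‖ ∂Pr ≤ Real.cosh C * ∫ ω, Real.cosh ‖M ω‖ ∂Pr := by
  have hDi : Integrable D Pr := Integrable.of_bound hD C hDC
  have hξ := stronglyMeasurable_coshSlope_smul (C := C) hM
  have hξB : ∀ᵐ ω ∂Pr, ‖coshSlope C (M ω) • M ω‖ ≤ Real.sinh B * Real.sinh C / C := by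
    filter_upwards [hMB] with ω h using norm_coshSlope_smul_le hC h
  have hz := integral_inner_eq_zero_of_condExp hm hξ hξB hDi hD0
  have hMs : AEStronglyMeasurable[m0] M Pr := (hM.mono hm).aestronglyMeasurable
  have hint : Integrable (fun ω => inner ℝ (coshSlope C (M ω) • M ω) (D ω)) Pr := by
    refine Integrable.of_bound (C := Real.sinh B * Real.sinh C / C * C)
      ((hξ.mono hm).aestronglyMeasurable.inner hD) ?_
    filter_upwards [hξB, hDC] with ω h1 h2
    exact (norm_inner_le_norm _ _).trans (mul_le_mul h1 h2 (norm_nonneg _) ((norm_nonneg _).trans h1))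
  have hci := integrable_cosh_norm hMs hMB
  calc ∫ ω, Real.cosh ‖M ω + D ω‖ ∂Pr
      ≤ ∫ ω, (Real.cosh ‖M ω‖ * Real.cosh C + inner ℝ (coshSlope C (M ω) • M ω) (D ω)) ∂Pr := by
        refine integral_mono_ae ?_ ((hci.mul_const _).add hint) ?_
        · refine integrable_cosh_norm (B := B + C) (hMs.add hD) ?_
          filter_upwards [hMB, hDC] with ω h1 h2
          exact (norm_add_le _ _).trans (add_le_add h1 h2)
        · filter_upwards [hDC] with ω h2 using cosh_norm_add_le hC _ _ h2
    _ = _ := by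
        rw [integral_add (hci.mul_const _) hint, hz, add_zero, integral_mul_const, mul_comm]

/-- A Hilbert-space Azuma inequality in exponential form (after Pinelis). -/
theorem integral_cosh_norm_sum_le {ℱ : ℕ → MeasurableSpace Ω} (hle : ∀ j, ℱ j ≤ m0)
    {D : ℕ → Ω → E} {C : ℝ} (hC : 0 < C)
    (hD : ∀ j, AEStronglyMeasurable (D j) Pr) (hDC : ∀ j, ∀ᵐ ω ∂Pr, ‖D j ω‖ ≤ C)
    (hmeas : ∀ j, StronglyMeasurable[ℱ j] fun ω => ∑ l ∈ Finset.range j, D l ω)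
    (hD0 : ∀ j, Pr[D j | ℱ j] =ᵐ[Pr] 0) (K : ℕ) :
    ∫ ω, Real.cosh ‖∑ l ∈ Finset.range K, D l ω‖ ∂Pr ≤ Real.exp (K * C ^ 2 / 2) := by
  induction K with
  | zero => simp
  | succ K ih =>
    have hMB : ∀ᵐ ω ∂Pr, ‖∑ l ∈ Finset.range K, D l ω‖ ≤ K * C := by
      filter_upwards [ae_all_iff.mpr hDC] with ω h
      refine (norm_sum_le _ _).trans ((Finset.sum_le_sum fun l _ => h l).trans (le_of_eq ?_))
      simp
    simp only [Finset.sum_range_succ]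
    refine (integral_cosh_norm_add_le (hle K) hC (hmeas K) hMB (hD K) (hDC K) (hD0 K)).trans ?_
    calc _ ≤ Real.exp (C ^ 2 / 2) * Real.exp (K * C ^ 2 / 2) :=
          mul_le_mul (Real.cosh_le_exp_half_sq C) ih
            (integral_nonneg fun ω => (Real.cosh_pos _).le) (Real.exp_pos _).le
      _ = _ := by rw [← Real.exp_add]; push_cast; ring_nf

end Pinelis

section BetaMixing

variable {Ω : Type*} {m0 : MeasurableSpace Ω} {Pr : Measure Ω} [IsProbabilityMeasure Pr]
  {E : Type*} [NormedAddCommGroup E] [NormedSpace ℝ E] [CompleteSpace E]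

theorem condExp_indicator_one_smul {m : MeasurableSpace Ω} {B : Set Ω} (hB : MeasurableSet[m0] B)
    (v : E) : Pr[fun ω => B.indicator (fun _ => (1 : ℝ)) ω • v | m] =ᵐ[Pr]
      fun ω => (Pr⟦B | m⟧) ω • v := by
  have hi : Integrable (B.indicator fun _ : Ω => (1 : ℝ)) Pr :=
    (integrable_const _).indicator hB
  have h := (ContinuousLinearMap.toSpanSingleton ℝ v).comp_condExp_comm (m := m) hi
  refine EventuallyEq.trans (Eq.eventuallyEq ?_) (h.symm.trans (Eq.eventuallyEq ?_))
  · congr 1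
  · rfl

omit [IsProbabilityMeasure Pr] in
theorem integral_indicator_one_smul {B : Set Ω} (hB : MeasurableSet B) (v : E) :
    ∫ ω, B.indicator (fun _ => (1 : ℝ)) ω • v ∂Pr = Pr.real B • v := by
  rw [integral_smul_const, integral_indicator_const _ hB, smul_eq_mul, mul_one]

theorem sum_abs_le_of_forall_subset {ι : Type*} (s : Finset ι) (f : ι → ℝ) {b : ℝ}
    (h : ∀ t ⊆ s, |∑ i ∈ t, f i| ≤ b) : ∑ i ∈ s, |f i| ≤ 2 * b := by
  classical
  rw [← Finset.sum_filter_add_sum_filter_not s (fun i => 0 ≤ f i)]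
  have h1 := h _ (Finset.filter_subset (fun i => 0 ≤ f i) s)
  have h2 := h _ (Finset.filter_subset (fun i => ¬ 0 ≤ f i) s)
  have e1 : ∑ i ∈ s.filter (fun i => 0 ≤ f i), |f i| = ∑ i ∈ s.filter (fun i => 0 ≤ f i), f i :=
    Finset.sum_congr rfl fun i hi => abs_of_nonneg (Finset.mem_filter.mp hi).2
  have e2 : ∑ i ∈ s.filter (fun i => ¬ 0 ≤ f i), |f i| =
      -∑ i ∈ s.filter (fun i => ¬ 0 ≤ f i), f i := by
    rw [← Finset.sum_neg_distrib]
    exact Finset.sum_congr rfl fun i hi =>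
      abs_of_neg (not_le.mp (Finset.mem_filter.mp hi).2)
  rw [e1, e2]
  linarith [le_abs_self (∑ i ∈ s.filter (fun i => 0 ≤ f i), f i),
    neg_abs_le (∑ i ∈ s.filter (fun i => ¬ 0 ≤ f i), f i)]

/-- The local mixing coefficient `sup_{B ∈ F} |P(B | m) - P(B)|`. -/
noncomputable def localBeta (Pr : Measure Ω) (m F : MeasurableSpace Ω) (ω : Ω) : ℝ≥0∞ :=
  ⨆ (B : Set Ω) (_ : MeasurableSet[F] B), ENNReal.ofReal |(Pr⟦B | m⟧) ω - Pr.real B|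

theorem enorm_condExp_simpleFunc_sub_integral_le {m F : MeasurableSpace Ω}
    (hF : F ≤ m0) (s : @SimpleFunc Ω F E) {c : ℝ} (hs : ∀ ω, ‖s ω‖ ≤ c) :
    ∀ᵐ ω ∂Pr, ‖(Pr[s | m]) ω - ∫ ω', s ω' ∂Pr‖ₑ ≤
      ENNReal.ofReal (2 * c) * localBeta Pr m F ω := by
  classical
  have hms : ∀ C : Set E, MeasurableSet[F] (s ⁻¹' C) := fun C =>
    @SimpleFunc.measurableSet_preimage _ _ F s C
  set p : E → Ω → ℝ := fun v ω => (Pr⟦s ⁻¹' {v} | m⟧) ω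
  have hint : ∀ C : Set E, Integrable ((s ⁻¹' C).indicator fun _ : Ω => (1 : ℝ)) Pr := fun C =>
    (integrable_const _).indicator (hF _ (hms C))
  have hC : ∀ C : Finset E, ∀ᵐ ω ∂Pr, (Pr⟦s ⁻¹' (C : Set E) | m⟧) ω = ∑ v ∈ C, p v ω := by
    intro C
    have he : (s ⁻¹' (C : Set E)).indicator (fun _ : Ω => (1 : ℝ)) =
        ∑ v ∈ C, (s ⁻¹' {v}).indicator (fun _ : Ω => (1 : ℝ)) := by
      ext ω
      simp [Set.indicator_apply]
    rw [he]
    filter_upwards [condExp_finsetSum (m := m) (μ := Pr) (fun v (_ : v ∈ C) => hint {v})] with ω h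
    rw [h]; simp [p]
  have hC' : ∀ C : Finset E, Pr.real (s ⁻¹' (C : Set E)) = ∑ v ∈ C, Pr.real (s ⁻¹' {v}) := by
    intro C
    have := measureReal_biUnion_finset (μ := Pr) (s := C) (f := fun v => s ⁻¹' {v})
      (fun a _ b _ hab => Set.disjoint_left.mpr fun x hx hy => hab (hx.symm.trans hy))
      (fun v _ => hF _ (hms {v}))
    rw [← this]
    congr 1; ext; simp
  have hsum : (s : Ω → E) =
      ∑ v ∈ s.range, fun ω => (s ⁻¹' {v}).indicator (fun _ => (1 : ℝ)) ω • v := by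
    ext ω
    rw [Finset.sum_apply, Finset.sum_eq_single (s ω)]
    · simp
    · intro v _ hv
      simp [hv.symm]
    · intro h
      exact absurd (@SimpleFunc.mem_range_self _ _ F s ω) h
  have hce : ∀ᵐ ω ∂Pr, (Pr[s | m]) ω = ∑ v ∈ s.range, p v ω • v := by
    have h1 := condExp_finsetSum (m := m) (μ := Pr) (s := s.range)
      (f := fun v ω => (s ⁻¹' {v}).indicator (fun _ => (1 : ℝ)) ω • v)
      (fun v _ => (hint {v}).smul_const v)
    rw [← hsum] at h1
    have h2 : ∀ᵐ ω ∂Pr, ∀ v ∈ s.range,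
        (Pr[fun ω => (s ⁻¹' {v}).indicator (fun _ => (1 : ℝ)) ω • v | m]) ω = p v ω • v := by
      refine (ae_ball_iff (S := (s.range : Set E)) s.range.countable_toSet).mpr fun v _ => ?_
      exact condExp_indicator_one_smul (hF _ (hms {v})) v
    filter_upwards [h1, h2] with ω h1 h2
    rw [h1, Finset.sum_apply]
    exact Finset.sum_congr rfl h2
  have hie : ∫ ω', s ω' ∂Pr = ∑ v ∈ s.range, Pr.real (s ⁻¹' {v}) • v := by
    conv_lhs => rw [hsum]
    simp only [Finset.sum_apply]
    rw [integral_finsetSum _ (fun v _ => (hint {v}).smul_const v)]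
    refine Finset.sum_congr rfl fun v _ => ?_
    exact integral_indicator_one_smul (hF _ (hms {v})) v
  have hall : ∀ᵐ ω ∂Pr, ∀ C ∈ s.range.powerset,
      (Pr⟦s ⁻¹' (C : Set E) | m⟧) ω = ∑ v ∈ C, p v ω := by
    exact (ae_ball_iff (S := (s.range.powerset : Set (Finset E)))
      s.range.powerset.countable_toSet).mpr fun C _ => hC C
  filter_upwards [hce, hall] with ω h1 h2
  rcases eq_or_ne (localBeta Pr m F ω) ∞ with htop | htop
  · by_cases hc : 0 < c
    · rw [htop, ENNReal.mul_top (by simpa using hc)]; exact le_top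
    · have h0 : ∀ ω', s ω' = 0 := fun ω' =>
        norm_le_zero_iff.mp ((hs ω').trans (not_lt.mp hc))
      have : (s : Ω → E) = 0 := funext h0
      simp [this]
  have hle : ∀ C ⊆ s.range, |∑ v ∈ C, (p v ω - Pr.real (s ⁻¹' {v}))| ≤
      (localBeta Pr m F ω).toReal := by
    intro C hCs
    rw [Finset.sum_sub_distrib, ← h2 C (Finset.mem_powerset.mpr hCs), ← hC' C]
    rw [← ENNReal.ofReal_le_iff_le_toReal htop]
    exact le_iSup₂_of_le (s ⁻¹' (C : Set E)) (hms _) le_rfl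
  have hc : 0 ≤ c := (norm_nonneg _).trans (hs ω)
  have hnorm : ‖(Pr[s | m]) ω - ∫ ω', s ω' ∂Pr‖ ≤ 2 * c * (localBeta Pr m F ω).toReal := by
    rw [h1, hie, ← Finset.sum_sub_distrib]
    calc ‖∑ v ∈ s.range, (p v ω • v - Pr.real (s ⁻¹' {v}) • v)‖
        ≤ ∑ v ∈ s.range, |p v ω - Pr.real (s ⁻¹' {v})| * c := by
          refine (norm_sum_le _ _).trans (Finset.sum_le_sum fun v hv => ?_)
          obtain ⟨ω', rfl⟩ := (@SimpleFunc.mem_range _ _ F s v).mp hv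
          rw [← sub_smul, norm_smul, Real.norm_eq_abs]
          exact mul_le_mul_of_nonneg_left (hs ω') (abs_nonneg _)
      _ ≤ _ := by
          rw [← Finset.sum_mul]
          have := sum_abs_le_of_forall_subset _ _ hle
          nlinarith
  rw [← ofReal_norm]
  calc _ ≤ ENNReal.ofReal (2 * c * (localBeta Pr m F ω).toReal) := ENNReal.ofReal_le_ofReal hnorm
    _ = _ := by rw [ENNReal.ofReal_mul (by positivity), ENNReal.ofReal_toReal htop]

theorem integral_norm_condExp_sub_integral_le {m F : MeasurableSpace Ω}
    (hF : F ≤ m0) {Y : Ω → E} (hY : StronglyMeasurable[F] Y) {c : ℝ}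
    (hYc : ∀ ω, ‖Y ω‖ ≤ c) {β : ℝ} (hβ0 : 0 ≤ β)
    (hβ : ∫⁻ ω, localBeta Pr m F ω ∂Pr ≤ ENNReal.ofReal β) :
    ∫ ω, ‖(Pr[Y | m]) ω - ∫ ω', Y ω' ∂Pr‖ ∂Pr ≤ 2 * c * β := by
  obtain ⟨ω0⟩ : Nonempty Ω := nonempty_of_isProbabilityMeasure Pr
  have hc : 0 ≤ c := (norm_nonneg _).trans (hYc ω0)
  set s : ℕ → @SimpleFunc Ω F E := fun n => hY.approxBounded c n
  have hsc : ∀ n ω, ‖s n ω‖ ≤ c := fun n ω => hY.norm_approxBounded_le hc n ω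
  have hsm : ∀ n, AEStronglyMeasurable[m0] (s n) Pr := fun n =>
    ((@SimpleFunc.stronglyMeasurable _ _ F _ (s n)).mono hF).aestronglyMeasurable
  have hYm : AEStronglyMeasurable[m0] Y Pr := (hY.mono hF).aestronglyMeasurable
  have hsi : ∀ n, Integrable (s n) Pr := fun n =>
    Integrable.of_bound (hsm n) c (ae_of_all _ (hsc n))
  have hYi : Integrable Y Pr := Integrable.of_bound hYm c (ae_of_all _ hYc)
  have h0 : ∀ n, ∫ ω, ‖(Pr[s n | m]) ω - ∫ ω', s n ω' ∂Pr‖ ∂Pr ≤ 2 * c * β := by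
    intro n
    have hi : Integrable (fun ω => (Pr[s n | m]) ω - ∫ ω', s n ω' ∂Pr) Pr :=
      integrable_condExp.sub (integrable_const _)
    rw [integral_norm_eq_lintegral_enorm hi.aestronglyMeasurable]
    refine ENNReal.toReal_le_of_le_ofReal (by positivity) ?_
    refine (lintegral_mono_ae
      (enorm_condExp_simpleFunc_sub_integral_le (m := m) hF (s n) (hsc n))).trans ?_
    rw [lintegral_const_mul' _ _ ENNReal.ofReal_ne_top, ENNReal.ofReal_mul (p := 2 * c) (by positivity)]
    exact mul_le_mul' le_rfl hβ
  have hdiff : ∀ n, ∫ ω, ‖(Pr[Y | m]) ω - ∫ ω', Y ω' ∂Pr‖ ∂Pr ≤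
      2 * c * β + 2 * ∫ ω, ‖Y ω - s n ω‖ ∂Pr := by
    intro n
    have hd : Integrable (fun ω => Y ω - s n ω) Pr := hYi.sub (hsi n)
    have h1 : ∫ ω, ‖(Pr[fun ω => Y ω - s n ω | m]) ω‖ ∂Pr ≤ ∫ ω, ‖Y ω - s n ω‖ ∂Pr :=
      integral_norm_condExp_le _
    have h2 : ‖∫ ω', Y ω' ∂Pr - ∫ ω', s n ω' ∂Pr‖ ≤ ∫ ω, ‖Y ω - s n ω‖ ∂Pr := by
      rw [← integral_sub hYi (hsi n)]
      exact norm_integral_le_integral_norm _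
    have h3 : ∀ᵐ ω ∂Pr, ‖(Pr[Y | m]) ω - ∫ ω', Y ω' ∂Pr‖ ≤
        ‖(Pr[s n | m]) ω - ∫ ω', s n ω' ∂Pr‖ + ‖(Pr[fun ω => Y ω - s n ω | m]) ω‖
          + ‖∫ ω', Y ω' ∂Pr - ∫ ω', s n ω' ∂Pr‖ := by
      filter_upwards [condExp_sub (m := m) hYi (hsi n)] with ω hω
      have hω' : (Pr[fun ω => Y ω - s n ω | m]) ω = (Pr[Y | m]) ω - (Pr[s n | m]) ω := hω
      rw [hω']
      have e : (Pr[Y | m]) ω - ∫ ω', Y ω' ∂Pr = ((Pr[s n | m]) ω - ∫ ω', s n ω' ∂Pr) +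
          ((Pr[Y | m]) ω - (Pr[s n | m]) ω) - (∫ ω', Y ω' ∂Pr - ∫ ω', s n ω' ∂Pr) := by abel
      rw [e]
      exact (norm_sub_le _ _).trans (add_le_add_left (norm_add_le _ _) _)
    have i1 : Integrable (fun ω => ‖(Pr[s n | m]) ω - ∫ ω', s n ω' ∂Pr‖) Pr :=
      (integrable_condExp.sub (integrable_const _)).norm
    have i2 : Integrable (fun ω => ‖(Pr[fun ω => Y ω - s n ω | m]) ω‖) Pr :=
      integrable_condExp.norm
    have i12 : Integrable (fun ω => ‖(Pr[s n | m]) ω - ∫ ω', s n ω' ∂Pr‖ +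
        ‖(Pr[fun ω => Y ω - s n ω | m]) ω‖) Pr := i1.add i2
    have iY : Integrable (fun ω => ‖(Pr[Y | m]) ω - ∫ ω', Y ω' ∂Pr‖) Pr :=
      (integrable_condExp.sub (integrable_const _)).norm
    have h4 := integral_mono_ae iY (i12.add (integrable_const _)) h3
    have h5 : ∫ ω, (‖(Pr[s n | m]) ω - ∫ ω', s n ω' ∂Pr‖ + ‖(Pr[fun ω => Y ω - s n ω | m]) ω‖
          + ‖∫ ω', Y ω' ∂Pr - ∫ ω', s n ω' ∂Pr‖) ∂Pr =
        ∫ ω, ‖(Pr[s n | m]) ω - ∫ ω', s n ω' ∂Pr‖ ∂Pr +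
        ∫ ω, ‖(Pr[fun ω => Y ω - s n ω | m]) ω‖ ∂Pr +
        ‖∫ ω', Y ω' ∂Pr - ∫ ω', s n ω' ∂Pr‖ := by
      rw [integral_add i12 (integrable_const _), integral_add i1 i2]
      simp
    have h6 := h4.trans (le_of_eq h5)
    linarith [h0 n]
  have hlim : Tendsto (fun n => ∫ ω, ‖Y ω - s n ω‖ ∂Pr) atTop (nhds 0) := by
    have := tendsto_integral_of_dominated_convergence (μ := Pr)
      (F := fun n ω => ‖Y ω - s n ω‖) (f := fun _ => (0 : ℝ)) (fun _ => 2 * c)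
      (fun n => (hYm.sub (hsm n)).norm) (integrable_const _)
      (fun n => ae_of_all _ fun ω => by
        rw [norm_norm]
        exact (norm_sub_le _ _).trans (by linarith [hYc ω, hsc n ω]))
      (ae_of_all _ fun ω => by
        have h := hY.tendsto_approxBounded_of_norm_le (hYc ω)
        have h' := (tendsto_const_nhds (x := Y ω)).sub h
        rw [sub_self] at h'
        simpa using h'.norm)
    simpa using this
  have hl2 := (tendsto_const_nhds (x := 2 * c * β)).add (hlim.const_mul 2)
  simp only [mul_zero, add_zero] at hl2
  exact ge_of_tendsto' hl2 hdiff

end BetaMixing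

theorem lintegral_localBeta_le_betaCoeff {S : Type*} [MeasurableSpace S] {Ω : Type*}
    [MeasurableSpace Ω] (Pr : Measure Ω) (X : ℕ → Ω → S) {t i : ℕ} (ht : 1 ≤ t) :
    ∫⁻ ω, localBeta Pr (pastSigma X t) (futureSigma X (t + i)) ω ∂Pr ≤ betaCoeff Pr X i :=
  le_iSup₂_of_le (f := fun (t : ℕ) (_ : 1 ≤ t) =>
    ∫⁻ ω, localBeta Pr (pastSigma X t) (futureSigma X (t + i)) ω ∂Pr) t ht le_rfl

theorem sum_range_mul_eq_sum_residue {E : Type*} [AddCommMonoid E] (f : ℕ → E) (a K : ℕ) :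
    ∑ i ∈ Finset.range (a * K), f i =
      ∑ r ∈ Finset.range a, ∑ j ∈ Finset.range K, f (r + j * a) := by
  rw [Finset.sum_comm]
  induction K with
  | zero => simp
  | succ K ih =>
    rw [Nat.mul_succ, Finset.sum_range_add, ih, Finset.sum_range_succ]
    congr 1
    refine Finset.sum_congr rfl fun r _ => ?_
    rw [mul_comm, add_comm]

section BlockConcentration

variable {Ω : Type*} {m0 : MeasurableSpace Ω} {Pr : Measure Ω} [IsProbabilityMeasure Pr]
  {E : Type*} [NormedAddCommGroup E] [InnerProductSpace ℝ E] [CompleteSpace E]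

omit [InnerProductSpace ℝ E] [CompleteSpace E] in
theorem exp_norm_sum_div_le [NormedSpace ℝ E] {a : ℕ} (ha : 0 < a) (M : ℕ → E) (s : ℝ)
    (hs : 0 ≤ s) :
    Real.exp (s / a * ‖∑ r ∈ Finset.range a, M r‖) ≤
      ∑ r ∈ Finset.range a, (1 / (a : ℝ)) * (2 * Real.cosh ‖s • M r‖) := by
  have ha' : (0 : ℝ) < a := by exact_mod_cast ha
  have hconv := convexOn_exp.map_sum_le (t := Finset.range a) (w := fun _ => 1 / (a : ℝ))
    (p := fun r => s * ‖M r‖) (fun _ _ => by positivity) (by simp [ha'.ne'])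
    (fun _ _ => Set.mem_univ _)
  simp only [smul_eq_mul] at hconv
  calc Real.exp (s / a * ‖∑ r ∈ Finset.range a, M r‖)
      ≤ Real.exp (∑ r ∈ Finset.range a, 1 / (a : ℝ) * (s * ‖M r‖)) := by
        refine Real.exp_le_exp.mpr ?_
        rw [← Finset.mul_sum, ← Finset.mul_sum, ← mul_assoc, one_div_mul_eq_div]
        exact mul_le_mul_of_nonneg_left (norm_sum_le _ _) (by positivity)
    _ ≤ _ := hconv.trans (Finset.sum_le_sum fun r _ => by
        gcongr
        rw [norm_smul, Real.norm_of_nonneg hs, Real.cosh_eq]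
        linarith [Real.exp_pos (-(s * ‖M r‖))])

variable {ℱ : ℕ → MeasurableSpace Ω} {Y : ℕ → Ω → E} {c : ℝ}

theorem integral_exp_norm_sum_le (hmono : Monotone ℱ) (hle : ∀ i, ℱ i ≤ m0)
    (hY : ∀ i, StronglyMeasurable[ℱ (i + 1)] (Y i)) (hc : 0 < c) (hYc : ∀ i ω, ‖Y i ω‖ ≤ c)
    {a : ℕ} (ha : 0 < a) (K : ℕ) {s : ℝ} (hs : 0 < s) :
    Integrable (fun ω => Real.exp (s / a * ‖∑ i ∈ Finset.range (a * K),
      (Y i ω - (Pr[Y i | ℱ (i + 1 - a)]) ω)‖)) Pr ∧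
    ∫ ω, Real.exp (s / a * ‖∑ i ∈ Finset.range (a * K),
      (Y i ω - (Pr[Y i | ℱ (i + 1 - a)]) ω)‖) ∂Pr ≤ 2 * Real.exp (2 * K * c ^ 2 * s ^ 2) := by
  have ha' : (0 : ℝ) < a := by exact_mod_cast ha
  set D : ℕ → ℕ → Ω → E := fun r j ω =>
    s • (Y (r + j * a) ω - (Pr[Y (r + j * a) | ℱ (r + j * a + 1 - a)]) ω)
  have hYm : ∀ i, AEStronglyMeasurable[m0] (Y i) Pr := fun i =>
    ((hY i).mono (hle _)).aestronglyMeasurable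
  have hYi : ∀ i, Integrable (Y i) Pr := fun i =>
    Integrable.of_bound (hYm i) c (ae_of_all _ (hYc i))
  have hDm : ∀ r j, AEStronglyMeasurable[m0] (D r j) Pr := fun r j =>
    ((hYi _).sub integrable_condExp).aestronglyMeasurable.const_smul s
  have hdb : ∀ i k, ∀ᵐ ω ∂Pr, ‖Y i ω - (Pr[Y i | ℱ k]) ω‖ ≤ 2 * c := by
    intro i k
    filter_upwards [ae_bdd_norm_condExp_of_ae_bdd_norm (m := ℱ k) (ae_of_all Pr (hYc i))] with ω h
    exact (norm_sub_le _ _).trans (by linarith [hYc i ω])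
  have hDC : ∀ r j, ∀ᵐ ω ∂Pr, ‖D r j ω‖ ≤ s * (2 * c) := by
    intro r j
    filter_upwards [hdb (r + j * a) (r + j * a + 1 - a)] with ω h
    rw [norm_smul, Real.norm_of_nonneg hs.le]
    exact mul_le_mul_of_nonneg_left h hs.le
  have hmeas : ∀ r j, StronglyMeasurable[ℱ (r + j * a + 1 - a)]
      fun ω => ∑ l ∈ Finset.range j, D r l ω := by
    intro r j
    refine Finset.stronglyMeasurable_fun_sum _ fun l hl => ?_
    have hl' : (l + 1) * a ≤ j * a := Nat.mul_le_mul_right a (Finset.mem_range.mp hl)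
    rw [add_mul, one_mul] at hl'
    refine StronglyMeasurable.const_smul (StronglyMeasurable.sub ?_ ?_) s
    · exact (hY _).mono (hmono (by omega))
    · exact stronglyMeasurable_condExp.mono (hmono (by omega))
  have hD0 : ∀ r j, Pr[D r j | ℱ (r + j * a + 1 - a)] =ᵐ[Pr] 0 := by
    intro r j
    set k := r + j * a + 1 - a
    have h1 := condExp_smul (μ := Pr) s
      (fun ω => Y (r + j * a) ω - (Pr[Y (r + j * a) | ℱ k]) ω) (ℱ k)
    have h2 := condExp_sub (m := ℱ k) (hYi (r + j * a))
      (integrable_condExp (m := ℱ k) (μ := Pr) (f := Y (r + j * a)))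
    have h3 := condExp_of_stronglyMeasurable (hle k)
      (stronglyMeasurable_condExp (m := ℱ k) (μ := Pr) (f := Y (r + j * a))) integrable_condExp
    rw [h3, sub_self] at h2
    refine EventuallyEq.trans h1 ?_
    filter_upwards [h2] with ω h
    have h' : (Pr[fun ω => Y (r + j * a) ω - (Pr[Y (r + j * a) | ℱ k]) ω | ℱ k]) ω = 0 := h
    rw [Pi.smul_apply, h', smul_zero, Pi.zero_apply]
  have hcosh := fun r => integral_cosh_norm_sum_le (Pr := Pr)
    (ℱ := fun j => ℱ (r + j * a + 1 - a)) (fun j => hle _)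
    (D := D r) (C := s * (2 * c)) (by positivity) (hDm r) (hDC r) (hmeas r) (hD0 r) K
  have hpt : ∀ ω, Real.exp (s / a * ‖∑ i ∈ Finset.range (a * K),
      (Y i ω - (Pr[Y i | ℱ (i + 1 - a)]) ω)‖) ≤
      ∑ r ∈ Finset.range a, (1 / (a : ℝ)) *
        (2 * Real.cosh ‖∑ l ∈ Finset.range K, D r l ω‖) := by
    intro ω
    rw [sum_range_mul_eq_sum_residue]
    refine (exp_norm_sum_div_le ha _ s hs.le).trans (le_of_eq ?_)
    simp only [D, Finset.smul_sum]
  have hci : ∀ r, Integrable (fun ω => Real.cosh ‖∑ l ∈ Finset.range K, D r l ω‖) Pr := by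
    intro r
    refine integrable_cosh_norm (B := K * (s * (2 * c)))
      ((hmeas r K).mono (hle _)).aestronglyMeasurable ?_
    filter_upwards [ae_all_iff.mpr (hDC r)] with ω h
    refine (norm_sum_le _ _).trans ((Finset.sum_le_sum fun l _ => h l).trans (le_of_eq ?_))
    simp
  have hsi : Integrable (fun ω => ∑ r ∈ Finset.range a, (1 / (a : ℝ)) *
        (2 * Real.cosh ‖∑ l ∈ Finset.range K, D r l ω‖)) Pr :=
    integrable_finsetSum _ fun r _ => ((hci r).const_mul 2).const_mul _
  have hdm : AEStronglyMeasurable[m0] (fun ω => ∑ i ∈ Finset.range (a * K),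
      (Y i ω - (Pr[Y i | ℱ (i + 1 - a)]) ω)) Pr :=
    (integrable_finsetSum _ fun i _ =>
      (hYi i).sub (integrable_condExp (m := ℱ (i + 1 - a)))).aestronglyMeasurable
  have hint : Integrable (fun ω => Real.exp (s / a * ‖∑ i ∈ Finset.range (a * K),
      (Y i ω - (Pr[Y i | ℱ (i + 1 - a)]) ω)‖)) Pr := by
    refine hsi.mono (Real.continuous_exp.comp_aestronglyMeasurable (hdm.norm.const_mul _)) ?_
    refine ae_of_all _ fun ω => ?_
    rw [Real.norm_of_nonneg (Real.exp_pos _).le]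
    exact (hpt ω).trans (le_abs_self _)
  refine ⟨hint, (integral_mono hint hsi hpt).trans ?_⟩
  rw [integral_finsetSum _ fun r _ => ((hci r).const_mul 2).const_mul _]
  have hterm : ∀ r ∈ Finset.range a, ∫ ω, (1 / (a : ℝ)) *
      (2 * Real.cosh ‖∑ l ∈ Finset.range K, D r l ω‖) ∂Pr ≤
      (1 / (a : ℝ)) * (2 * Real.exp (2 * K * c ^ 2 * s ^ 2)) := by
    intro r _
    rw [integral_const_mul, integral_const_mul]
    have := hcosh r
    have e : (K : ℝ) * (s * (2 * c)) ^ 2 / 2 = 2 * K * c ^ 2 * s ^ 2 := by ring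
    rw [e] at this
    gcongr
  refine (Finset.sum_le_sum hterm).trans (le_of_eq ?_)
  rw [Finset.sum_const, Finset.card_range, nsmul_eq_mul]
  field_simp

/-- Concentration of a sum of bounded vectors whose conditional means given the distant past are
close to the means on average. -/
theorem measureReal_norm_sum_sub_integral_ge_le (hmono : Monotone ℱ) (hle : ∀ i, ℱ i ≤ m0)
    (hY : ∀ i, StronglyMeasurable[ℱ (i + 1)] (Y i)) (hc : 0 < c) (hYc : ∀ i ω, ‖Y i ω‖ ≤ c)
    {a K : ℕ} (ha : 0 < a) (hK : 0 < K) {η T₁ T₂ : ℝ} (hT₁ : 0 < T₁) (hT₂ : 0 < T₂)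
    (hη : ∑ i ∈ Finset.range (a * K),
      ∫ ω, ‖(Pr[Y i | ℱ (i + 1 - a)]) ω - ∫ ω', Y i ω' ∂Pr‖ ∂Pr ≤ η) :
    Pr.real {ω | T₁ + T₂ ≤ ‖∑ i ∈ Finset.range (a * K), (Y i ω - ∫ ω', Y i ω' ∂Pr)‖} ≤
      2 * Real.exp (-(T₁ ^ 2 / (8 * K * a ^ 2 * c ^ 2))) + η / T₂ := by
  have ha' : (0 : ℝ) < a := by exact_mod_cast ha
  have hK' : (0 : ℝ) < K := by exact_mod_cast hK
  set s : ℝ := T₁ / (4 * K * c ^ 2 * a)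
  have hs : 0 < s := by positivity
  obtain ⟨hint, hexp⟩ := integral_exp_norm_sum_le (Pr := Pr) hmono hle hY hc hYc ha K hs
  set M : Ω → E := fun ω => ∑ i ∈ Finset.range (a * K), (Y i ω - (Pr[Y i | ℱ (i + 1 - a)]) ω)
  set R : Ω → ℝ := fun ω => ∑ i ∈ Finset.range (a * K),
    ‖(Pr[Y i | ℱ (i + 1 - a)]) ω - ∫ ω', Y i ω' ∂Pr‖
  have hRi : ∀ i, Integrable
      (fun ω => ‖(Pr[Y i | ℱ (i + 1 - a)]) ω - ∫ ω', Y i ω' ∂Pr‖) Pr := fun i =>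
    (integrable_condExp.sub (integrable_const _)).norm
  have hR : Pr.real {ω | T₂ ≤ R ω} ≤ η / T₂ := by
    rw [le_div_iff₀ hT₂, mul_comm]
    refine (mul_meas_ge_le_integral_of_nonneg (f := R)
      (ae_of_all _ fun ω => Finset.sum_nonneg fun i _ => norm_nonneg _)
      (integrable_finsetSum _ fun i _ => hRi i) T₂).trans ?_
    rw [integral_finsetSum _ fun i _ => hRi i]
    exact hη
  have hM : Pr.real {ω | T₁ ≤ ‖M ω‖} ≤ 2 * Real.exp (-(T₁ ^ 2 / (8 * K * a ^ 2 * c ^ 2))) := by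
    have h1 := mul_meas_ge_le_integral_of_nonneg (f := fun ω => Real.exp (s / a * ‖M ω‖))
      (ae_of_all _ fun ω => (Real.exp_pos _).le) hint (Real.exp (s / a * T₁))
    have hset : {ω | T₁ ≤ ‖M ω‖} = {ω | Real.exp (s / a * T₁) ≤ Real.exp (s / a * ‖M ω‖)} := by
      ext ω
      simp only [Set.mem_ofPred_eq, Real.exp_le_exp]
      rw [mul_le_mul_iff_right₀ (by positivity)]
    rw [← hset] at h1
    have h2 := h1.trans hexp
    rw [mul_comm, ← le_div_iff₀ (Real.exp_pos _), mul_div_assoc, ← Real.exp_sub] at h2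
    refine h2.trans (le_of_eq ?_)
    congr 2
    simp only [s]
    field_simp
    ring
  refine (measureReal_mono (fun ω hω => ?_) (by finiteness)).trans
    ((measureReal_union_le {ω | T₁ ≤ ‖M ω‖} {ω | T₂ ≤ R ω}).trans (add_le_add hM hR))
  simp only [Set.mem_ofPred_eq, Set.mem_union] at hω ⊢
  by_contra! hcon
  have hsplit : ∑ i ∈ Finset.range (a * K), (Y i ω - ∫ ω', Y i ω' ∂Pr) = M ω +
      ∑ i ∈ Finset.range (a * K), ((Pr[Y i | ℱ (i + 1 - a)]) ω - ∫ ω', Y i ω' ∂Pr) := by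
    rw [← Finset.sum_add_distrib]
    exact Finset.sum_congr rfl fun i _ => by abel
  rw [hsplit] at hω
  have h1 := norm_add_le (M ω)
    (∑ i ∈ Finset.range (a * K), ((Pr[Y i | ℱ (i + 1 - a)]) ω - ∫ ω', Y i ω' ∂Pr))
  have h2 : ‖∑ i ∈ Finset.range (a * K), ((Pr[Y i | ℱ (i + 1 - a)]) ω - ∫ ω', Y i ω' ∂Pr)‖ ≤ R ω :=
    norm_sum_le _ _
  linarith [hcon.1, hcon.2]

end BlockConcentration

section MixingRate

variable {βbar b κ δ x : ℝ}

theorem exp_neg_mixLambda (hx : 1 ≤ x) (hδ : 0 < δ) :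
    Real.exp (-mixLambda βbar x δ) =
      δ / (8 * x ^ 2) / max (4 * Real.exp 1 ^ 2) (x * βbar) := by
  have hm : 0 < max (4 * Real.exp 1 ^ 2) (x * βbar) := lt_max_of_lt_left (by positivity)
  rw [mixLambda, Real.exp_neg, Real.exp_add, Real.exp_log (by positivity), Real.exp_log hm]
  field_simp

theorem one_le_mixLambda (hx : 1 ≤ x) (hδ : δ ∈ Set.Ioo (0 : ℝ) 1) : 1 ≤ mixLambda βbar x δ := by
  have h1 : 0 ≤ Real.log (8 * x ^ 2 / δ) := by
    refine Real.log_nonneg ?_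
    rw [le_div_iff₀ hδ.1]
    nlinarith [hδ.2]
  have h2 : 1 ≤ Real.log (max (4 * Real.exp 1 ^ 2) (x * βbar)) := by
    rw [Real.le_log_iff_exp_le (lt_max_of_lt_left (by positivity))]
    refine le_max_of_le_left ?_
    nlinarith [Real.add_one_le_exp (1 : ℝ)]
  unfold mixLambda; linarith

theorem two_mul_exp_neg_mixLambda_le (hx : 1 ≤ x) (hδ : 0 < δ) :
    2 * Real.exp (-mixLambda βbar x δ) ≤ δ / (16 * x ^ 2) := by
  rw [exp_neg_mixLambda hx hδ]
  have h4 : 4 ≤ max (4 * Real.exp 1 ^ 2) (x * βbar) :=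
    le_max_of_le_left (by nlinarith [Real.add_one_le_exp (1 : ℝ)])
  have h : δ / (8 * x ^ 2) / max (4 * Real.exp 1 ^ 2) (x * βbar) ≤ δ / (8 * x ^ 2) / 4 :=
    div_le_div_of_nonneg_left (by positivity) (by norm_num) h4
  have e : δ / (16 * x ^ 2) = 2 * (δ / (8 * x ^ 2) / 4) := by field_simp; norm_num
  rw [e]; linarith

theorem mul_exp_neg_mixLambda_le (hx : 1 ≤ x) (hδ : 0 < δ) (hβ : 0 < βbar) :
    βbar * Real.exp (-mixLambda βbar x δ) ≤ δ / (8 * x ^ 3) := by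
  rw [exp_neg_mixLambda hx hδ]
  have hx0 : 0 < x := by linarith
  have h : δ / (8 * x ^ 2) / max (4 * Real.exp 1 ^ 2) (x * βbar) ≤ δ / (8 * x ^ 2) / (x * βbar) :=
    div_le_div_of_nonneg_left (by positivity) (by positivity) (le_max_right _ _)
  have e : δ / (8 * x ^ 3) = βbar * (δ / (8 * x ^ 2) / (x * βbar)) := by field_simp
  rw [e]
  exact mul_le_mul_of_nonneg_left h hβ.le

/-- The decorrelation time `max {Λ/b, 1}^{1/κ}`. -/
noncomputable def mixTime (βbar b κ x δ : ℝ) : ℝ :=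
  (max (mixLambda βbar x δ / b) 1) ^ (1 / κ)

theorem mixI_eq : mixI βbar b κ x δ = 32 * mixLambda βbar x δ * mixTime βbar b κ x δ := rfl

theorem one_le_mixTime (hκ : 0 < κ) : 1 ≤ mixTime βbar b κ x δ :=
  Real.one_le_rpow (le_max_right _ _) (by positivity)

theorem mixLambda_le_mul_rpow (hb : 0 < b) (hκ : 0 < κ) {g : ℝ}
    (hg : mixTime βbar b κ x δ ≤ g) : mixLambda βbar x δ ≤ b * g ^ κ := by
  have h0 : (0 : ℝ) ≤ max (mixLambda βbar x δ / b) 1 := le_max_of_le_right zero_le_one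
  have h1 : mixTime βbar b κ x δ ^ κ ≤ g ^ κ :=
    Real.rpow_le_rpow (Real.rpow_nonneg h0 _) hg hκ.le
  rw [mixTime, ← Real.rpow_mul h0, one_div_mul_cancel hκ.ne', Real.rpow_one] at h1
  have h2 := (le_max_left _ _).trans h1
  rwa [div_le_iff₀' hb] at h2

end MixingRate

section WindowConcentration

variable {S : Type*} [MeasurableSpace S] {Ω : Type*} [m0 : MeasurableSpace Ω] {Pr : Measure Ω}
  [IsProbabilityMeasure Pr] {X : ℕ → Ω → S}

omit m0 in
theorem pastSigma_mono (X : ℕ → Ω → S) : Monotone (pastSigma X) := fun _ _ hst =>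
  biSup_mono fun _ hi => ⟨hi.1, hi.2.trans hst⟩

theorem pastSigma_le (hX : ∀ i ≥ 1, Measurable (X i)) (t : ℕ) : pastSigma X t ≤ m0 :=
  iSup₂_le fun i hi => (hX i hi.1).comap_le

theorem futureSigma_le (hX : ∀ i ≥ 1, Measurable (X i)) {t : ℕ} (ht : 1 ≤ t) :
    futureSigma X t ≤ m0 :=
  iSup₂_le fun i hi => (hX i (ht.trans hi)).comap_le

omit m0 in
theorem pastSigma_zero (X : ℕ → Ω → S) : pastSigma X 0 = ⊥ := by
  simp [pastSigma]

/-- The relative deviation level `(2/√N) √((m + 1) I(N, δ))`. -/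
noncomputable def devLevel (βbar b κ δ : ℝ) (m N : ℝ) : ℝ :=
  2 / Real.sqrt N * Real.sqrt ((m + 1) * mixI βbar b κ N δ)

variable {βbar b κ δ : ℝ}

theorem mul_devLevel_sq {m N : ℝ} (hN : 1 ≤ N) (hm : 0 ≤ m) (hκ : 0 < κ)
    (hδ : δ ∈ Set.Ioo (0 : ℝ) 1) : N * devLevel βbar b κ δ m N ^ 2 =
      128 * (m + 1) * mixLambda βbar N δ * mixTime βbar b κ N δ := by
  have h1 := one_le_mixLambda (βbar := βbar) hN hδ
  have h2 := one_le_mixTime (βbar := βbar) (b := b) (x := N) (δ := δ) hκ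
  have h3 : 0 ≤ (m + 1) * (32 * mixLambda βbar N δ * mixTime βbar b κ N δ) := by positivity
  rw [devLevel, mul_pow, div_pow, Real.sq_sqrt (by linarith), mixI_eq, Real.sq_sqrt h3]
  have : N ≠ 0 := by linarith
  field_simp
  ring

variable {E : Type*} [NormedAddCommGroup E] [InnerProductSpace ℝ E] [CompleteSpace E]

set_option maxHeartbeats 1000000 in
/-- Concentration of window functions of a geometrically beta-mixing process. -/
theorem measureReal_norm_window_sum_ge_le (hX : ∀ i ≥ 1, Measurable (X i))
    (hβbar : 0 < βbar) (hb : 0 < b) (hκ : 0 < κ) (hδ : δ ∈ Set.Ioo (0 : ℝ) 1)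
    (hmix : ∀ i : ℕ, 1 ≤ i →
      betaCoeff Pr X i ≤ ENNReal.ofReal (βbar * Real.exp (-b * (i : ℝ) ^ κ)))
    {m N : ℕ} (hm : 1 ≤ m) (hN : 1 ≤ N) {Y : ℕ → Ω → E} {c : ℝ} (hc : 0 < c)
    (hYp : ∀ i ∈ Finset.Icc m N, StronglyMeasurable[pastSigma X (i + 1)] (Y i))
    (hYf : ∀ i ∈ Finset.Icc m N, StronglyMeasurable[futureSigma X (i + 1 - m)] (Y i))
    (hYc : ∀ i ∈ Finset.Icc m N, ∀ ω, ‖Y i ω‖ ≤ c) (hτ : devLevel βbar b κ δ m N < 2) :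
    Pr.real {ω | c * N * devLevel βbar b κ δ m N ≤
      ‖∑ i ∈ Finset.Icc m N, (Y i ω - ∫ ω', Y i ω' ∂Pr)‖} ≤ δ / (8 * N ^ 2) := by
  have hN' : (1 : ℝ) ≤ N := by exact_mod_cast hN
  set Λ := mixLambda βbar N δ with hΛ
  set M := mixTime βbar b κ N δ with hM
  set τ := devLevel βbar b κ δ m N with hτdef
  have hΛ1 : 1 ≤ Λ := one_le_mixLambda hN' hδ
  have hM1 : 1 ≤ M := one_le_mixTime hκ
  have hm1 : (1 : ℝ) ≤ m := by exact_mod_cast hm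
  have hm0 : (0 : ℝ) ≤ m := Nat.cast_nonneg m
  have hτ2 : N * τ ^ 2 = 128 * (m + 1) * Λ * M := mul_devLevel_sq hN' hm0 hκ hδ
  have hτ0 : 0 ≤ τ := by simp only [hτdef, devLevel]; positivity
  have hmM : 1 ≤ (m + 1) * M := by nlinarith
  have hmΛM : (m + 1) * M ≤ (m + 1) * Λ * M := by nlinarith
  have hτpos : 0 < τ := by
    rcases hτ0.eq_or_lt with h | h
    · rw [← h] at hτ2; nlinarith
    · exact h
  set g : ℕ := ⌈M⌉₊ with hg
  have hgM : M ≤ g := Nat.le_ceil M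
  have hg2 : (g : ℝ) ≤ 2 * M := by
    have := Nat.ceil_lt_add_one (by linarith : (0 : ℝ) ≤ M)
    linarith
  have hg1 : 1 ≤ g := Nat.one_le_iff_ne_zero.mpr (by
    intro h
    rw [h] at hgM
    norm_num at hgM
    linarith)
  set a : ℕ := m + g with ha
  have ha2 : (a : ℝ) ≤ 2 * ((m + 1) * M) := by
    rw [ha]; push_cast; nlinarith
  have haN' : (a : ℝ) ≤ N := by
    have : (N : ℝ) * τ ^ 2 ≤ N * 4 := by
      refine mul_le_mul_of_nonneg_left ?_ (by linarith)
      nlinarith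
    nlinarith
  have haN : a ≤ N := by exact_mod_cast haN'
  have ha0 : 0 < a := by omega
  have ha0' : (0 : ℝ) < a := by exact_mod_cast ha0
  set K : ℕ := N / a + 1 with hK
  have hKa : a * K ≤ 2 * N := by
    have := Nat.mul_div_le N a
    rw [hK, mul_add]; omega
  have hKa' : (K : ℝ) * a ≤ 2 * N := by
    rw [mul_comm]; exact_mod_cast hKa
  have hKN : N < a * K := Nat.lt_mul_div_succ N ha0
  classical
  set Z : ℕ → Ω → E := fun i => if i ∈ Finset.Icc m N then Y i else 0 with hZ
  have hZc : ∀ i ω, ‖Z i ω‖ ≤ c := by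
    intro i ω
    by_cases hi : i ∈ Finset.Icc m N
    · simpa only [hZ, if_pos hi] using hYc i hi ω
    · simp only [hZ, if_neg hi, Pi.zero_apply, norm_zero]; exact hc.le
  have hZp : ∀ i, StronglyMeasurable[pastSigma X (i + 1)] (Z i) := by
    intro i
    by_cases hi : i ∈ Finset.Icc m N
    · simpa only [hZ, if_pos hi] using hYp i hi
    · simp only [hZ, if_neg hi]; exact stronglyMeasurable_zero
  have hβg : βbar * Real.exp (-b * (g : ℝ) ^ κ) ≤ δ / (8 * N ^ 3) := by
    refine le_trans ?_ (mul_exp_neg_mixLambda_le hN' hδ.1 hβbar)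
    refine mul_le_mul_of_nonneg_left (Real.exp_le_exp.mpr ?_) hβbar.le
    have := mixLambda_le_mul_rpow (x := N) (δ := δ) (βbar := βbar) hb hκ hgM
    linarith
  have hη : ∑ i ∈ Finset.range (a * K),
      ∫ ω, ‖(Pr[Z i | pastSigma X (i + 1 - a)]) ω - ∫ ω', Z i ω' ∂Pr‖ ∂Pr ≤
        N * (2 * c * (δ / (8 * N ^ 3))) := by
    have hterm : ∀ i ∈ Finset.range (a * K),
        ∫ ω, ‖(Pr[Z i | pastSigma X (i + 1 - a)]) ω - ∫ ω', Z i ω' ∂Pr‖ ∂Pr ≤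
          if i ∈ Finset.Icc m N then 2 * c * (δ / (8 * N ^ 3)) else 0 := by
      intro i _
      by_cases hi : i ∈ Finset.Icc m N
      · simp only [hZ, if_pos hi]
        obtain ⟨him, hiN⟩ := Finset.mem_Icc.mp hi
        rcases Nat.eq_zero_or_pos (i + 1 - a) with h0 | hpos
        · have hδ0 := hδ.1
          rw [h0, pastSigma_zero, condExp_bot]
          simp only [sub_self, norm_zero, integral_zero]
          positivity
        · refine (integral_norm_condExp_sub_integral_le (β := βbar * Real.exp (-b * (g : ℝ) ^ κ))
            (futureSigma_le hX (t := i + 1 - m) (by omega)) (hYf i hi) (hYc i hi)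
            (by positivity) ?_).trans (mul_le_mul_of_nonneg_left hβg (by positivity))
          have e : i + 1 - m = i + 1 - a + g := by omega
          rw [e]
          exact (lintegral_localBeta_le_betaCoeff Pr X hpos).trans (hmix g hg1)
      · simp only [hZ, if_neg hi, condExp_zero]
        simp
    refine (Finset.sum_le_sum hterm).trans ?_
    rw [← Finset.sum_filter, Finset.sum_const, nsmul_eq_mul]
    have hcard : ((Finset.range (a * K)).filter (· ∈ Finset.Icc m N)).card ≤ N := by
      refine (Finset.card_le_card (fun i hi => (Finset.mem_filter.mp hi).2)).trans ?_
      rw [Nat.card_Icc]; omega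
    have hδ0 := hδ.1
    exact mul_le_mul_of_nonneg_right (by exact_mod_cast hcard) (by positivity)
  have hT : 0 < c * N * τ / 2 := by positivity
  have hmain := measureReal_norm_sum_sub_integral_ge_le (Pr := Pr) (pastSigma_mono X)
    (pastSigma_le hX) hZp hc hZc ha0 (K := K) (Nat.succ_pos _) hT hT hη
  have hsum : ∀ ω, ∑ i ∈ Finset.range (a * K), (Z i ω - ∫ ω', Z i ω' ∂Pr) =
      ∑ i ∈ Finset.Icc m N, (Y i ω - ∫ ω', Y i ω' ∂Pr) := by
    intro ω
    rw [← Finset.sum_subset (s₁ := Finset.Icc m N)]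
    · exact Finset.sum_congr rfl fun i hi => by simp only [hZ, if_pos hi]
    · intro i hi
      exact Finset.mem_range.mpr (lt_of_le_of_lt (Finset.mem_Icc.mp hi).2 hKN)
    · intro i _ hi
      simp only [hZ, if_neg hi, Pi.zero_apply, integral_zero, sub_zero]
  simp only [hsum, add_halves] at hmain
  refine hmain.trans ?_
  have hδ0 := hδ.1
  have hexp : Λ ≤ (c * N * τ / 2) ^ 2 / (8 * K * a ^ 2 * c ^ 2) := by
    have hK0 : (0 : ℝ) < K := by exact_mod_cast Nat.succ_pos _
    rw [le_div_iff₀ (by positivity)]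
    have e : (c * N * τ / 2) ^ 2 = c ^ 2 * N * (N * τ ^ 2) / 4 := by ring
    rw [e, hτ2]
    have h1 : (K : ℝ) * a * a ≤ 2 * N * (2 * ((m + 1) * M)) :=
      mul_le_mul hKa' ha2 ha0'.le (by positivity)
    have h2 : Λ * (8 * K * a ^ 2 * c ^ 2) = 8 * Λ * c ^ 2 * (K * a * a) := by ring
    rw [h2]
    have h3 := mul_le_mul_of_nonneg_left h1 (by positivity : 0 ≤ 8 * Λ * c ^ 2)
    refine h3.trans (le_of_eq ?_)
    ring
  have hfirst : 2 * Real.exp (-((c * N * τ / 2) ^ 2 / (8 * K * a ^ 2 * c ^ 2))) ≤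
      δ / (16 * N ^ 2) := by
    refine le_trans ?_ (two_mul_exp_neg_mixLambda_le (βbar := βbar) hN' hδ.1)
    gcongr
  have hNτ : 16 ≤ N * τ := by
    have h256 : (16 : ℝ) ^ 2 ≤ (N * τ) ^ 2 := by
      have e : (N * τ) ^ 2 = N * (N * τ ^ 2) := by ring
      rw [e, hτ2]
      have h2 : 2 ≤ (m + 1) * Λ * M := by nlinarith
      nlinarith
    exact (sq_le_sq₀ (by norm_num) (by positivity)).mp h256
  have hsecond : N * (2 * c * (δ / (8 * N ^ 3))) / (c * N * τ / 2) ≤ δ / (16 * N ^ 2) := by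
    have e : N * (2 * c * (δ / (8 * N ^ 3))) / (c * N * τ / 2) = δ / (2 * N ^ 2 * (N * τ)) := by
      field_simp
      norm_num
    rw [e]
    refine div_le_div_of_nonneg_left hδ0.le (by positivity) ?_
    have : (0 : ℝ) < N ^ 2 := by positivity
    nlinarith
  have e : δ / (8 * (N : ℝ) ^ 2) = δ / (16 * N ^ 2) + δ / (16 * N ^ 2) := by
    field_simp; norm_num
  rw [e]
  exact add_le_add hfirst hsecond

end WindowConcentration

section TransitionOperator

variable {S : Type*} [MeasurableSpace S]

/-- The transition operator `(P g)(x) = ∫ g dP(x, ·)`. -/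
noncomputable def transOp (P : Kernel S S) (g : S → ℝ) : S → ℝ := fun x => ∫ y, g y ∂(P x)

variable [Countable S] [MeasurableSingletonClass S] {P : Kernel S S} [IsMarkovKernel P]

theorem integrable_of_forall_abs_le {μ : Measure S} [IsFiniteMeasure μ] {g : S → ℝ} {C : ℝ}
    (hg : ∀ x, |g x| ≤ C) : Integrable g μ :=
  Integrable.of_bound (measurable_of_countable g).aestronglyMeasurable C (ae_of_all _ hg)

omit [Countable S] [MeasurableSingletonClass S] in
theorem abs_transOp_le {g : S → ℝ} {C : ℝ} (hg : ∀ x, |g x| ≤ C) (x : S) :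
    |transOp P g x| ≤ C := by
  have := norm_integral_le_of_norm_le_const (μ := P x) (f := g) (ae_of_all _ hg)
  simpa [transOp] using this

omit [Countable S] [MeasurableSingletonClass S] in
theorem abs_transOp_iterate_le {g : S → ℝ} {C : ℝ} (hg : ∀ x, |g x| ≤ C) (k : ℕ) (x : S) :
    |(transOp P)^[k] g x| ≤ C := by
  induction k generalizing x with
  | zero => exact hg x
  | succ k ih => rw [Function.iterate_succ_apply']; exact abs_transOp_le ih x

theorem transOp_add {f g : S → ℝ} {C D : ℝ} (hf : ∀ x, |f x| ≤ C) (hg : ∀ x, |g x| ≤ D) :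
    transOp P (fun x => f x + g x) = fun x => transOp P f x + transOp P g x :=
  funext fun _ => integral_add (integrable_of_forall_abs_le hf) (integrable_of_forall_abs_le hg)

omit [Countable S] [MeasurableSingletonClass S] [IsMarkovKernel P] in
theorem transOp_const_mul (c : ℝ) (g : S → ℝ) :
    transOp P (fun x => c * g x) = fun x => c * transOp P g x :=
  funext fun _ => integral_const_mul c g

theorem transOp_iterate_add {f g : S → ℝ} {C D : ℝ} (hf : ∀ x, |f x| ≤ C) (hg : ∀ x, |g x| ≤ D)
    (k : ℕ) : (transOp P)^[k] (fun x => f x + g x) =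
      fun x => (transOp P)^[k] f x + (transOp P)^[k] g x := by
  induction k with
  | zero => rfl
  | succ k ih =>
    simp only [Function.iterate_succ_apply']
    rw [ih, transOp_add (abs_transOp_iterate_le hf k) (abs_transOp_iterate_le hg k)]

omit [Countable S] [MeasurableSingletonClass S] [IsMarkovKernel P] in
theorem transOp_iterate_const_mul (c : ℝ) (g : S → ℝ) (k : ℕ) :
    (transOp P)^[k] (fun x => c * g x) = fun x => c * (transOp P)^[k] g x := by
  induction k with
  | zero => rfl
  | succ k ih => simp only [Function.iterate_succ_apply']; rw [ih, transOp_const_mul]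

theorem transOp_iterate_sub {f g : S → ℝ} {C D : ℝ} (hf : ∀ x, |f x| ≤ C) (hg : ∀ x, |g x| ≤ D)
    (k : ℕ) : (transOp P)^[k] (fun x => f x - g x) =
      fun x => (transOp P)^[k] f x - (transOp P)^[k] g x := by
  have h := transOp_iterate_add (P := P) hf (g := fun x => (-1) * g x) (D := D)
    (fun x => by simpa using hg x) k
  rw [transOp_iterate_const_mul] at h
  simpa [sub_eq_add_neg] using h

theorem transOp_iterate_sum {ι : Type*} (s : Finset ι) (w : ι → ℝ) {f : ι → S → ℝ} {C : ℝ}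
    (hf : ∀ i x, |f i x| ≤ C) (k : ℕ) : (transOp P)^[k] (fun x => ∑ i ∈ s, w i * f i x) =
      fun x => ∑ i ∈ s, w i * (transOp P)^[k] (f i) x := by
  classical
  induction s using Finset.induction_on with
  | empty =>
    simp only [Finset.sum_empty]
    simpa using transOp_iterate_const_mul (P := P) 0 (fun _ => 0) k
  | insert i s hi ih =>
    simp only [Finset.sum_insert hi]
    have h1 : ∀ x, |w i * f i x| ≤ |w i| * C := fun x => by
      rw [abs_mul]; exact mul_le_mul_of_nonneg_left (hf i x) (abs_nonneg _)
    have h2 : ∀ x, |∑ j ∈ s, w j * f j x| ≤ ∑ j ∈ s, |w j| * C := fun x =>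
      (Finset.abs_sum_le_sum_abs _ _).trans (Finset.sum_le_sum fun j _ => by
        rw [abs_mul]; exact mul_le_mul_of_nonneg_left (hf j x) (abs_nonneg _))
    rw [transOp_iterate_add h1 h2, ih, transOp_iterate_const_mul]

variable {μ : Measure S} [IsProbabilityMeasure μ]

theorem integral_transOp (hμ : Kernel.Invariant P μ) {g : S → ℝ} {C : ℝ}
    (hg : ∀ x, |g x| ≤ C) : ∫ x, transOp P g x ∂μ = ∫ x, g x ∂μ := by
  have h : (μ ⊗ₘ P).snd = μ := (Measure.snd_compProd μ P).trans hμ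
  have h1 := integral_map (μ := μ ⊗ₘ P) measurable_snd.aemeasurable (f := g)
    (measurable_of_countable g).aestronglyMeasurable
  have h2 : (μ ⊗ₘ P).map Prod.snd = μ := h
  rw [h2, Measure.integral_compProd (integrable_of_forall_abs_le fun p => hg p.2)] at h1
  exact h1.symm

theorem integral_transOp_iterate (hμ : Kernel.Invariant P μ) {g : S → ℝ} {C : ℝ}
    (hg : ∀ x, |g x| ≤ C) (k : ℕ) : ∫ x, (transOp P)^[k] g x ∂μ = ∫ x, g x ∂μ := by
  induction k with
  | zero => rfl
  | succ k ih =>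
    rw [Function.iterate_succ_apply', integral_transOp hμ (abs_transOp_iterate_le hg k), ih]

theorem transOp_sq_le {g : S → ℝ} {C : ℝ} (hg : ∀ x, |g x| ≤ C) (x : S) :
    transOp P g x ^ 2 ≤ transOp P (fun y => g y ^ 2) x := by
  have hgi : Integrable g (P x) := integrable_of_forall_abs_le hg
  have hg2 : Integrable (fun y => g y ^ 2) (P x) :=
    integrable_of_forall_abs_le (C := C ^ 2) fun y => by
      rw [abs_of_nonneg (sq_nonneg _)]
      exact sq_le_sq' (abs_le.mp (hg y)).1 (abs_le.mp (hg y)).2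
  have h0 : 0 ≤ ∫ y, (g y - transOp P g x) ^ 2 ∂(P x) := integral_nonneg fun y => sq_nonneg _
  have h1 : ∫ y, (g y - transOp P g x) ^ 2 ∂(P x) =
      transOp P (fun y => g y ^ 2) x - transOp P g x ^ 2 := by
    have e : ∀ y, (g y - transOp P g x) ^ 2 =
        g y ^ 2 - 2 * transOp P g x * g y + transOp P g x ^ 2 := fun y => by ring
    have hs : Integrable (fun y => g y ^ 2 - 2 * transOp P g x * g y) (P x) :=
      hg2.sub (hgi.const_mul _)
    simp only [e]
    rw [integral_add hs (integrable_const _),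
      integral_sub hg2 (hgi.const_mul _), integral_const_mul]
    simp only [transOp, integral_const, probReal_univ, one_smul]
    ring
  linarith

theorem integral_transOp_iterate_sq_le (hμ : Kernel.Invariant P μ) {g : S → ℝ} {C : ℝ}
    (hg : ∀ x, |g x| ≤ C) (k : ℕ) :
    ∫ x, (transOp P)^[k] g x ^ 2 ∂μ ≤ ∫ x, g x ^ 2 ∂μ := by
  have hsq : ∀ {f : S → ℝ}, (∀ x, |f x| ≤ C) → ∀ x, |f x ^ 2| ≤ C ^ 2 := fun hf x => by
    rw [abs_of_nonneg (sq_nonneg _)]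
    exact sq_le_sq' (abs_le.mp (hf x)).1 (abs_le.mp (hf x)).2
  induction k with
  | zero => rfl
  | succ k ih =>
    refine le_trans ?_ ih
    rw [← integral_transOp hμ (hsq (abs_transOp_iterate_le (P := P) hg k))]
    refine integral_mono (integrable_of_forall_abs_le (hsq (abs_transOp_iterate_le hg (k + 1))))
      (integrable_of_forall_abs_le (abs_transOp_le
        (hsq (abs_transOp_iterate_le (P := P) hg k)))) fun x => ?_
    rw [Function.iterate_succ_apply']
    exact transOp_sq_le (abs_transOp_iterate_le hg k) x

omit [IsMarkovKernel P] in
/-- A stationary distribution of an ergodic chain charges every state. -/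
theorem measure_singleton_pos_of_ergodic (hP : IsErgodicKernel P) (hμ : Kernel.Invariant P μ)
    (y : S) : 0 < μ {y} := by
  have hpow : ∀ n : ℕ, μ.bind (P ^ n : Kernel S S) = μ := by
    intro n
    induction n with
    | zero =>
      rw [pow_zero]
      exact Measure.bind_dirac
    | succ n ih =>
      have h : Kernel.Invariant ((P ^ n : Kernel S S) ∘ₖ P) μ := Kernel.Invariant.comp ih hμ
      rw [pow_succ]
      exact h
  obtain ⟨x, hx⟩ : ∃ x, μ {x} ≠ 0 := by
    by_contra! h
    have : μ = 0 := Measure.ext_of_singleton fun a => by simp [h a]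
    exact IsProbabilityMeasure.ne_zero μ this
  obtain ⟨n, hn⟩ := hP x y
  have hxy := hn n le_rfl
  rw [← hpow n, Measure.bind_apply (MeasurableSet.singleton y) (P ^ n : Kernel S S).measurable.aemeasurable]
  have hle : ∫⁻ a in {x}, (P ^ n : Kernel S S) a {y} ∂μ ≤ ∫⁻ a, (P ^ n : Kernel S S) a {y} ∂μ := setLIntegral_le_lintegral _ _
  refine lt_of_lt_of_le ?_ hle
  rw [lintegral_singleton]
  exact ENNReal.mul_pos hxy.ne' hx

end TransitionOperator

section MarkovMarginals

variable {S : Type*} [MeasurableSpace S] [Countable S] [MeasurableSingletonClass S]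
  {Ω : Type*} [MeasurableSpace Ω] {Pr : Measure Ω} [IsProbabilityMeasure Pr]
  {P : Kernel S S} [IsMarkovKernel P] {μ : Measure S} {X : ℕ → Ω → S}

namespace IsMarkovChain

/-- The path `(X 1, …, X (n + 1))`. -/
def path (X : ℕ → Ω → S) (n : ℕ) (ω : Ω) : Fin (n + 1) → S := fun i => X (i + 1) ω

omit [Countable S] [MeasurableSingletonClass S] [IsProbabilityMeasure Pr] [IsMarkovKernel P] in
theorem measurable_path (h : IsMarkovChain Pr P μ X) (n : ℕ) : Measurable (path X n) :=
  measurable_pi_lambda _ fun i => h.measurable (i + 1) (Nat.le_add_left 1 i)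

theorem map_path_prod (h : IsMarkovChain Pr P μ X) (n : ℕ) :
    Pr.map (fun ω => (path X n ω, X (n + 2) ω)) =
      (Pr.map (path X n)) ⊗ₘ (P.comap (fun v : Fin (n + 1) → S => v (Fin.last n))
        (measurable_of_countable _)) := by
  have hpm := h.measurable_path n
  have := Measure.isProbabilityMeasure_map (μ := Pr) hpm.aemeasurable
  refine Measure.ext_of_singleton fun ⟨v, y⟩ => ?_
  rw [Measure.map_apply (hpm.prodMk (h.measurable _ (by omega))) (MeasurableSet.singleton _),
    ← Set.singleton_prod_singleton, Measure.compProd_apply_prod (MeasurableSet.singleton _)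
      (MeasurableSet.singleton _), lintegral_singleton,
      Measure.map_apply hpm (MeasurableSet.singleton _), Kernel.comap_apply]
  set x : ℕ → S := fun i => if hi : i - 1 < n + 1 then v ⟨i - 1, hi⟩ else y
  have hx1 : ∀ i : Fin (n + 1), x (i + 1) = v i := fun i => by
    simp only [x, Nat.add_sub_cancel, dif_pos i.isLt]
  have hx2 : x (n + 2) = y := by simp [x]
  have hmk := h.markov (n + 1) (by omega) x
  have hlast : x (n + 1) = v (Fin.last n) := hx1 (Fin.last n)
  rw [show n + 1 + 1 = n + 2 from rfl, hx2, hlast] at hmk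
  have e2 : path X n ⁻¹' {v} = {ω | ∀ i ∈ Finset.Icc 1 (n + 1), X i ω = x i} := by
    ext ω
    simp only [Set.mem_preimage, Set.mem_singleton_iff, Set.mem_ofPred_eq, funext_iff, path]
    refine ⟨fun hω i hi => ?_, fun hω i => ?_⟩
    · obtain ⟨h1, h2⟩ := Finset.mem_Icc.mp hi
      obtain ⟨j, rfl⟩ := Nat.exists_eq_add_of_le' h1
      have := hω ⟨j, by omega⟩
      rw [this, ← hx1]
    · rw [hω (i + 1) (Finset.mem_Icc.mpr ⟨by omega, by omega⟩), hx1]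
  have e1 : (fun ω => (path X n ω, X (n + 2) ω)) ⁻¹' ({v} ×ˢ {y}) =
      {ω | ∀ i ∈ Finset.Icc 1 (n + 2), X i ω = x i} := by
    ext ω
    have h2 := Set.ext_iff.mp e2 ω
    simp only [Set.mem_preimage, Set.mem_prod, Set.mem_singleton_iff, Set.mem_ofPred_eq] at h2 ⊢
    rw [h2]
    refine ⟨fun hω i hi => ?_, fun hω => ⟨fun i hi => ?_, ?_⟩⟩
    · obtain ⟨h3, h4⟩ := Finset.mem_Icc.mp hi
      rcases Nat.lt_or_ge i (n + 2) with h5 | h5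
      · exact hω.1 i (Finset.mem_Icc.mpr ⟨h3, by omega⟩)
      · obtain rfl : i = n + 2 := by omega
        rw [hω.2, hx2]
    · exact hω i (Finset.mem_Icc.mpr ⟨(Finset.mem_Icc.mp hi).1,
        (Finset.mem_Icc.mp hi).2.trans (by omega)⟩)
    · rw [hω (n + 2) (Finset.mem_Icc.mpr ⟨by omega, le_rfl⟩), hx2]
  rw [e1, e2, hmk, mul_comm]

/-- The Markov property, integrated against a bounded function of an earlier state. -/
theorem integral_mul_succ (h : IsMarkovChain Pr P μ X) {f g : S → ℝ} {C D : ℝ}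
    (hf : ∀ x, |f x| ≤ C) (hg : ∀ x, |g x| ≤ D) {i j : ℕ} (hi : 1 ≤ i) (hij : i ≤ j) :
    ∫ ω, f (X i ω) * g (X (j + 1) ω) ∂Pr = ∫ ω, f (X i ω) * transOp P g (X j ω) ∂Pr := by
  obtain ⟨n, rfl⟩ := Nat.exists_eq_add_of_le' (hi.trans hij)
  obtain ⟨k, rfl⟩ := Nat.exists_eq_add_of_le' hi
  have hpm := h.measurable_path n
  have := Measure.isProbabilityMeasure_map (μ := Pr) hpm.aemeasurable
  have hk : k < n + 1 := by omega
  set F : (Fin (n + 1) → S) × S → ℝ := fun p => f (p.1 ⟨k, hk⟩) * g p.2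
  have hFm : Measurable F := measurable_of_countable F
  have hFb : ∀ p, |F p| ≤ C * D := fun p => by
    rw [abs_mul]
    exact mul_le_mul (hf _) (hg _) (abs_nonneg _) ((abs_nonneg _).trans (hf (p.1 ⟨k, hk⟩)))
  have e1 : ∫ ω, f (X (k + 1) ω) * g (X (n + 1 + 1) ω) ∂Pr =
      ∫ p, F p ∂(Pr.map (fun ω => (path X n ω, X (n + 2) ω))) :=
    (integral_map (hpm.prodMk (h.measurable _ (by omega))).aemeasurable
      hFm.aestronglyMeasurable).symm
  rw [e1, h.map_path_prod n, Measure.integral_compProd (integrable_of_forall_abs_le hFb),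
    integral_map hpm.aemeasurable (measurable_of_countable _).aestronglyMeasurable]
  refine integral_congr_ae (ae_of_all _ fun ω => ?_)
  simp only [F, Kernel.comap_apply, integral_const_mul]
  rfl

theorem integral_mul_add (h : IsMarkovChain Pr P μ X) {f g : S → ℝ} {C D : ℝ}
    (hf : ∀ x, |f x| ≤ C) (hg : ∀ x, |g x| ≤ D) {i : ℕ} (hi : 1 ≤ i) (k : ℕ) :
    ∫ ω, f (X i ω) * g (X (i + k) ω) ∂Pr =
      ∫ ω, f (X i ω) * (transOp P)^[k] g (X i ω) ∂Pr := by
  induction k generalizing g with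
  | zero => rfl
  | succ k ih =>
    rw [← add_assoc, h.integral_mul_succ hf hg hi (Nat.le_add_right i k),
      ih (abs_transOp_le hg), Function.iterate_succ_apply]

variable [IsProbabilityMeasure μ]

theorem integral_eq (h : IsMarkovChain Pr P μ X) (hμ : Kernel.Invariant P μ) {g : S → ℝ} {D : ℝ}
    (hg : ∀ x, |g x| ≤ D) {i : ℕ} (hi : 1 ≤ i) : ∫ ω, g (X i ω) ∂Pr = ∫ x, g x ∂μ := by
  obtain ⟨k, rfl⟩ := Nat.exists_eq_add_of_le hi
  have h1 := h.integral_mul_add (f := fun _ => 1) (C := 1) (fun _ => by simp) hg le_rfl k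
  simp only [one_mul] at h1
  rw [h1, ← integral_transOp_iterate hμ hg k]
  have h2 := integral_map (μ := Pr) (h.measurable 1 le_rfl).aemeasurable
    (f := (transOp P)^[k] g) (measurable_of_countable _).aestronglyMeasurable
  rw [h.initial] at h2
  exact h2.symm

/-- Two-time correlations of the stationary chain. -/
theorem integral_mul_eq (h : IsMarkovChain Pr P μ X) (hμ : Kernel.Invariant P μ) {f g : S → ℝ}
    {C D : ℝ} (hf : ∀ x, |f x| ≤ C) (hg : ∀ x, |g x| ≤ D) {i : ℕ} (hi : 1 ≤ i) (k : ℕ) :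
    ∫ ω, f (X i ω) * g (X (i + k) ω) ∂Pr = ∫ x, f x * (transOp P)^[k] g x ∂μ := by
  rw [h.integral_mul_add hf hg hi k]
  refine h.integral_eq hμ (g := fun x => f x * (transOp P)^[k] g x) (D := C * D) (fun x => ?_) hi
  rw [abs_mul]
  exact mul_le_mul (hf x) (abs_transOp_iterate_le hg k x) (abs_nonneg _)
    ((abs_nonneg _).trans (hf x))

end IsMarkovChain

end MarkovMarginals

/-- Boundedness of a real function. -/
def IsBdd {S : Type*} (f : S → ℝ) : Prop := ∃ C, ∀ x, |f x| ≤ C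

namespace IsBdd

variable {S : Type*} {f g : S → ℝ}

theorem add (hf : IsBdd f) (hg : IsBdd g) : IsBdd fun x => f x + g x := by
  obtain ⟨C, hC⟩ := hf
  obtain ⟨D, hD⟩ := hg
  exact ⟨C + D, fun x => (abs_add_le _ _).trans (add_le_add (hC x) (hD x))⟩

theorem mul (hf : IsBdd f) (hg : IsBdd g) : IsBdd fun x => f x * g x := by
  obtain ⟨C, hC⟩ := hf
  obtain ⟨D, hD⟩ := hg
  exact ⟨C * D, fun x => by
    rw [abs_mul]
    exact mul_le_mul (hC x) (hD x) (abs_nonneg _) ((abs_nonneg _).trans (hC x))⟩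

theorem const (c : ℝ) : IsBdd fun _ : S => c := ⟨|c|, fun _ => le_rfl⟩

theorem const_mul (c : ℝ) (hf : IsBdd f) : IsBdd fun x => c * f x := (const c).mul hf

theorem sub (hf : IsBdd f) (hg : IsBdd g) : IsBdd fun x => f x - g x := by
  have := hf.add (hg.const_mul (-1))
  simpa [sub_eq_add_neg] using this

theorem sum {ι : Type*} (s : Finset ι) {f : ι → S → ℝ} (hf : ∀ i, IsBdd (f i)) :
    IsBdd fun x => ∑ i ∈ s, f i x := by
  classical
  induction s using Finset.induction_on with
  | empty => simpa using const (S := S) 0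
  | insert i s hi ih =>
    simp only [Finset.sum_insert hi]
    exact (hf i).add ih

theorem pow (hf : IsBdd f) (n : ℕ) : IsBdd fun x => f x ^ n := by
  induction n with
  | zero => simpa using const (S := S) 1
  | succ n ih => simpa only [pow_succ] using ih.mul hf

variable [MeasurableSpace S]

theorem transOp_iterate {P : Kernel S S} [IsMarkovKernel P] (hf : IsBdd f) (k : ℕ) :
    IsBdd ((transOp P)^[k] f) := by
  obtain ⟨C, hC⟩ := hf
  exact ⟨C, abs_transOp_iterate_le hC k⟩

theorem integrable [Countable S] [MeasurableSingletonClass S] {μ : Measure S} [IsFiniteMeasure μ]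
    (hf : IsBdd f) : Integrable f μ := by
  obtain ⟨C, hC⟩ := hf
  exact integrable_of_forall_abs_le hC

end IsBdd

section TraceCorrelation

variable {S : Type*} [MeasurableSpace S]

/-- The stationary correlation `∫ f (P^k u - γ P^{k+1} g) dμ`. -/
noncomputable def lagCorr (P : Kernel S S) (μ : Measure S) (γ : ℝ) (f u g : S → ℝ) (k : ℕ) : ℝ :=
  ∫ x, f x * ((transOp P)^[k] u x - γ * (transOp P)^[k + 1] g x) ∂μ

/-- The discounted sum `∑ₖ q^k ∫ f (P^k u - γ P^{k+1} g) dμ` of stationary correlations. -/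
noncomputable def traceCorr (P : Kernel S S) (μ : Measure S) (γ q : ℝ) (f u g : S → ℝ) : ℝ :=
  ∑' k : ℕ, q ^ k * lagCorr P μ γ f u g k

variable [Countable S] [MeasurableSingletonClass S] {P : Kernel S S} [IsMarkovKernel P]
  {μ : Measure S} [IsProbabilityMeasure μ] {γ q : ℝ} {f u g : S → ℝ}

omit [Countable S] [MeasurableSingletonClass S] in
theorem exists_abs_lagCorr_le (γ : ℝ) (hf : IsBdd f) (hu : IsBdd u) (hg : IsBdd g) :
    ∃ C, ∀ k, |lagCorr P μ γ f u g k| ≤ C := by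
  obtain ⟨F, hF⟩ := hf
  obtain ⟨U, hU⟩ := hu
  obtain ⟨G, hG⟩ := hg
  refine ⟨F * (U + |γ| * G), fun k => ?_⟩
  have h : ∀ x, ‖f x * ((transOp P)^[k] u x - γ * (transOp P)^[k + 1] g x)‖ ≤
      F * (U + |γ| * G) := by
    intro x
    rw [norm_mul]
    refine mul_le_mul (hF x) ((norm_sub_le _ _).trans ?_) (norm_nonneg _)
      ((abs_nonneg _).trans (hF x))
    rw [norm_mul]
    exact add_le_add (abs_transOp_iterate_le hU k x)
      (mul_le_mul_of_nonneg_left (abs_transOp_iterate_le hG (k + 1) x) (abs_nonneg _))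
  have := norm_integral_le_of_norm_le_const (μ := μ) (ae_of_all _ h)
  simpa [lagCorr] using this

theorem summable_pow_mul_of_abs_le {a : ℕ → ℝ} {C : ℝ} (hq : q ∈ Set.Ico (0 : ℝ) 1)
    (ha : ∀ k, |a k| ≤ C) : Summable fun k => q ^ k * a k := by
  refine Summable.of_norm_bounded (g := fun k => q ^ k * C)
    ((summable_geometric_of_lt_one hq.1 hq.2).mul_right C) fun k => ?_
  rw [norm_mul, norm_pow, Real.norm_of_nonneg hq.1]
  exact mul_le_mul_of_nonneg_left (ha k) (pow_nonneg hq.1 k)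

omit [Countable S] [MeasurableSingletonClass S] in
theorem summable_traceCorr (hq : q ∈ Set.Ico (0 : ℝ) 1) (hf : IsBdd f) (hu : IsBdd u)
    (hg : IsBdd g) : Summable fun k => q ^ k * lagCorr P μ γ f u g k := by
  obtain ⟨C, hC⟩ := exists_abs_lagCorr_le (P := P) (μ := μ) γ hf hu hg
  exact summable_pow_mul_of_abs_le hq hC

omit [Countable S] [MeasurableSingletonClass S] in
theorem IsBdd.lagCorr_integrand (γ : ℝ) (hf : IsBdd f) (hu : IsBdd u) (hg : IsBdd g) (k : ℕ) :
    IsBdd fun x => f x * ((transOp P)^[k] u x - γ * (transOp P)^[k + 1] g x) :=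
  hf.mul ((hu.transOp_iterate k).sub ((hg.transOp_iterate (k + 1)).const_mul γ))

theorem traceCorr_sum_left {ι : Type*} (s : Finset ι) (w : ι → ℝ) {F : ι → S → ℝ}
    (hq : q ∈ Set.Ico (0 : ℝ) 1) (hF : ∀ i, IsBdd (F i)) (hu : IsBdd u) (hg : IsBdd g) :
    traceCorr P μ γ q (fun x => ∑ i ∈ s, w i * F i x) u g =
      ∑ i ∈ s, w i * traceCorr P μ γ q (F i) u g := by
  have h : ∀ k, q ^ k * lagCorr P μ γ (fun x => ∑ i ∈ s, w i * F i x) u g k =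
      ∑ i ∈ s, w i * (q ^ k * lagCorr P μ γ (F i) u g k) := by
    intro k
    have e : lagCorr P μ γ (fun x => ∑ i ∈ s, w i * F i x) u g k =
        ∑ i ∈ s, w i * lagCorr P μ γ (F i) u g k := by
      simp only [lagCorr, Finset.sum_mul, mul_assoc]
      rw [integral_finsetSum _ fun i _ =>
        (((hF i).lagCorr_integrand (P := P) γ hu hg k).const_mul (w i)).integrable]
      simp only [integral_const_mul]
    rw [e, Finset.mul_sum]
    exact Finset.sum_congr rfl fun i _ => by ring
  simp only [traceCorr, h]
  rw [Summable.tsum_finsetSum fun i _ => (summable_traceCorr hq (hF i) hu hg).mul_left (w i)]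
  simp only [tsum_mul_left]

theorem lagCorr_sum_right {ι : Type*} (s : Finset ι) (w : ι → ℝ) {U : ι → S → ℝ}
    (hf : IsBdd f) {C : ℝ} (hU : ∀ i x, |U i x| ≤ C) (k : ℕ) :
    lagCorr P μ γ f (fun x => ∑ i ∈ s, w i * U i x) (fun x => ∑ i ∈ s, w i * U i x) k =
        ∑ i ∈ s, w i * lagCorr P μ γ f (U i) (U i) k := by
  simp only [lagCorr]
  rw [transOp_iterate_sum s w hU, transOp_iterate_sum s w hU]
  have hB : ∀ i, IsBdd (U i) := fun i => ⟨C, hU i⟩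
  simp only [← integral_const_mul]
  rw [← integral_finsetSum _ fun i _ =>
    ((hf.lagCorr_integrand (P := P) γ (hB i) (hB i) k).const_mul (w i)).integrable]
  congr 1
  ext x
  rw [Finset.mul_sum, ← Finset.sum_sub_distrib, Finset.mul_sum]
  exact Finset.sum_congr rfl fun i _ => by ring

theorem traceCorr_sum_right {ι : Type*} (s : Finset ι) (w : ι → ℝ) {U : ι → S → ℝ}
    (hq : q ∈ Set.Ico (0 : ℝ) 1) (hf : IsBdd f) {C : ℝ} (hU : ∀ i x, |U i x| ≤ C) :
    traceCorr P μ γ q f (fun x => ∑ i ∈ s, w i * U i x) (fun x => ∑ i ∈ s, w i * U i x) =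
      ∑ i ∈ s, w i * traceCorr P μ γ q f (U i) (U i) := by
  have hB : ∀ i, IsBdd (U i) := fun i => ⟨C, hU i⟩
  simp only [traceCorr, lagCorr_sum_right s w hf hU, Finset.mul_sum, mul_left_comm _ (w _)]
  rw [Summable.tsum_finsetSum fun i _ => (summable_traceCorr hq hf (hB i) (hB i)).mul_left (w i)]
  simp only [tsum_mul_left]

theorem traceCorr_sub_right (hq : q ∈ Set.Ico (0 : ℝ) 1) (hf : IsBdd f) {r : S → ℝ}
    (hu : IsBdd u) (hr : IsBdd r) (hg : IsBdd g) :
    traceCorr P μ γ q f (fun x => u x - r x) g =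
      traceCorr P μ γ q f u g - traceCorr P μ γ q f r (fun _ => 0) := by
  have h0 : ∀ k, (transOp P)^[k] (fun _ : S => (0 : ℝ)) = fun _ => 0 := fun k => by
    simpa using transOp_iterate_const_mul (P := P) 0 (fun _ => 0) k
  rw [traceCorr, traceCorr, traceCorr, ← Summable.tsum_sub (summable_traceCorr hq hf hu hg)
    (summable_traceCorr hq hf hr (IsBdd.const 0))]
  congr 1
  ext k
  rw [← mul_sub]
  congr 1
  have hr' : IsBdd fun x => f x * ((transOp P)^[k] r x - γ * 0) := by
    simpa using hf.mul (hr.transOp_iterate k)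
  simp only [lagCorr, h0]
  rw [← integral_sub (hf.lagCorr_integrand (P := P) γ hu hg k).integrable hr'.integrable]
  congr 1
  ext x
  obtain ⟨U, hU⟩ := hu
  obtain ⟨R, hR⟩ := hr
  rw [transOp_iterate_sub hU hR]
  ring

theorem abs_integral_mul_transOp_iterate_le (hμ : Kernel.Invariant P μ) (hu : IsBdd u) (k : ℕ) :
    |∫ x, u x * (transOp P)^[k] u x ∂μ| ≤ ∫ x, u x ^ 2 ∂μ := by
  have hk := hu.transOp_iterate (P := P) k
  have h1 : |∫ x, u x * (transOp P)^[k] u x ∂μ| ≤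
      ∫ x, (1 / 2 * u x ^ 2 + 1 / 2 * (transOp P)^[k] u x ^ 2) ∂μ := by
    refine (norm_integral_le_integral_norm _).trans (integral_mono (hu.mul hk).integrable.norm
      (((hu.pow 2).const_mul _).add ((hk.pow 2).const_mul _)).integrable fun x => ?_)
    simp only [Real.norm_eq_abs]
    rw [abs_le]
    constructor
    · nlinarith [sq_nonneg (u x + (transOp P)^[k] u x)]
    · nlinarith [sq_nonneg (u x - (transOp P)^[k] u x)]
  rw [integral_add ((hu.pow 2).const_mul _).integrable ((hk.pow 2).const_mul _).integrable,
    integral_const_mul, integral_const_mul] at h1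
  obtain ⟨U, hU⟩ := hu
  have := integral_transOp_iterate_sq_le hμ hU k
  linarith

/-- Coercivity of the `λ`-discounted temporal-difference form. -/
theorem traceCorr_self_ge (hμ : Kernel.Invariant P μ) (hq0 : 0 ≤ q) (hqγ : q ≤ γ)
    (hq1 : q < 1) (hu : IsBdd u) :
    (1 - γ) / (1 - q) * ∫ x, u x ^ 2 ∂μ ≤ traceCorr P μ γ q u u u := by
  set c : ℕ → ℝ := fun k => ∫ x, u x * (transOp P)^[k] u x ∂μ
  have hc : ∀ k, |c k| ≤ ∫ x, u x ^ 2 ∂μ := abs_integral_mul_transOp_iterate_le hμ hu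
  have hc0 : c 0 = ∫ x, u x ^ 2 ∂μ := by simp [c, sq]
  have hl : ∀ k, lagCorr P μ γ u u u k = c k - γ * c (k + 1) := by
    intro k
    simp only [lagCorr, c, mul_sub, mul_left_comm (u _) γ]
    rw [integral_sub (hu.mul (hu.transOp_iterate k)).integrable
      ((hu.mul (hu.transOp_iterate (k + 1))).const_mul γ).integrable, integral_const_mul]
  have hs := summable_pow_mul_of_abs_le ⟨hq0, hq1⟩ hc
  have hs' := summable_pow_mul_of_abs_le ⟨hq0, hq1⟩ (fun k => hc (k + 1))
  have e1 : traceCorr P μ γ q u u u = ∑' k, q ^ k * c k - γ * ∑' k, q ^ k * c (k + 1) := by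
    rw [← tsum_mul_left, ← hs.tsum_sub (hs'.mul_left γ), traceCorr]
    congr 1
    ext k
    rw [hl]; ring
  have e2 : ∑' k, q ^ k * c k = c 0 + q * ∑' k, q ^ k * c (k + 1) := by
    rw [hs.tsum_eq_zero_add, ← tsum_mul_left]
    simp only [pow_zero, one_mul, pow_succ']
    congr 2
    ext k; ring
  have hle : ∑' k, q ^ k * c (k + 1) ≤ (∫ x, u x ^ 2 ∂μ) / (1 - q) := by
    refine (hs'.tsum_le_tsum (g := fun k => q ^ k * ∫ x, u x ^ 2 ∂μ) (fun k =>
      mul_le_mul_of_nonneg_left ((le_abs_self _).trans (hc (k + 1))) (pow_nonneg hq0 k))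
      ((summable_geometric_of_lt_one hq0 hq1).mul_right _)).trans (le_of_eq ?_)
    rw [tsum_mul_right, tsum_geometric_of_lt_one hq0 hq1]
    ring
  rw [e1, e2, hc0]
  have h1q : 0 < 1 - q := by linarith
  have h2 := mul_le_mul_of_nonneg_left hle (sub_nonneg.mpr hqγ)
  have e3 : (1 - γ) / (1 - q) * ∫ x, u x ^ 2 ∂μ =
      ∫ x, u x ^ 2 ∂μ - (γ - q) * ((∫ x, u x ^ 2 ∂μ) / (1 - q)) := by
    field_simp; ring
  rw [e3]
  linarith

end TraceCorrelation

theorem one_sub_mul_tsum_add_partial_sum {x : ℕ → ℝ} {γ lam C : ℝ} (hγ : γ ∈ Set.Ioo (0 : ℝ) 1)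
    (hlam : lam ∈ Set.Ioo (0 : ℝ) 1) (hx : ∀ j, |x j| ≤ C * γ ^ j) (v : ℝ) :
    (1 - lam) * ∑' i, lam ^ i * (v + ∑ j ∈ Finset.range (i + 1), x j) =
      v + ∑' j, lam ^ j * x j := by
  have hlam' : lam ∈ Set.Ico (0 : ℝ) 1 := ⟨hlam.1.le, hlam.2⟩
  have hC : 0 ≤ C := by simpa using (abs_nonneg _).trans (hx 0)
  set T : ℕ → ℝ := fun i => ∑ j ∈ Finset.range i, x j
  have hT : ∀ i, |T i| ≤ C / (1 - γ) := by
    intro i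
    refine (Finset.abs_sum_le_sum_abs _ _).trans ((Finset.sum_le_sum fun j _ => hx j).trans ?_)
    rw [← Finset.mul_sum, div_eq_mul_inv]
    refine mul_le_mul_of_nonneg_left ?_ hC
    rw [← tsum_geometric_of_lt_one hγ.1.le hγ.2]
    exact (summable_geometric_of_lt_one hγ.1.le hγ.2).sum_le_tsum _
      fun _ _ => pow_nonneg hγ.1.le _
  have s0 := summable_pow_mul_of_abs_le hlam' hT
  have s1 := summable_pow_mul_of_abs_le hlam' (fun i => hT (i + 1))
  have sg := summable_geometric_of_lt_one hlam.1.le hlam.2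
  have e1 : ∑' i, lam ^ i * (v + T (i + 1)) = v / (1 - lam) + ∑' i, lam ^ i * T (i + 1) := by
    simp only [mul_add]
    rw [(sg.mul_right v).tsum_add s1, tsum_mul_right, tsum_geometric_of_lt_one hlam.1.le hlam.2]
    ring
  have e2 : ∑' j, lam ^ j * x j = ∑' j, lam ^ j * T (j + 1) - ∑' j, lam ^ j * T j := by
    rw [← s1.tsum_sub s0]
    congr 1
    ext j
    simp only [T, Finset.sum_range_succ]; ring
  have e3 : ∑' j, lam ^ j * T j = lam * ∑' j, lam ^ j * T (j + 1) := by
    rw [s0.tsum_eq_zero_add, ← tsum_mul_left]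
    simp only [pow_zero, one_mul, pow_succ', T, Finset.range_zero, Finset.sum_empty, zero_add]
    congr 1
    ext j; ring
  have h1 : 1 - lam ≠ 0 := by linarith [hlam.2]
  rw [e1, e2, e3]
  field_simp

section BellmanEquation

variable {S : Type*} [MeasurableSpace S] [Countable S] [MeasurableSingletonClass S]
  {P : Kernel S S} [IsMarkovKernel P] {μ : Measure S} [IsProbabilityMeasure μ] {γ lam : ℝ}
  {r v f : S → ℝ}

omit [Countable S] [MeasurableSingletonClass S] [IsMarkovKernel P] in
theorem bellman_eq (P : Kernel S S) (r : S → ℝ) (γ : ℝ) (v : S → ℝ) :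
    bellman P r γ v = fun x => r x + γ * transOp P v x := rfl

theorem bellman_iterate_eq (hr : IsBdd r) (hv : IsBdd v) (i : ℕ) :
    (bellman P r γ)^[i] v = fun x => v x + ∑ j ∈ Finset.range i,
      γ ^ j * (transOp P)^[j] (fun x => r x + γ * transOp P v x - v x) x := by
  set w : S → ℝ := fun x => r x + γ * transOp P v x - v x
  have hw : IsBdd w := (hr.add ((hv.transOp_iterate (P := P) 1).const_mul γ)).sub hv
  obtain ⟨V, hV⟩ := hv
  obtain ⟨W, hW⟩ := hw
  induction i with
  | zero => simp
  | succ i ih =>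
    rw [Function.iterate_succ_apply', ih, bellman_eq]
    have hsum : IsBdd fun x => ∑ j ∈ Finset.range i, γ ^ j * (transOp P)^[j] w x :=
      IsBdd.sum _ fun j => IsBdd.const_mul _ ⟨W, abs_transOp_iterate_le hW j⟩
    obtain ⟨D, hD⟩ := hsum
    have h1 := transOp_iterate_sum (P := P) (Finset.range i) (fun j => γ ^ j)
      (f := fun j => (transOp P)^[j] w) (C := W) (fun j => abs_transOp_iterate_le hW j) 1
    simp only [Function.iterate_one] at h1
    ext x
    rw [transOp_add hV hD, h1, Finset.sum_range_succ', mul_add, Finset.mul_sum]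
    simp only [pow_zero, one_mul, Function.iterate_zero, id, w, Function.iterate_succ_apply',
      pow_succ', mul_assoc]
    ring

theorem bellmanLam_eq (hγ : γ ∈ Set.Ioo (0 : ℝ) 1) (hlam : lam ∈ Set.Ioo (0 : ℝ) 1)
    (hr : IsBdd r) (hv : IsBdd v) (x : S) :
    bellmanLam P r γ lam v x = v x + ∑' j : ℕ, (lam * γ) ^ j *
      (transOp P)^[j] (fun x => r x + γ * transOp P v x - v x) x := by
  have hw : IsBdd fun x => r x + γ * transOp P v x - v x :=
    (hr.add ((hv.transOp_iterate (P := P) 1).const_mul γ)).sub hv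
  obtain ⟨W, hW⟩ := hw
  simp only [bellmanLam, bellman_iterate_eq hr hv]
  rw [one_sub_mul_tsum_add_partial_sum (C := W) hγ hlam (fun j => ?_)]
  · congr 2
    ext j
    rw [mul_pow]; ring
  · rw [abs_mul, abs_pow, abs_of_pos hγ.1, mul_comm]
    exact mul_le_mul_of_nonneg_right (abs_transOp_iterate_le hW j x) (pow_nonneg hγ.1.le _)

theorem integral_bellmanLam_sub_mul (hγ : γ ∈ Set.Ioo (0 : ℝ) 1) (hlam : lam ∈ Set.Ioo (0 : ℝ) 1)
    (hr : IsBdd r) (hv : IsBdd v) (hf : IsBdd f) :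
    ∫ x, (bellmanLam P r γ lam v x - v x) * f x ∂μ =
      -traceCorr P μ γ (lam * γ) f (fun x => v x - r x) v := by
  set q := lam * γ
  have hq : q ∈ Set.Ico (0 : ℝ) 1 := ⟨mul_nonneg hlam.1.le hγ.1.le, by
    have := mul_lt_mul hlam.2 hγ.2.le hγ.1 zero_le_one
    simpa using this⟩
  set w : S → ℝ := fun x => r x + γ * transOp P v x - v x
  have hw : IsBdd w := (hr.add ((hv.transOp_iterate (P := P) 1).const_mul γ)).sub hv
  have hterm : ∀ k, ∫ x, q ^ k * ((transOp P)^[k] w x * f x) ∂μ =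
      -(q ^ k * lagCorr P μ γ f (fun x => v x - r x) v k) := by
    intro k
    rw [integral_const_mul, lagCorr, ← mul_neg, ← integral_neg]
    congr 2
    ext x
    have e : w = fun x => γ * transOp P v x - (v x - r x) := by
      ext y; simp only [w]; ring
    obtain ⟨C, hC⟩ := (hv.transOp_iterate (P := P) 1).const_mul γ
    obtain ⟨D, hD⟩ := hv.sub hr
    rw [Function.iterate_one] at hC
    rw [e, transOp_iterate_sub hC hD, transOp_iterate_const_mul,
      Function.iterate_succ_apply]
    ring
  obtain ⟨W, hW⟩ := hw
  obtain ⟨F, hF⟩ := hf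
  have hb : ∀ k x, ‖q ^ k * ((transOp P)^[k] w x * f x)‖ ≤ q ^ k * (W * F) := by
    intro k x
    rw [norm_mul, norm_pow, Real.norm_of_nonneg hq.1, norm_mul]
    exact mul_le_mul_of_nonneg_left (mul_le_mul (abs_transOp_iterate_le hW k x) (hF x)
      (norm_nonneg _) ((abs_nonneg _).trans (hW x))) (pow_nonneg hq.1 k)
  have hint : ∀ k, Integrable (fun x => q ^ k * ((transOp P)^[k] w x * f x)) μ := fun k =>
    integrable_of_forall_abs_le (hb k)
  have hsum : Summable fun k => ∫ x, ‖q ^ k * ((transOp P)^[k] w x * f x)‖ ∂μ := by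
    refine Summable.of_nonneg_of_le (fun k => integral_nonneg fun x => norm_nonneg _) (fun k => ?_)
      ((summable_geometric_of_lt_one hq.1 hq.2).mul_right (W * F))
    have := integral_mono (hint k).norm (integrable_const (q ^ k * (W * F))) (hb k)
    simpa using this
  have h := hasSum_integral_of_summable_integral_norm hint hsum
  simp only [hterm] at h
  rw [traceCorr, ← tsum_neg, h.tsum_eq]
  congr 1
  ext x
  rw [bellmanLam_eq hγ hlam hr hv, add_sub_cancel_left, ← tsum_mul_right]
  exact tsum_congr fun k => by ring

end BellmanEquation

theorem dotProduct_mulVec_ge_of_isLeast_spectrum {d : ℕ} {G : Matrix (Fin d) (Fin d) ℝ} {ν : ℝ}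
    (hG : G.IsHermitian) (hν : IsLeast (spectrum ℝ G) ν) (e : Fin d → ℝ) :
    ν * (e ⬝ᵥ e) ≤ e ⬝ᵥ (G *ᵥ e) := by
  have hH : (G - algebraMap ℝ _ ν).IsHermitian := by
    refine hG.sub ?_
    rw [Matrix.algebraMap_eq_diagonal]
    exact Matrix.isHermitian_diagonal _
  have hp : (G - algebraMap ℝ (Matrix (Fin d) (Fin d) ℝ) ν).PosSemidef := by
    rw [Matrix.posSemidef_iff_isHermitian_and_spectrum_nonneg]
    refine ⟨hH, ?_⟩
    rw [← spectrum.sub_singleton_eq]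
    rintro _ ⟨a, ha, _, rfl, rfl⟩
    exact sub_nonneg.mpr (hν.2 ha)
  have h := hp.dotProduct_mulVec_nonneg e
  rw [Matrix.sub_mulVec, dotProduct_sub, star_trivial, Algebra.algebraMap_eq_smul_one,
    Matrix.smul_mulVec, Matrix.one_mulVec, dotProduct_smul, smul_eq_mul] at h
  linarith

theorem exists_mulVec_eq_smul_of_mem_spectrum {d : ℕ} {G : Matrix (Fin d) (Fin d) ℝ} {ν : ℝ}
    (hν : ν ∈ spectrum ℝ G) : ∃ e : Fin d → ℝ, e ≠ 0 ∧ G *ᵥ e = ν • e := by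
  rw [spectrum.mem_iff, Matrix.isUnit_iff_isUnit_det, isUnit_iff_ne_zero, not_not,
    ← Matrix.exists_mulVec_eq_zero_iff] at hν
  obtain ⟨e, he, h⟩ := hν
  refine ⟨e, he, ?_⟩
  rw [Matrix.sub_mulVec, Algebra.algebraMap_eq_smul_one, Matrix.smul_mulVec, Matrix.one_mulVec,
    sub_eq_zero] at h
  exact h.symm

theorem dotProduct_self_nonneg {ι : Type*} [Fintype ι] (x : ι → ℝ) : 0 ≤ x ⬝ᵥ x :=
  Finset.sum_nonneg fun _ _ => mul_self_nonneg _

theorem abs_dotProduct_le {ι : Type*} [Fintype ι] (x y : ι → ℝ) :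
    |x ⬝ᵥ y| ≤ Real.sqrt (x ⬝ᵥ x) * Real.sqrt (y ⬝ᵥ y) := by
  rw [← Real.sqrt_mul (dotProduct_self_nonneg x)]
  refine Real.abs_le_sqrt ?_
  have := Finset.sum_mul_sq_le_sq_mul_sq Finset.univ x y
  simpa [dotProduct, sq] using this

theorem abs_dotProduct_mulVec_le {d : ℕ} (M : Matrix (Fin d) (Fin d) ℝ) (e : Fin d → ℝ) :
    |e ⬝ᵥ (M *ᵥ e)| ≤ Real.sqrt (∑ i, ∑ j, M i j ^ 2) * (e ⬝ᵥ e) := by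
  have h := abs_dotProduct_le (fun p : Fin d × Fin d => M p.1 p.2) (fun p => e p.1 * e p.2)
  have e1 : (fun p : Fin d × Fin d => M p.1 p.2) ⬝ᵥ (fun p => e p.1 * e p.2) =
      e ⬝ᵥ (M *ᵥ e) := by
    simp only [dotProduct, Matrix.mulVec, Fintype.sum_prod_type, Finset.mul_sum]
    exact Finset.sum_congr rfl fun i _ => Finset.sum_congr rfl fun j _ => by ring
  have e2 : (fun p : Fin d × Fin d => e p.1 * e p.2) ⬝ᵥ (fun p => e p.1 * e p.2) =
      (e ⬝ᵥ e) ^ 2 := by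
    rw [sq, dotProduct, dotProduct, Fintype.sum_prod_type, Finset.sum_mul_sum]
    exact Finset.sum_congr rfl fun i _ => Finset.sum_congr rfl fun j _ => by ring
  have e3 : (fun p : Fin d × Fin d => M p.1 p.2) ⬝ᵥ (fun p => M p.1 p.2) =
      ∑ i, ∑ j, M i j ^ 2 := by
    simp only [dotProduct, Fintype.sum_prod_type, sq]
  rwa [e1, e2, e3, Real.sqrt_sq (dotProduct_self_nonneg e)] at h

section Features

variable {S : Type*} [MeasurableSpace S] [Countable S] [MeasurableSingletonClass S] {d : ℕ}
  {P : Kernel S S} [IsMarkovKernel P] {μ : Measure S} [IsProbabilityMeasure μ]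
  {φ : S → Fin d → ℝ} {L ν γ lam Rmax : ℝ} {r : S → ℝ}

omit [MeasurableSpace S] [Countable S] [MeasurableSingletonClass S] in
theorem isBdd_feature (hφ : ∀ x j, |φ x j| ≤ L) (j : Fin d) : IsBdd fun x => φ x j :=
  ⟨L, fun x => hφ x j⟩

omit [MeasurableSpace S] [Countable S] [MeasurableSingletonClass S] in
theorem isBdd_dotProduct (hφ : ∀ x j, |φ x j| ≤ L) (e : Fin d → ℝ) :
    IsBdd fun x => φ x ⬝ᵥ e :=
  IsBdd.sum _ fun j => (isBdd_feature hφ j).mul (IsBdd.const (e j))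

omit [MeasurableSpace S] [Countable S] [MeasurableSingletonClass S] in
theorem dotProduct_feature_eq (φ : S → Fin d → ℝ) (e : Fin d → ℝ) :
    (fun x => φ x ⬝ᵥ e) = fun x => ∑ j, e j * φ x j := by
  ext x
  simp only [dotProduct, mul_comm]

omit [MeasurableSpace S] [Countable S] [MeasurableSingletonClass S] in
theorem dotProduct_feature_self_le (hφ : ∀ x j, |φ x j| ≤ L) (x : S) :
    φ x ⬝ᵥ φ x ≤ d * L ^ 2 := by
  calc φ x ⬝ᵥ φ x ≤ ∑ _j : Fin d, L ^ 2 := Finset.sum_le_sum fun j _ => by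
        rw [← sq]; exact sq_le_sq' (abs_le.mp (hφ x j)).1 (abs_le.mp (hφ x j)).2
    _ = d * L ^ 2 := by simp

omit [MeasurableSpace S] [Countable S] [MeasurableSingletonClass S] in
theorem abs_dotProduct_feature_le (hφ : ∀ x j, |φ x j| ≤ L) (e : Fin d → ℝ) (x : S) :
    |φ x ⬝ᵥ e| ≤ Real.sqrt (d * L ^ 2) * Real.sqrt (e ⬝ᵥ e) :=
  (abs_dotProduct_le _ _).trans (mul_le_mul_of_nonneg_right
    (Real.sqrt_le_sqrt (dotProduct_feature_self_le hφ x)) (Real.sqrt_nonneg _))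

theorem dotProduct_gramMatrix_mulVec (hφ : ∀ x j, |φ x j| ≤ L) (e : Fin d → ℝ) :
    e ⬝ᵥ (gramMatrix μ φ *ᵥ e) = ∫ x, (φ x ⬝ᵥ e) ^ 2 ∂μ := by
  have hb : ∀ i j, IsBdd fun x => e i * (φ x i * φ x j * e j) := fun i j =>
    (((isBdd_feature hφ i).mul (isBdd_feature hφ j)).mul (IsBdd.const (e j))).const_mul (e i)
  have h : ∀ x, (φ x ⬝ᵥ e) ^ 2 = ∑ i, ∑ j, e i * (φ x i * φ x j * e j) := by
    intro x
    rw [sq, dotProduct, Finset.sum_mul_sum]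
    exact Finset.sum_congr rfl fun i _ => Finset.sum_congr rfl fun j _ => by ring
  simp only [h]
  rw [integral_finsetSum _ fun i _ => (IsBdd.sum _ fun j => hb i j).integrable]
  simp only [dotProduct, Matrix.mulVec, gramMatrix, Matrix.of_apply, Finset.mul_sum]
  refine Finset.sum_congr rfl fun i _ => ?_
  rw [integral_finsetSum _ fun j _ => (hb i j).integrable]
  refine Finset.sum_congr rfl fun j _ => ?_
  rw [integral_const_mul, integral_mul_const]

theorem quadratic_form_ge (hφ : ∀ x j, |φ x j| ≤ L) (hν : IsLeast (spectrum ℝ (gramMatrix μ φ)) ν)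
    (e : Fin d → ℝ) : ν * (e ⬝ᵥ e) ≤ ∫ x, (φ x ⬝ᵥ e) ^ 2 ∂μ := by
  rw [← dotProduct_gramMatrix_mulVec hφ]
  refine dotProduct_mulVec_ge_of_isLeast_spectrum ?_ hν e
  ext i j
  simp only [Matrix.conjTranspose_apply, gramMatrix, Matrix.of_apply, star_trivial, mul_comm]

omit [IsMarkovKernel P] in
theorem integral_dotProduct_sq_pos (hP : IsErgodicKernel P) (hμ : Kernel.Invariant P μ)
    (hφ : ∀ x j, |φ x j| ≤ L) (hlin : LinearIndependent ℝ (fun (j : Fin d) (x : S) => φ x j))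
    {e : Fin d → ℝ} (he : e ≠ 0) : 0 < ∫ x, (φ x ⬝ᵥ e) ^ 2 ∂μ := by
  refine (integral_nonneg fun x => sq_nonneg _).lt_of_ne fun h => he ?_
  have h0 := (integral_eq_zero_iff_of_nonneg (fun x => sq_nonneg _)
    ((isBdd_dotProduct hφ e).pow 2).integrable).mp h.symm
  have hz : ∀ x, φ x ⬝ᵥ e = 0 := by
    intro x
    by_contra hx
    have hle : μ {x} ≤ μ {y | ¬ (φ y ⬝ᵥ e) ^ 2 = 0} := measure_mono (by
      rintro y rfl
      exact pow_ne_zero 2 hx)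
    have : μ {y | ¬ (φ y ⬝ᵥ e) ^ 2 = 0} = 0 := h0
    rw [this] at hle
    exact absurd hle (not_le.mpr (measure_singleton_pos_of_ergodic hP hμ x))
  rw [Fintype.linearIndependent_iff] at hlin
  refine funext fun j => hlin e ?_ j
  ext x
  have := hz x
  simpa [dotProduct, mul_comm] using this

omit [IsMarkovKernel P] in
theorem gram_eigenvalue_pos (hP : IsErgodicKernel P) (hμ : Kernel.Invariant P μ)
    (hφ : ∀ x j, |φ x j| ≤ L) (hlin : LinearIndependent ℝ (fun (j : Fin d) (x : S) => φ x j))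
    (hν : IsLeast (spectrum ℝ (gramMatrix μ φ)) ν) : 0 < ν := by
  obtain ⟨e, he, h⟩ := exists_mulVec_eq_smul_of_mem_spectrum hν.1
  have h1 := integral_dotProduct_sq_pos hP hμ hφ hlin he
  rw [← dotProduct_gramMatrix_mulVec hφ, h, dotProduct_smul, smul_eq_mul] at h1
  exact pos_of_mul_pos_left h1 (dotProduct_self_nonneg e)

theorem gram_eigenvalue_le (hφ : ∀ x j, |φ x j| ≤ L)
    (hν : IsLeast (spectrum ℝ (gramMatrix μ φ)) ν) : ν ≤ d * L ^ 2 := by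
  obtain ⟨e, he, h⟩ := exists_mulVec_eq_smul_of_mem_spectrum hν.1
  have hpos : 0 < e ⬝ᵥ e :=
    (dotProduct_self_nonneg e).lt_of_ne fun h => he (dotProduct_self_eq_zero.mp h.symm)
  have h1 := dotProduct_gramMatrix_mulVec (μ := μ) hφ e
  rw [h, dotProduct_smul, smul_eq_mul] at h1
  have h2 : ∫ x, (φ x ⬝ᵥ e) ^ 2 ∂μ ≤ d * L ^ 2 * (e ⬝ᵥ e) := by
    have hle : ∀ x, (φ x ⬝ᵥ e) ^ 2 ≤ d * L ^ 2 * (e ⬝ᵥ e) := fun x => by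
      have := pow_le_pow_left₀ (abs_nonneg _) (abs_dotProduct_feature_le hφ e x) 2
      rwa [sq_abs, mul_pow, Real.sq_sqrt (by positivity),
        Real.sq_sqrt (dotProduct_self_nonneg e)] at this
    have := integral_mono ((isBdd_dotProduct hφ e).pow 2).integrable
      (integrable_const (μ := μ) _) hle
    simpa using this
  rw [← h1] at h2
  exact le_of_mul_le_mul_right h2 hpos

/-- The stationary matrix `A` of the algorithm. -/
noncomputable def stationaryMatrix (P : Kernel S S) (μ : Measure S) (φ : S → Fin d → ℝ) (γ q : ℝ) :
    Matrix (Fin d) (Fin d) ℝ :=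
  Matrix.of fun a j => traceCorr P μ γ q (fun x => φ x a) (fun x => φ x j) (fun x => φ x j)

theorem stationaryMatrix_mulVec {q : ℝ} (hq : q ∈ Set.Ico (0 : ℝ) 1) (hφ : ∀ x j, |φ x j| ≤ L)
    (e : Fin d → ℝ) (a : Fin d) : (stationaryMatrix P μ φ γ q *ᵥ e) a =
      traceCorr P μ γ q (fun x => φ x a) (fun x => φ x ⬝ᵥ e) (fun x => φ x ⬝ᵥ e) := by
  rw [dotProduct_feature_eq, traceCorr_sum_right _ _ hq (isBdd_feature hφ a)
    (U := fun j x => φ x j) (fun j x => hφ x j)]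
  simp only [Matrix.mulVec, dotProduct, stationaryMatrix, Matrix.of_apply, mul_comm]

theorem dotProduct_traceCorr {q : ℝ} (hq : q ∈ Set.Ico (0 : ℝ) 1) (hφ : ∀ x j, |φ x j| ≤ L)
    {u g : S → ℝ} (hu : IsBdd u) (hg : IsBdd g) (e : Fin d → ℝ) :
    e ⬝ᵥ (fun a => traceCorr P μ γ q (fun x => φ x a) u g) =
      traceCorr P μ γ q (fun x => φ x ⬝ᵥ e) u g := by
  rw [dotProduct_feature_eq, traceCorr_sum_left _ _ hq (F := fun j x => φ x j)
    (fun j => isBdd_feature hφ j) hu hg]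
  rfl

theorem dotProduct_stationaryMatrix_ge {q : ℝ} (hμ : Kernel.Invariant P μ)
    (hq0 : 0 ≤ q) (hqγ : q ≤ γ) (hq1 : q < 1) (hφ : ∀ x j, |φ x j| ≤ L) (e : Fin d → ℝ) :
    (1 - γ) / (1 - q) * ∫ x, (φ x ⬝ᵥ e) ^ 2 ∂μ ≤ e ⬝ᵥ (stationaryMatrix P μ φ γ q *ᵥ e) := by
  have hb := isBdd_dotProduct hφ e
  have h1 : stationaryMatrix P μ φ γ q *ᵥ e = fun a => _ :=
    funext fun a => stationaryMatrix_mulVec ⟨hq0, hq1⟩ hφ e a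
  rw [h1, dotProduct_traceCorr ⟨hq0, hq1⟩ hφ hb hb]
  exact traceCorr_self_ge hμ hq0 hqγ hq1 hb

theorem isUnit_of_dotProduct_mulVec_pos {M : Matrix (Fin d) (Fin d) ℝ}
    (h : ∀ e, e ≠ 0 → 0 < e ⬝ᵥ (M *ᵥ e)) : IsUnit M := by
  rw [Matrix.isUnit_iff_isUnit_det, isUnit_iff_ne_zero]
  intro hdet
  obtain ⟨e, he, h0⟩ := Matrix.exists_mulVec_eq_zero_iff.mpr hdet
  have := h e he
  rw [h0, dotProduct_zero] at this
  exact lt_irrefl _ this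

/-- The stationary vector `b` of the algorithm. -/
noncomputable def stationaryVector (P : Kernel S S) (μ : Measure S) (φ : S → Fin d → ℝ)
    (r : S → ℝ) (γ q : ℝ) : Fin d → ℝ :=
  fun a => traceCorr P μ γ q (fun x => φ x a) r (fun _ => 0)

theorem isLSTDLimit_iff (hγ : γ ∈ Set.Ioo (0 : ℝ) 1) (hlam : lam ∈ Set.Ioo (0 : ℝ) 1)
    (hφ : ∀ x j, |φ x j| ≤ L) (hr : IsBdd r) (e : Fin d → ℝ) :
    IsLSTDLimit P μ φ r γ lam (fun x => φ x ⬝ᵥ e) ↔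
      stationaryMatrix P μ φ γ (lam * γ) *ᵥ e = stationaryVector P μ φ r γ (lam * γ) := by
  have hq : lam * γ ∈ Set.Ico (0 : ℝ) 1 := ⟨mul_nonneg hlam.1.le hγ.1.le, by
    have := mul_lt_mul hlam.2 hγ.2.le hγ.1 zero_le_one
    simpa using this⟩
  have hb := isBdd_dotProduct hφ e
  have key : ∀ f : S → ℝ, IsBdd f →
      ∫ x, (bellmanLam P r γ lam (fun x => φ x ⬝ᵥ e) x - φ x ⬝ᵥ e) * f x ∂μ =
      traceCorr P μ γ (lam * γ) f r (fun _ => 0) -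
        traceCorr P μ γ (lam * γ) f (fun x => φ x ⬝ᵥ e) (fun x => φ x ⬝ᵥ e) := by
    intro f hf
    rw [integral_bellmanLam_sub_mul hγ hlam hr hb hf, traceCorr_sub_right hq hf hb hr hb]
    ring
  constructor
  · intro h
    ext a
    have hs : (fun x => φ x a) ∈ featureSpace φ := Submodule.subset_span ⟨a, rfl⟩
    have h1 := h.2 _ hs
    rw [key _ (isBdd_feature hφ a)] at h1
    rw [stationaryMatrix_mulVec hq hφ, stationaryVector]
    linarith
  · intro h
    refine ⟨Submodule.mem_span_range_iff_exists_fun ℝ |>.mpr ⟨e, ?_⟩, fun s hs => ?_⟩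
    · ext x
      simp [dotProduct, mul_comm]
    · obtain ⟨c, rfl⟩ := (Submodule.mem_span_range_iff_exists_fun ℝ).mp hs
      have hc : (∑ i, c i • fun x => φ x i) = fun x => φ x ⬝ᵥ c := by
        ext x
        simp [dotProduct, mul_comm]
      rw [hc, key _ (isBdd_dotProduct hφ c), ← dotProduct_traceCorr hq hφ hr (IsBdd.const 0),
        ← dotProduct_traceCorr hq hφ hb hb]
      have h1 : (fun a => traceCorr P μ γ (lam * γ) (fun x => φ x a) (fun x => φ x ⬝ᵥ e)
          (fun x => φ x ⬝ᵥ e)) = stationaryMatrix P μ φ γ (lam * γ) *ᵥ e :=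
        funext fun a => (stationaryMatrix_mulVec hq hφ e a).symm
      rw [h1, h]
      exact sub_self _

omit [Countable S] [MeasurableSingletonClass S] [IsProbabilityMeasure μ] in
theorem muNorm_sq {f : S → ℝ} : muNorm μ f ^ 2 = ∫ x, f x ^ 2 ∂μ := by
  rw [muNorm, Real.sq_sqrt (integral_nonneg fun x => sq_nonneg _)]
  simp only [sq_abs]

theorem exists_unique_lstd_parameter (hγ : γ ∈ Set.Ioo (0 : ℝ) 1)
    (hlam : lam ∈ Set.Ioo (0 : ℝ) 1) (hP : IsErgodicKernel P) (hμ : Kernel.Invariant P μ)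
    (hφ : ∀ x j, |φ x j| ≤ L) (hlin : LinearIndependent ℝ (fun (j : Fin d) (x : S) => φ x j))
    (hr : IsBdd r) : ∃ θ : Fin d → ℝ,
      stationaryMatrix P μ φ γ (lam * γ) *ᵥ θ = stationaryVector P μ φ r γ (lam * γ) ∧
      ∀ w : S → ℝ, IsLSTDLimit P μ φ r γ lam w ↔ w = fun x => φ x ⬝ᵥ θ := by
  have hqγ : lam * γ ≤ γ := by nlinarith [hlam.2, hγ.1]
  have hq1 : lam * γ < 1 := hqγ.trans_lt hγ.2
  have hq0 : 0 ≤ lam * γ := mul_nonneg hlam.1.le hγ.1.le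
  have hA : IsUnit (stationaryMatrix P μ φ γ (lam * γ)) := by
    refine isUnit_of_dotProduct_mulVec_pos fun e he => ?_
    refine lt_of_lt_of_le ?_ (dotProduct_stationaryMatrix_ge hμ hq0 hqγ hq1 hφ e)
    exact mul_pos (div_pos (by linarith [hγ.2]) (by linarith))
      (integral_dotProduct_sq_pos hP hμ hφ hlin he)
  obtain ⟨θ, hθ⟩ := Matrix.mulVec_surjective_iff_isUnit.mpr hA
    (stationaryVector P μ φ r γ (lam * γ))
  refine ⟨θ, hθ, fun w => ⟨fun hw => ?_, ?_⟩⟩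
  · obtain ⟨e, he⟩ := (Submodule.mem_span_range_iff_exists_fun ℝ).mp hw.1
    have hwe : w = fun x => φ x ⬝ᵥ e := by
      rw [← he]; ext x; simp [dotProduct, mul_comm]
    rw [hwe] at hw ⊢
    have h1 := (isLSTDLimit_iff hγ hlam hφ hr e).mp hw
    have h2 := Matrix.mulVec_injective_iff_isUnit.mpr hA (h1.trans hθ.symm)
    rw [h2]
  · rintro rfl
    exact (isLSTDLimit_iff hγ hlam hφ hr θ).mpr hθ

theorem integral_abs_le_muNorm {f : S → ℝ} (hf : IsBdd f) : ∫ x, |f x| ∂μ ≤ muNorm μ f := by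
  have h := transOp_sq_le (P := Kernel.const S μ) (g := fun x => |f x|) (C := hf.choose)
    (fun x => by rw [abs_abs]; exact hf.choose_spec x)
  obtain ⟨x0⟩ : Nonempty S := nonempty_of_isProbabilityMeasure μ
  have := h x0
  simp only [transOp, Kernel.const_apply] at this
  exact Real.le_sqrt_of_sq_le this

theorem muNorm_lstd_le (hγ : γ ∈ Set.Ioo (0 : ℝ) 1)
    (hlam : lam ∈ Set.Ioo (0 : ℝ) 1) (hμ : Kernel.Invariant P μ)
    (hφ : ∀ x j, |φ x j| ≤ L) (hr : ∀ x, |r x| ≤ Rmax) {θ : Fin d → ℝ}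
    (hθ : stationaryMatrix P μ φ γ (lam * γ) *ᵥ θ = stationaryVector P μ φ r γ (lam * γ)) :
    muNorm μ (fun x => φ x ⬝ᵥ θ) ≤ Rmax / (1 - γ) := by
  set q := lam * γ
  have hqγ : q ≤ γ := by simp only [q]; nlinarith [hlam.2, hγ.1]
  have hq1 : q < 1 := hqγ.trans_lt hγ.2
  have hq0 : 0 ≤ q := mul_nonneg hlam.1.le hγ.1.le
  set v : S → ℝ := fun x => φ x ⬝ᵥ θ
  have hv : IsBdd v := isBdd_dotProduct hφ θ
  have h1 := dotProduct_stationaryMatrix_ge hμ hq0 hqγ hq1 hφ θ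
  rw [hθ] at h1
  have h2 : θ ⬝ᵥ stationaryVector P μ φ r γ q = traceCorr P μ γ q v r (fun _ => 0) :=
    dotProduct_traceCorr ⟨hq0, hq1⟩ hφ ⟨Rmax, hr⟩ (IsBdd.const 0) θ
  have hterm : ∀ k, |lagCorr P μ γ v r (fun _ => 0) k| ≤ muNorm μ v * Rmax := by
    intro k
    have h0 : (transOp P)^[k + 1] (fun _ : S => (0 : ℝ)) = fun _ => 0 := by
      simpa using transOp_iterate_const_mul (P := P) 0 (fun _ => 0) (k + 1)
    rw [lagCorr, h0]
    simp only [mul_zero, sub_zero]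
    have hrk : IsBdd ((transOp P)^[k] r) := IsBdd.transOp_iterate ⟨Rmax, hr⟩ k
    obtain ⟨x0⟩ : Nonempty S := nonempty_of_isProbabilityMeasure μ
    have hR : 0 ≤ Rmax := (abs_nonneg _).trans (hr x0)
    have hva : IsBdd fun x => |v x| := hv.imp fun C hC x => by rw [abs_abs]; exact hC x
    calc |∫ x, v x * (transOp P)^[k] r x ∂μ| ≤ ∫ x, |v x| * Rmax ∂μ := by
          refine (norm_integral_le_integral_norm _).trans (integral_mono
            (hv.mul hrk).integrable.norm (hva.mul (IsBdd.const Rmax)).integrable fun x => ?_)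
          rw [norm_mul]
          exact mul_le_mul_of_nonneg_left (abs_transOp_iterate_le hr k x) (norm_nonneg _)
      _ ≤ _ := by
          rw [integral_mul_const]
          exact mul_le_mul_of_nonneg_right (integral_abs_le_muNorm hv) hR
  have h3 : traceCorr P μ γ q v r (fun _ => 0) ≤ muNorm μ v * Rmax / (1 - q) := by
    have hs := summable_traceCorr (P := P) (μ := μ) (γ := γ) ⟨hq0, hq1⟩ hv
      ⟨Rmax, hr⟩ (IsBdd.const 0)
    refine (hs.tsum_le_tsum (g := fun k => q ^ k * (muNorm μ v * Rmax)) (fun k =>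
      mul_le_mul_of_nonneg_left ((le_abs_self _).trans (hterm k)) (pow_nonneg hq0 k))
      ((summable_geometric_of_lt_one hq0 hq1).mul_right _)).trans (le_of_eq ?_)
    rw [tsum_mul_right, tsum_geometric_of_lt_one hq0 hq1]
    ring
  have h4 := h1.trans (h2.le.trans h3)
  have h5 : ∫ x, (φ x ⬝ᵥ θ) ^ 2 ∂μ = muNorm μ v ^ 2 := muNorm_sq.symm
  rw [h5] at h4
  have hγ1 : 0 < 1 - γ := by linarith [hγ.2]
  have hq1' : 0 < 1 - q := by linarith
  rw [le_div_iff₀ hγ1]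
  have h6 : (1 - γ) * muNorm μ v ^ 2 ≤ muNorm μ v * Rmax := by
    have := mul_le_mul_of_nonneg_right h4 hq1'.le
    rw [div_mul_cancel₀ _ hq1'.ne'] at this
    refine le_trans (le_of_eq ?_) this
    field_simp
  rcases (Real.sqrt_nonneg (∫ x, |v x| ^ 2 ∂μ)).eq_or_lt with h | h
  · have h' : muNorm μ v = 0 := h.symm
    obtain ⟨x0⟩ : Nonempty S := nonempty_of_isProbabilityMeasure μ
    rw [h', zero_mul]
    exact (abs_nonneg _).trans (hr x0)
  · have h' : 0 < muNorm μ v := h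
    nlinarith

theorem dotProduct_self_le_of_muNorm_le (hφ : ∀ x j, |φ x j| ≤ L)
    (hν : IsLeast (spectrum ℝ (gramMatrix μ φ)) ν) (hν0 : 0 < ν) (e : Fin d → ℝ) :
    Real.sqrt (e ⬝ᵥ e) ≤ muNorm μ (fun x => φ x ⬝ᵥ e) / Real.sqrt ν := by
  rw [le_div_iff₀ (Real.sqrt_pos.mpr hν0), ← Real.sqrt_mul (dotProduct_self_nonneg e), muNorm]
  refine Real.sqrt_le_sqrt ?_
  simp only [sq_abs]
  rw [mul_comm]
  exact quadratic_form_ge hφ hν e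

/-- Perturbation bound for the parameter equation, measured in the `μ`-norm. -/
theorem isUnit_and_muNorm_sub_le {q ρ H : ℝ} (hμ : Kernel.Invariant P μ) (hγ : γ < 1)
    (hq0 : 0 ≤ q) (hqγ : q ≤ γ) (hφ : ∀ x j, |φ x j| ≤ L)
    (hν : IsLeast (spectrum ℝ (gramMatrix μ φ)) ν) (hν0 : 0 < ν)
    {M : Matrix (Fin d) (Fin d) ℝ} {c θ : Fin d → ℝ} (hρ : ρ < 1)
    (hM : Real.sqrt (∑ i, ∑ j, (M - stationaryMatrix P μ φ γ q) i j ^ 2) ≤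
      ρ * ((1 - γ) / (1 - q) * ν))
    (hη : Real.sqrt ((M *ᵥ θ - c) ⬝ᵥ (M *ᵥ θ - c)) ≤ (1 - γ) / (1 - q) * Real.sqrt ν * H) :
    IsUnit M ∧ muNorm μ (fun x => φ x ⬝ᵥ θ - φ x ⬝ᵥ (M⁻¹ *ᵥ c)) ≤ H / (1 - ρ) := by
  set A := stationaryMatrix P μ φ γ q
  have hq1 : q < 1 := hqγ.trans_lt hγ
  have hκ : 0 < (1 - γ) / (1 - q) := div_pos (by linarith) (by linarith)
  set κ₀ := (1 - γ) / (1 - q)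
  have hcoer : ∀ e : Fin d → ℝ, κ₀ * (1 - ρ) * ∫ x, (φ x ⬝ᵥ e) ^ 2 ∂μ ≤ e ⬝ᵥ (M *ᵥ e) := by
    intro e
    have h1 : κ₀ * ∫ x, (φ x ⬝ᵥ e) ^ 2 ∂μ ≤ e ⬝ᵥ (A *ᵥ e) :=
      dotProduct_stationaryMatrix_ge hμ hq0 hqγ hq1 hφ e
    have h2 := abs_dotProduct_mulVec_le (M - A) e
    have h3 : e ⬝ᵥ ((M - A) *ᵥ e) = e ⬝ᵥ (M *ᵥ e) - e ⬝ᵥ (A *ᵥ e) := by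
      rw [Matrix.sub_mulVec, dotProduct_sub]
    have h4 := h2.trans (mul_le_mul_of_nonneg_right hM (dotProduct_self_nonneg e))
    have hρ0 : 0 ≤ ρ := by
      have := (Real.sqrt_nonneg _).trans hM
      exact nonneg_of_mul_nonneg_left this (mul_pos hκ hν0)
    have h5 := mul_le_mul_of_nonneg_left (quadratic_form_ge hφ hν e) (mul_nonneg hρ0 hκ.le)
    have h6 := (abs_le.mp h4).1
    rw [h3] at h6
    nlinarith
  have hunit : IsUnit M := by
    refine isUnit_of_dotProduct_mulVec_pos fun e he => lt_of_lt_of_le ?_ (hcoer e)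
    have hpos : 0 < e ⬝ᵥ e :=
      (dotProduct_self_nonneg e).lt_of_ne fun h => he (dotProduct_self_eq_zero.mp h.symm)
    have := quadratic_form_ge hφ hν e
    have h1 : 0 < ∫ x, (φ x ⬝ᵥ e) ^ 2 ∂μ := lt_of_lt_of_le (mul_pos hν0 hpos) this
    exact mul_pos (mul_pos hκ (by linarith)) h1
  refine ⟨hunit, ?_⟩
  set e := θ - M⁻¹ *ᵥ c
  have hMe : M *ᵥ e = M *ᵥ θ - c := by
    rw [Matrix.mulVec_sub, Matrix.mulVec_mulVec, Matrix.mul_nonsing_inv _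
      ((Matrix.isUnit_iff_isUnit_det M).mp hunit), Matrix.one_mulVec]
  have hfun : (fun x => φ x ⬝ᵥ θ - φ x ⬝ᵥ (M⁻¹ *ᵥ c)) = fun x => φ x ⬝ᵥ e := by
    ext x; rw [dotProduct_sub]
  rw [hfun]
  set u := muNorm μ fun x => φ x ⬝ᵥ e
  have hu0 : 0 ≤ u := Real.sqrt_nonneg _
  have h1 := hcoer e
  rw [← muNorm_sq (f := fun x => φ x ⬝ᵥ e), hMe] at h1
  have hs : 0 < Real.sqrt ν := Real.sqrt_pos.mpr hν0
  have h2 : e ⬝ᵥ (M *ᵥ θ - c) ≤ u / Real.sqrt ν * (κ₀ * Real.sqrt ν * H) :=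
    (le_abs_self _).trans ((abs_dotProduct_le _ _).trans (mul_le_mul
      (dotProduct_self_le_of_muNorm_le hφ hν hν0 e) hη (Real.sqrt_nonneg _) (by positivity)))
  have h3 : u / Real.sqrt ν * (κ₀ * Real.sqrt ν * H) = κ₀ * (u * H) := by field_simp
  have h4 : κ₀ * ((1 - ρ) * u ^ 2) ≤ κ₀ * (u * H) := by
    rw [← h3, ← mul_assoc]; exact h1.trans h2
  have h5 := le_of_mul_le_mul_left h4 hκ
  have h1ρ : 0 < 1 - ρ := by linarith
  rw [le_div_iff₀ h1ρ]
  have hH : 0 ≤ H := by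
    have := (Real.sqrt_nonneg _).trans hη
    exact nonneg_of_mul_nonneg_right this (mul_pos hκ hs)
  rcases hu0.eq_or_lt with h | h
  · rw [← h, zero_mul]; exact hH
  · nlinarith

end Features

section Tensor

variable {ι ι' : Type*} [Fintype ι] [Fintype ι']

/-- The outer product of two vectors as an element of a Euclidean space. -/
noncomputable def tensorVec (u : ι → ℝ) (w : ι' → ℝ) : EuclideanSpace ℝ (ι × ι') :=
  WithLp.toLp 2 fun p => u p.1 * w p.2

theorem norm_tensorVec (u : ι → ℝ) (w : ι' → ℝ) :
    ‖tensorVec u w‖ = Real.sqrt (u ⬝ᵥ u) * Real.sqrt (w ⬝ᵥ w) := by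
  rw [EuclideanSpace.norm_eq, ← Real.sqrt_mul (dotProduct_self_nonneg u), dotProduct, dotProduct,
    Finset.sum_mul_sum, Fintype.sum_prod_type]
  congr 1
  refine Finset.sum_congr rfl fun i _ => Finset.sum_congr rfl fun j _ => ?_
  simp only [tensorVec, Real.norm_eq_abs, sq_abs]
  ring

omit [Fintype ι] [Fintype ι'] in
theorem tensorVec_sum_smul {κ : Type*} (s : Finset κ) (c : κ → ℝ) (u : κ → ι → ℝ) (w : ι' → ℝ) :
    tensorVec (∑ k ∈ s, c k • u k) w = ∑ k ∈ s, c k • tensorVec (u k) w := by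
  ext p
  simp only [tensorVec, Finset.sum_apply, Pi.smul_apply, smul_eq_mul, WithLp.ofLp_sum,
    WithLp.ofLp_smul, Finset.sum_mul, mul_assoc]

theorem euclidean_integral_apply {Ω : Type*} [MeasurableSpace Ω] {Pr : Measure Ω}
    {F : Ω → EuclideanSpace ℝ ι} (hF : Integrable F Pr) (i : ι) :
    (∫ ω, F ω ∂Pr) i = ∫ ω, F ω i ∂Pr :=
  ((EuclideanSpace.proj (𝕜 := ℝ) i).integral_comp_comm hF).symm

end Tensor

theorem eligTrace_eq_sum_range {S Ω : Type*} {d : ℕ} (φ : S → Fin d → ℝ) (γ lam : ℝ)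
    (X : ℕ → Ω → S) (i : ℕ) (ω : Ω) : eligTrace φ γ lam X i ω =
      ∑ k ∈ Finset.range i, (lam * γ) ^ k • φ (X (i - k) ω) := by
  refine Finset.sum_nbij' (fun k => i - k) (fun k => i - k) ?_ ?_ ?_ ?_ ?_
  · intro k hk; simp only [Finset.mem_Icc, Finset.mem_range] at *; omega
  · intro k hk; simp only [Finset.mem_Icc, Finset.mem_range] at *; omega
  · intro k hk; simp only [Finset.mem_Icc] at hk; omega
  · intro k hk; simp only [Finset.mem_range] at hk; omega
  · intro k hk
    simp only [Finset.mem_Icc] at hk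
    rw [Nat.sub_sub_self hk.2]

section GeometricSums

variable {E : Type*} [NormedAddCommGroup E] [NormedSpace ℝ E] {q D : ℝ} {W : ℕ → E}

theorem norm_sum_range_geometric_smul_le (hq : q ∈ Set.Ico (0 : ℝ) 1) (hW : ∀ k, ‖W k‖ ≤ D)
    (n : ℕ) : ‖∑ k ∈ Finset.range n, q ^ k • W k‖ ≤ D / (1 - q) := by
  have hD : 0 ≤ D := (norm_nonneg _).trans (hW 0)
  calc _ ≤ ∑ k ∈ Finset.range n, q ^ k * D := (norm_sum_le _ _).trans
        (Finset.sum_le_sum fun k _ => by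
          rw [norm_smul, norm_pow, Real.norm_of_nonneg hq.1]
          exact mul_le_mul_of_nonneg_left (hW k) (pow_nonneg hq.1 k))
    _ ≤ _ := by
        rw [← Finset.sum_mul, div_eq_inv_mul]
        refine mul_le_mul_of_nonneg_right ?_ hD
        rw [← tsum_geometric_of_lt_one hq.1 hq.2]
        exact (summable_geometric_of_lt_one hq.1 hq.2).sum_le_tsum _
          fun _ _ => pow_nonneg hq.1 _

theorem norm_sum_range_sub_sum_range_geometric_smul_le (hq : q ∈ Set.Ico (0 : ℝ) 1)
    (hW : ∀ k, ‖W k‖ ≤ D) {m n : ℕ} (hmn : m ≤ n) :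
    ‖∑ k ∈ Finset.range n, q ^ k • W k - ∑ k ∈ Finset.range m, q ^ k • W k‖ ≤
      q ^ m * (D / (1 - q)) := by
  obtain ⟨l, rfl⟩ := Nat.exists_eq_add_of_le hmn
  rw [Finset.sum_range_add, add_sub_cancel_left]
  have : ∑ k ∈ Finset.range l, q ^ (m + k) • W (m + k) =
      q ^ m • ∑ k ∈ Finset.range l, q ^ k • W (m + k) := by
    rw [Finset.smul_sum]
    exact Finset.sum_congr rfl fun k _ => by rw [pow_add, mul_smul]
  rw [this, norm_smul, norm_pow, Real.norm_of_nonneg hq.1]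
  exact mul_le_mul_of_nonneg_left (norm_sum_range_geometric_smul_le hq (fun k => hW (m + k)) l)
    (pow_nonneg hq.1 m)

end GeometricSums

section TraceProcess

variable {S : Type*} [MeasurableSpace S] [Countable S] [MeasurableSingletonClass S] {d : ℕ}
  {P : Kernel S S} [IsMarkovKernel P] {μ : Measure S} [IsProbabilityMeasure μ]
  {φ : S → Fin d → ℝ} {L γ lam B q : ℝ}
  {Ω : Type*} [m0 : MeasurableSpace Ω] {Pr : Measure Ω} [IsProbabilityMeasure Pr]
  {X : ℕ → Ω → S} {ι : Type*} [Fintype ι] {f g : ι → S → ℝ}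

/-- The increment `ψ_i = f(X_i) - γ g(X_{i+1})`. -/
def tdIncrement (γ : ℝ) (f g : ι → S → ℝ) (X : ℕ → Ω → S) (i : ℕ) (ω : Ω) : ι → ℝ :=
  fun j => f j (X i ω) - γ * g j (X (i + 1) ω)

/-- The term of lag `k` in the trace product, `φ(X_{i-k}) ⊗ ψ_i`. -/
noncomputable def lagTerm (φ : S → Fin d → ℝ) (γ : ℝ) (f g : ι → S → ℝ) (X : ℕ → Ω → S)
    (i k : ℕ) (ω : Ω) : EuclideanSpace ℝ (Fin d × ι) :=
  tensorVec (φ (X (i - k) ω)) (tdIncrement γ f g X i ω)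

/-- The stationary mean of the trace product. -/
noncomputable def traceMean (P : Kernel S S) (μ : Measure S) (φ : S → Fin d → ℝ) (γ q : ℝ)
    (f g : ι → S → ℝ) : EuclideanSpace ℝ (Fin d × ι) :=
  WithLp.toLp 2 fun p => traceCorr P μ γ q (fun x => φ x p.1) (f p.2) (g p.2)

omit [MeasurableSpace S] [Countable S] [MeasurableSingletonClass S] m0 in
theorem norm_lagTerm_le (hφ : ∀ x j, |φ x j| ≤ L) (hB0 : 0 ≤ B)
    (hB : ∀ x y, ∑ j, (f j x - γ * g j y) ^ 2 ≤ B ^ 2) (i k : ℕ) (ω : Ω) :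
    ‖lagTerm φ γ f g X i k ω‖ ≤ Real.sqrt (d * L ^ 2) * B := by
  rw [lagTerm, norm_tensorVec]
  refine mul_le_mul (Real.sqrt_le_sqrt (dotProduct_feature_self_le hφ _)) ?_
    (Real.sqrt_nonneg _) (Real.sqrt_nonneg _)
  refine Real.sqrt_le_iff.mpr ⟨hB0, ?_⟩
  simpa only [dotProduct, tdIncrement, ← sq] using hB (X i ω) (X (i + 1) ω)

omit m0 in
theorem stronglyMeasurable_lagTerm {m' : MeasurableSpace Ω} {i k : ℕ}
    (h1 : Measurable[m'] (X (i - k))) (h2 : Measurable[m'] (X i)) (h3 : Measurable[m'] (X (i + 1))) :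
    StronglyMeasurable[m'] (lagTerm φ γ f g X i k) := by
  refine (PiLp.continuous_toLp 2 _).comp_stronglyMeasurable ?_
  refine Measurable.stronglyMeasurable ?_
  refine measurable_pi_lambda _ fun p => ?_
  have e1 : Measurable[m'] fun ω => φ (X (i - k) ω) p.1 :=
    (measurable_of_countable fun x => φ x p.1).comp h1
  have e2 : Measurable[m'] fun ω => f p.2 (X i ω) := (measurable_of_countable (f p.2)).comp h2
  have e3 : Measurable[m'] fun ω => g p.2 (X (i + 1) ω) :=
    (measurable_of_countable (g p.2)).comp h3
  exact e1.mul (e2.sub (e3.const_mul γ))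

omit [IsMarkovKernel P] [IsProbabilityMeasure μ] in
theorem integrable_lagTerm (hX : IsMarkovChain Pr P μ X) (hφ : ∀ x j, |φ x j| ≤ L) (hB0 : 0 ≤ B)
    (hB : ∀ x y, ∑ j, (f j x - γ * g j y) ^ 2 ≤ B ^ 2) {i k : ℕ} (hik : k < i) :
    Integrable (lagTerm φ γ f g X i k) Pr :=
  Integrable.of_bound (stronglyMeasurable_lagTerm (hX.measurable _ (by omega))
    (hX.measurable _ (by omega)) (hX.measurable _ (by omega))).aestronglyMeasurable _
    (ae_of_all _ (norm_lagTerm_le hφ hB0 hB i k))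

theorem integral_lagTerm (hX : IsMarkovChain Pr P μ X) (hμ : Kernel.Invariant P μ)
    (hφ : ∀ x j, |φ x j| ≤ L) (hB0 : 0 ≤ B)
    (hB : ∀ x y, ∑ j, (f j x - γ * g j y) ^ 2 ≤ B ^ 2)
    (hf : ∀ j, IsBdd (f j)) (hg : ∀ j, IsBdd (g j)) {i k : ℕ} (hik : k < i) :
    ∫ ω, lagTerm φ γ f g X i k ω ∂Pr =
      WithLp.toLp 2 fun p => lagCorr P μ γ (fun x => φ x p.1) (f p.2) (g p.2) k := by
  ext p
  rw [euclidean_integral_apply (integrable_lagTerm hX hφ hB0 hB hik)]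
  obtain ⟨F, hF⟩ := hf p.2
  obtain ⟨G, hG⟩ := hg p.2
  have hi : 1 ≤ i - k := by omega
  have e1 := hX.integral_mul_eq hμ (f := fun x => φ x p.1) (fun x => hφ x p.1) hF hi k
  have e2 := hX.integral_mul_eq hμ (f := fun x => φ x p.1) (fun x => hφ x p.1) hG hi (k + 1)
  rw [Nat.sub_add_cancel hik.le] at e1
  rw [← add_assoc, Nat.sub_add_cancel hik.le] at e2
  have b1 := (isBdd_feature hφ p.1).mul (IsBdd.transOp_iterate (P := P) (hf p.2) k)
  have b2 := (isBdd_feature hφ p.1).mul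
    (IsBdd.transOp_iterate (P := P) (hg p.2) (k + 1))
  have hbm : ∀ {u : S → ℝ} {U : ℝ} {l : ℕ}, (∀ x, |u x| ≤ U) → 1 ≤ l →
      Integrable (fun ω => φ (X (i - k) ω) p.1 * u (X l ω)) Pr := fun {u U l} hu hl => by
    refine Integrable.of_bound (C := L * U) ?_ (ae_of_all _ fun ω => ?_)
    · exact (((measurable_of_countable fun x => φ x p.1).comp (hX.measurable _ hi)).mul
        ((measurable_of_countable u).comp (hX.measurable _ hl))).aestronglyMeasurable
    · rw [norm_mul]
      exact mul_le_mul (hφ _ _) (hu _) (norm_nonneg _) ((abs_nonneg _).trans (hφ (X i ω) p.1))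
  calc ∫ ω, lagTerm φ γ f g X i k ω p ∂Pr
      = ∫ ω, (φ (X (i - k) ω) p.1 * f p.2 (X i ω) -
          γ * (φ (X (i - k) ω) p.1 * g p.2 (X (i + 1) ω))) ∂Pr := by
        congr 1; ext ω
        simp only [lagTerm, tensorVec, tdIncrement]
        ring
    _ = ∫ x, φ x p.1 * (transOp P)^[k] (f p.2) x ∂μ -
          γ * ∫ x, φ x p.1 * (transOp P)^[k + 1] (g p.2) x ∂μ := by
        rw [integral_sub (hbm hF (by omega)) ((hbm hG (by omega)).const_mul γ),
          integral_const_mul, e1, e2]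
    _ = _ := by
        rw [← integral_const_mul, ← integral_sub b1.integrable (b2.const_mul γ).integrable]
        simp only [lagCorr]
        congr 1; ext x; ring

theorem norm_lagCorr_vec_le (hX : IsMarkovChain Pr P μ X) (hμ : Kernel.Invariant P μ)
    (hφ : ∀ x j, |φ x j| ≤ L) (hB0 : 0 ≤ B)
    (hB : ∀ x y, ∑ j, (f j x - γ * g j y) ^ 2 ≤ B ^ 2)
    (hf : ∀ j, IsBdd (f j)) (hg : ∀ j, IsBdd (g j)) (k : ℕ) :
    ‖(WithLp.toLp 2 fun p => lagCorr P μ γ (fun x => φ x p.1) (f p.2) (g p.2) k :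
      EuclideanSpace ℝ (Fin d × ι))‖ ≤ Real.sqrt (d * L ^ 2) * B := by
  rw [← integral_lagTerm hX hμ hφ hB0 hB hf hg (Nat.lt_succ_self k)]
  have := norm_integral_le_of_norm_le_const (μ := Pr)
    (ae_of_all _ (norm_lagTerm_le (X := X) hφ hB0 hB (k + 1) k))
  simpa using this

omit [Countable S] [MeasurableSingletonClass S] [Fintype ι] in
theorem tendsto_sum_lagCorr_vec (hq : q ∈ Set.Ico (0 : ℝ) 1) (hφ : ∀ x j, |φ x j| ≤ L)
    (hf : ∀ j, IsBdd (f j)) (hg : ∀ j, IsBdd (g j)) :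
    Tendsto (fun n => ∑ k ∈ Finset.range n, q ^ k • (WithLp.toLp 2 fun p =>
      lagCorr P μ γ (fun x => φ x p.1) (f p.2) (g p.2) k : EuclideanSpace ℝ (Fin d × ι)))
      atTop (nhds (traceMean P μ φ γ q f g)) := by
  have h : ∀ n, ∑ k ∈ Finset.range n, q ^ k • (WithLp.toLp 2 fun p =>
      lagCorr P μ γ (fun x => φ x p.1) (f p.2) (g p.2) k : EuclideanSpace ℝ (Fin d × ι)) =
      WithLp.toLp 2 fun p => ∑ k ∈ Finset.range n,
        q ^ k * lagCorr P μ γ (fun x => φ x p.1) (f p.2) (g p.2) k := fun n => by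
    ext p
    simp only [WithLp.ofLp_sum, WithLp.ofLp_smul, Finset.sum_apply, Pi.smul_apply, smul_eq_mul]
  simp only [h]
  refine ((PiLp.continuous_toLp 2 _).tendsto _).comp (tendsto_pi_nhds.mpr fun p => ?_)
  exact (summable_traceCorr hq (isBdd_feature hφ p.1) (hf p.2) (hg p.2)).hasSum.tendsto_sum_nat

/-- The trace product truncated to `m` lags. -/
noncomputable def truncTrace (φ : S → Fin d → ℝ) (γ q : ℝ) (f g : ι → S → ℝ) (X : ℕ → Ω → S)
    (m i : ℕ) (ω : Ω) : EuclideanSpace ℝ (Fin d × ι) :=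
  ∑ k ∈ Finset.range m, q ^ k • lagTerm φ γ f g X i k ω

omit m0 in
theorem stronglyMeasurable_truncTrace {m' : MeasurableSpace Ω} {m i : ℕ} (hm : 1 ≤ m)
    (hX : ∀ l, i + 1 - m ≤ l → l ≤ i + 1 → Measurable[m'] (X l)) :
    StronglyMeasurable[m'] (truncTrace φ γ q f g X m i) := by
  refine Finset.stronglyMeasurable_fun_sum _ fun k hk => StronglyMeasurable.fun_const_smul ?_ _
  have := Finset.mem_range.mp hk
  exact stronglyMeasurable_lagTerm (hX _ (by omega) (by omega)) (hX _ (by omega) (by omega))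
    (hX _ (by omega) (by omega))

theorem norm_integral_truncTrace_sub_traceMean_le (hX : IsMarkovChain Pr P μ X)
    (hμ : Kernel.Invariant P μ) (hq : q ∈ Set.Ico (0 : ℝ) 1) (hφ : ∀ x j, |φ x j| ≤ L)
    (hB0 : 0 ≤ B) (hB : ∀ x y, ∑ j, (f j x - γ * g j y) ^ 2 ≤ B ^ 2)
    (hf : ∀ j, IsBdd (f j)) (hg : ∀ j, IsBdd (g j)) {m i : ℕ} (hmi : m ≤ i) :
    ‖traceMean P μ φ γ q f g - ∫ ω, truncTrace φ γ q f g X m i ω ∂Pr‖ ≤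
      q ^ m * (Real.sqrt (d * L ^ 2) * B / (1 - q)) := by
  have e : ∫ ω, truncTrace φ γ q f g X m i ω ∂Pr = ∑ k ∈ Finset.range m,
      q ^ k • (WithLp.toLp 2 fun p => lagCorr P μ γ (fun x => φ x p.1) (f p.2) (g p.2) k :
        EuclideanSpace ℝ (Fin d × ι)) := by
    simp only [truncTrace]
    rw [integral_finsetSum (f := fun k ω => q ^ k • lagTerm φ γ f g X i k ω) _
      fun k hk => (integrable_lagTerm hX hφ hB0 hB
      ((Finset.mem_range.mp hk).trans_le hmi)).smul (q ^ k)]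
    refine Finset.sum_congr rfl fun k hk => ?_
    rw [integral_smul, integral_lagTerm hX hμ hφ hB0 hB hf hg
      ((Finset.mem_range.mp hk).trans_le hmi)]
  rw [e]
  refine le_of_tendsto (((tendsto_sum_lagCorr_vec hq hφ hf hg).sub_const _).norm) ?_
  filter_upwards [eventually_ge_atTop m] with n hn
  exact norm_sum_range_sub_sum_range_geometric_smul_le hq
    (norm_lagCorr_vec_le hX hμ hφ hB0 hB hf hg) hn

theorem norm_traceMean_le (hX : IsMarkovChain Pr P μ X)
    (hμ : Kernel.Invariant P μ) (hq : q ∈ Set.Ico (0 : ℝ) 1) (hφ : ∀ x j, |φ x j| ≤ L)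
    (hB0 : 0 ≤ B) (hB : ∀ x y, ∑ j, (f j x - γ * g j y) ^ 2 ≤ B ^ 2)
    (hf : ∀ j, IsBdd (f j)) (hg : ∀ j, IsBdd (g j)) :
    ‖traceMean P μ φ γ q f g‖ ≤ Real.sqrt (d * L ^ 2) * B / (1 - q) := by
  have := norm_integral_truncTrace_sub_traceMean_le hX hμ hq hφ hB0 hB hf hg (Nat.le_refl 0)
  simpa [truncTrace] using this

omit [MeasurableSpace S] [Countable S] [MeasurableSingletonClass S] m0 [Fintype ι] in
theorem tensorVec_eligTrace (φ : S → Fin d → ℝ) (γ lam : ℝ) (f g : ι → S → ℝ) (X : ℕ → Ω → S)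
    (i : ℕ) (ω : Ω) : tensorVec (eligTrace φ γ lam X i ω) (tdIncrement γ f g X i ω) =
      truncTrace φ γ (lam * γ) f g X i i ω := by
  rw [eligTrace_eq_sum_range, tensorVec_sum_smul]
  rfl

theorem norm_sum_trace_sub_traceMean_le_trivial (hX : IsMarkovChain Pr P μ X)
    (hμ : Kernel.Invariant P μ) (hq : q ∈ Set.Ico (0 : ℝ) 1) (hφ : ∀ x j, |φ x j| ≤ L)
    (hB0 : 0 ≤ B) (hB : ∀ x y, ∑ j, (f j x - γ * g j y) ^ 2 ≤ B ^ 2)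
    (hf : ∀ j, IsBdd (f j)) (hg : ∀ j, IsBdd (g j)) (s : Finset ℕ) (ω : Ω) :
    ‖∑ i ∈ s, (truncTrace φ γ q f g X i i ω - traceMean P μ φ γ q f g)‖ ≤
      s.card * (2 * (Real.sqrt (d * L ^ 2) * B / (1 - q))) := by
  rw [← nsmul_eq_mul]
  refine norm_sum_le_of_le _ (fun i _ => ?_) |>.trans (by rw [Finset.sum_const])
  rw [two_mul]
  exact (norm_sub_le _ _).trans (add_le_add
    (norm_sum_range_geometric_smul_le hq (fun k => norm_lagTerm_le hφ hB0 hB i k ω) i)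
    (norm_traceMean_le hX hμ hq hφ hB0 hB hf hg))

theorem norm_sum_trace_sub_traceMean_le (hX : IsMarkovChain Pr P μ X)
    (hμ : Kernel.Invariant P μ) (hq : q ∈ Set.Ico (0 : ℝ) 1) (hφ : ∀ x j, |φ x j| ≤ L)
    (hB0 : 0 ≤ B) (hB : ∀ x y, ∑ j, (f j x - γ * g j y) ^ 2 ≤ B ^ 2)
    (hf : ∀ j, IsBdd (f j)) (hg : ∀ j, IsBdd (g j)) {m N : ℕ} (hm : 1 ≤ m)
    (hmN : N * q ^ m ≤ 1) (ω : Ω) :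
    ‖∑ i ∈ Finset.Icc 1 N, (truncTrace φ γ q f g X i i ω - traceMean P μ φ γ q f g)‖ ≤
      ‖∑ i ∈ Finset.Icc m N, (truncTrace φ γ q f g X m i ω -
        ∫ ω', truncTrace φ γ q f g X m i ω' ∂Pr)‖ +
      2 * m * (Real.sqrt (d * L ^ 2) * B / (1 - q)) := by
  set C := Real.sqrt (d * L ^ 2) * B / (1 - q)
  have hC : 0 ≤ C := div_nonneg (by positivity) (by linarith [hq.2])
  rw [← Finset.sum_filter_add_sum_filter_not (Finset.Icc 1 N) (fun i => m ≤ i)]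
  have hfil : (Finset.Icc 1 N).filter (fun i => m ≤ i) = Finset.Icc m N := by
    ext i; simp only [Finset.mem_filter, Finset.mem_Icc]; omega
  have hcard : ((Finset.Icc 1 N).filter (fun i => ¬ m ≤ i)).card ≤ m - 1 := by
    have : (Finset.Icc 1 N).filter (fun i => ¬ m ≤ i) ⊆ Finset.Icc 1 (m - 1) := by
      intro i; simp only [Finset.mem_filter, Finset.mem_Icc]; omega
    exact (Finset.card_le_card this).trans (by simp)
  have h2 := norm_sum_trace_sub_traceMean_le_trivial hX hμ hq hφ hB0 hB hf hg
    ((Finset.Icc 1 N).filter (fun i => ¬ m ≤ i)) ω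
  have h2' : (((Finset.Icc 1 N).filter (fun i => ¬ m ≤ i)).card : ℝ) * (2 * C) ≤
      (m - 1) * (2 * C) := by
    refine mul_le_mul_of_nonneg_right ?_ (by positivity)
    have : (((Finset.Icc 1 N).filter (fun i => ¬ m ≤ i)).card : ℝ) ≤ ((m - 1 : ℕ) : ℝ) := by
      exact_mod_cast hcard
    rwa [Nat.cast_sub hm, Nat.cast_one] at this
  have hsplit : ∑ i ∈ Finset.Icc m N, (truncTrace φ γ q f g X i i ω - traceMean P μ φ γ q f g) =
      ∑ i ∈ Finset.Icc m N, (truncTrace φ γ q f g X m i ω -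
        ∫ ω', truncTrace φ γ q f g X m i ω' ∂Pr) +
      ∑ i ∈ Finset.Icc m N, ((truncTrace φ γ q f g X i i ω - truncTrace φ γ q f g X m i ω) -
        (traceMean P μ φ γ q f g - ∫ ω', truncTrace φ γ q f g X m i ω' ∂Pr)) := by
    rw [← Finset.sum_add_distrib]
    exact Finset.sum_congr rfl fun i _ => by abel
  have h3 : ‖∑ i ∈ Finset.Icc m N, ((truncTrace φ γ q f g X i i ω -
      truncTrace φ γ q f g X m i ω) -
      (traceMean P μ φ γ q f g - ∫ ω', truncTrace φ γ q f g X m i ω' ∂Pr))‖ ≤ 2 * C := by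
    have hle : ∀ i ∈ Finset.Icc m N, ‖(truncTrace φ γ q f g X i i ω -
        truncTrace φ γ q f g X m i ω) -
        (traceMean P μ φ γ q f g - ∫ ω', truncTrace φ γ q f g X m i ω' ∂Pr)‖ ≤
        2 * (q ^ m * C) := by
      intro i hi
      rw [two_mul]
      exact (norm_sub_le _ _).trans (add_le_add
        (norm_sum_range_sub_sum_range_geometric_smul_le hq
          (fun k => norm_lagTerm_le hφ hB0 hB i k ω) (Finset.mem_Icc.mp hi).1)
        (norm_integral_truncTrace_sub_traceMean_le hX hμ hq hφ hB0 hB hf hg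
          (Finset.mem_Icc.mp hi).1))
    refine (norm_sum_le_of_le _ hle).trans ?_
    rw [Finset.sum_const, nsmul_eq_mul, Nat.card_Icc]
    have hN : ((N + 1 - m : ℕ) : ℝ) ≤ N := by exact_mod_cast (by omega : N + 1 - m ≤ N)
    have hp : 0 ≤ 2 * (q ^ m * C) := by have := pow_nonneg hq.1 m; positivity
    refine (mul_le_mul_of_nonneg_right hN hp).trans ?_
    have := mul_le_mul_of_nonneg_right hmN hC
    nlinarith
  rw [hfil, hsplit]
  refine (norm_add_le _ _).trans ?_
  have h4 := norm_add_le (∑ i ∈ Finset.Icc m N, (truncTrace φ γ q f g X m i ω -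
        ∫ ω', truncTrace φ γ q f g X m i ω' ∂Pr))
      (∑ i ∈ Finset.Icc m N, ((truncTrace φ γ q f g X i i ω - truncTrace φ γ q f g X m i ω) -
        (traceMean P μ φ γ q f g - ∫ ω', truncTrace φ γ q f g X m i ω' ∂Pr)))
  have h5 := h2.trans h2'
  linarith

omit [Countable S] [MeasurableSingletonClass S] m0 in
theorem measurable_pastSigma (X : ℕ → Ω → S) {l t : ℕ} (hl : 1 ≤ l) (hlt : l ≤ t) :
    Measurable[pastSigma X t] (X l) := by
  have h : MeasurableSpace.comap (X l) inferInstance ≤ pastSigma X t :=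
    le_biSup (fun i => MeasurableSpace.comap (X i) inferInstance)
      (show l ∈ Set.Icc 1 t from ⟨hl, hlt⟩)
  exact measurable_iff_comap_le.mpr h

omit [Countable S] [MeasurableSingletonClass S] m0 in
theorem measurable_futureSigma (X : ℕ → Ω → S) {l t : ℕ} (hl : t ≤ l) :
    Measurable[futureSigma X t] (X l) := by
  have h : MeasurableSpace.comap (X l) inferInstance ≤ futureSigma X t :=
    le_biSup (fun i => MeasurableSpace.comap (X i) inferInstance) (show l ∈ Set.Ici t from hl)
  exact measurable_iff_comap_le.mpr h

/-- Concentration of the empirical trace product around its stationary mean. -/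
theorem measureReal_trace_deviation_le {βbar b κ δ : ℝ} (hX : IsMarkovChain Pr P μ X)
    (hμ : Kernel.Invariant P μ) (hβbar : 0 < βbar) (hb : 0 < b) (hκ : 0 < κ)
    (hδ : δ ∈ Set.Ioo (0 : ℝ) 1)
    (hmix : ∀ i : ℕ, 1 ≤ i →
      betaCoeff Pr X i ≤ ENNReal.ofReal (βbar * Real.exp (-b * (i : ℝ) ^ κ)))
    (hq : lam * γ ∈ Set.Ico (0 : ℝ) 1) (hφ : ∀ x j, |φ x j| ≤ L)
    (hB0 : 0 ≤ B) (hB : ∀ x y, ∑ j, (f j x - γ * g j y) ^ 2 ≤ B ^ 2)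
    (hf : ∀ j, IsBdd (f j)) (hg : ∀ j, IsBdd (g j)) {m N : ℕ} (hN : 1 ≤ N)
    (hmN : N * (lam * γ) ^ m ≤ 1) :
    Pr.real {ω | Real.sqrt (d * L ^ 2) * B / (1 - lam * γ) *
        (devLevel βbar b κ δ m N + 2 * m / N) <
      ‖(1 / (N : ℝ)) • ∑ i ∈ Finset.Icc 1 N, tensorVec (eligTrace φ γ lam X i ω)
        (tdIncrement γ f g X i ω) - traceMean P μ φ γ (lam * γ) f g‖} ≤ δ / (8 * N ^ 2) := by
  set q := lam * γ
  set C := Real.sqrt (d * L ^ 2) * B / (1 - q)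
  have hC : 0 ≤ C := div_nonneg (by positivity) (by linarith [hq.2])
  have hN' : (1 : ℝ) ≤ N := by exact_mod_cast hN
  have hN0 : (0 : ℝ) < N := by linarith
  have hδ0 := hδ.1
  set τ := devLevel βbar b κ δ m N with hτ
  have hτ0 : 0 ≤ τ := by simp only [hτ, devLevel]; positivity
  have hrew : ∀ ω, ‖(1 / (N : ℝ)) • ∑ i ∈ Finset.Icc 1 N, tensorVec (eligTrace φ γ lam X i ω)
        (tdIncrement γ f g X i ω) - traceMean P μ φ γ q f g‖ =
      1 / N * ‖∑ i ∈ Finset.Icc 1 N,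
        (truncTrace φ γ q f g X i i ω - traceMean P μ φ γ q f g)‖ := by
    intro ω
    have : (1 / (N : ℝ)) • ∑ i ∈ Finset.Icc 1 N, tensorVec (eligTrace φ γ lam X i ω)
        (tdIncrement γ f g X i ω) - traceMean P μ φ γ q f g = (1 / (N : ℝ)) •
        ∑ i ∈ Finset.Icc 1 N, (truncTrace φ γ q f g X i i ω - traceMean P μ φ γ q f g) := by
      simp only [tensorVec_eligTrace]
      rw [Finset.sum_sub_distrib, smul_sub, Finset.sum_const, Nat.card_Icc, Nat.add_sub_cancel,
        ← Nat.cast_smul_eq_nsmul ℝ, smul_smul, one_div_mul_cancel hN0.ne', one_smul]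
    rw [this, norm_smul, Real.norm_of_nonneg (by positivity)]
  simp only [hrew]
  rcases le_or_gt (2 * C) (C * (τ + 2 * m / N)) with hcase | hcase
  · have hempty : ∀ ω, ¬ (C * (τ + 2 * m / N) < 1 / N * ‖∑ i ∈ Finset.Icc 1 N,
        (truncTrace φ γ q f g X i i ω - traceMean P μ φ γ q f g)‖) := by
      intro ω
      rw [not_lt]
      have h1 := norm_sum_trace_sub_traceMean_le_trivial hX hμ hq hφ hB0 hB hf hg
        (Finset.Icc 1 N) ω
      rw [Nat.card_Icc, Nat.add_sub_cancel] at h1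
      refine le_trans ?_ hcase
      rw [one_div_mul_eq_div, div_le_iff₀ hN0, mul_comm (2 * C)]
      exact h1
    simp only [hempty, Set.ofPred_false, measureReal_empty]
    positivity
  have hC0 : 0 < C := by
    refine hC.lt_of_ne fun h => ?_
    rw [← h] at hcase
    simp at hcase
  have hτ2 : τ < 2 := by
    have hm0 : (0 : ℝ) ≤ 2 * m / N := by positivity
    rw [mul_comm 2 C] at hcase
    linarith [lt_of_mul_lt_mul_left hcase hC]
  have hm : 1 ≤ m := by
    by_contra! hm
    obtain rfl : m = 0 := by omega
    rw [pow_zero, mul_one] at hmN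
    have h1 := mul_devLevel_sq (βbar := βbar) (b := b) hN' (le_refl (0 : ℝ)) hκ hδ
    have h2 := one_le_mixLambda (βbar := βbar) hN' hδ
    have h3 := one_le_mixTime (βbar := βbar) (b := b) (x := N) (δ := δ) hκ
    have h4 : (N : ℝ) = 1 := le_antisymm hmN hN'
    have h5 : devLevel βbar b κ δ 0 N = τ := by simp [hτ]
    rw [h5, h4] at h1
    rw [h4] at h2 h3
    nlinarith
  have hconc := measureReal_norm_window_sum_ge_le (Pr := Pr) hX.measurable hβbar hb hκ hδ hmix hm hN
    (Y := truncTrace φ γ q f g X m) hC0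
    (fun i hi => stronglyMeasurable_truncTrace hm fun l hl hl' =>
      measurable_pastSigma X (by have := (Finset.mem_Icc.mp hi).1; omega) hl')
    (fun i hi => stronglyMeasurable_truncTrace hm fun l hl _ => measurable_futureSigma X hl)
    (fun i _ ω => norm_sum_range_geometric_smul_le hq
      (fun k => norm_lagTerm_le hφ hB0 hB i k ω) m) hτ2
  refine (measureReal_mono (fun ω hω => ?_) (measure_ne_top _ _)).trans hconc
  rw [Set.mem_ofPred_eq] at hω ⊢
  have h1 := norm_sum_trace_sub_traceMean_le hX hμ hq hφ hB0 hB hf hg hm hmN ω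
  rw [one_div_mul_eq_div, lt_div_iff₀ hN0] at hω
  have e : C * (τ + 2 * m / N) * N = C * N * τ + 2 * m * C := by field_simp
  rw [e] at hω
  linarith

end TraceProcess

theorem exists_nat_eq_truncLen {γ lam : ℝ} (hq : lam * γ ∈ Set.Ioo (0 : ℝ) 1) {n : ℕ}
    (hn : 2 ≤ n) : ∃ m : ℕ, truncLen γ lam n = m ∧
      ((n - 1 : ℕ) : ℝ) * (lam * γ) ^ m ≤ 1 := by
  have hN : ((n - 1 : ℕ) : ℝ) = (n : ℝ) - 1 := by
    rw [Nat.cast_sub (by omega), Nat.cast_one]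
  have hN1 : (1 : ℝ) ≤ (n : ℝ) - 1 := by
    rw [← hN]; exact_mod_cast (by omega : 1 ≤ n - 1)
  have hlog : 0 < Real.log (1 / (lam * γ)) :=
    Real.log_pos (by rw [lt_div_iff₀ hq.1]; linarith [hq.2])
  set x := Real.log ((n : ℝ) - 1) / Real.log (1 / (lam * γ)) with hx
  have hx0 : 0 ≤ x := div_nonneg (Real.log_nonneg hN1) hlog.le
  obtain ⟨m, hm⟩ := Int.eq_ofNat_of_zero_le (Int.ceil_nonneg hx0)
  have htr : truncLen γ lam n = m := by
    rw [truncLen, ← hx, hm]; simp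
  refine ⟨m, htr, ?_⟩
  have hle : x ≤ m := by rw [← htr]; exact Int.le_ceil x
  rw [hx, div_le_iff₀ hlog, one_div, Real.log_inv] at hle
  rw [hN]
  have hpos : 0 < (lam * γ) ^ m := pow_pos hq.1 m
  have h1 : Real.log (((n : ℝ) - 1) * (lam * γ) ^ m) ≤ 0 := by
    rw [Real.log_mul (by linarith) hpos.ne', Real.log_pow]
    linarith
  exact (Real.log_nonpos_iff (by positivity)).mp h1

/-- The coefficient `2 V_max d L² / ((1 - γ) ν)`. -/
noncomputable def errorCoef (d : ℕ) (L Rmax γ ν : ℝ) : ℝ :=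
  2 * (Rmax / (1 - γ)) * d * L ^ 2 / ((1 - γ) * ν)

/-- The remainder in the estimation error bound. -/
noncomputable def errorRemainder (d : ℕ) (L Rmax γ lam ν βbar b κ : ℝ) (n : ℕ) (δ : ℝ) : ℝ :=
  (leadingTerm d L Rmax γ lam ν βbar b κ δ n * burnInLHS d L γ lam ν βbar b κ δ n +
    errorCoef d L Rmax γ ν * (2 * truncLen γ lam n / ((n : ℝ) - 1))) /
    (1 - burnInLHS d L γ lam ν βbar b κ δ n)

theorem sq_sub_sub_mul_le {γ : ℝ} (hγ : γ ∈ Set.Ioo (0 : ℝ) 1) {a b c M : ℝ} (ha : |a| ≤ M)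
    (hb : |b| ≤ M) (hc : |c| ≤ M * (1 - γ)) : ((a - c) - γ * b) ^ 2 ≤ (2 * M) ^ 2 := by
  obtain ⟨ha1, ha2⟩ := abs_le.mp ha
  obtain ⟨hb1, hb2⟩ := abs_le.mp hb
  obtain ⟨hc1, hc2⟩ := abs_le.mp hc
  have h1 := mul_le_mul_of_nonneg_left hb1 hγ.1.le
  have h2 := mul_le_mul_of_nonneg_left hb2 hγ.1.le
  exact sq_le_sq' (by linarith) (by linarith)

theorem sq_sub_mul_le {γ : ℝ} (hγ : γ ∈ Set.Ioo (0 : ℝ) 1) {a b M : ℝ} (ha : |a| ≤ M)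
    (hb : |b| ≤ M) : (a - γ * b) ^ 2 ≤ 2 ^ 2 * M ^ 2 := by
  have h := sq_sub_sub_mul_le (c := 0) hγ ha hb (by
    rw [abs_zero]
    exact mul_nonneg ((abs_nonneg _).trans ha) (by linarith [hγ.2]))
  rwa [sub_zero, mul_pow] at h

section PerSample

variable {S : Type*} [MeasurableSpace S] [Countable S] [MeasurableSingletonClass S] {d : ℕ}
  {P : Kernel S S} [IsMarkovKernel P] {μ : Measure S} [IsProbabilityMeasure μ]
  {φ : S → Fin d → ℝ} {L Rmax γ lam ν βbar b κ δ : ℝ} {r : S → ℝ}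
  {Ω : Type*} [m0 : MeasurableSpace Ω] {Pr : Measure Ω} [IsProbabilityMeasure Pr]
  {X : ℕ → Ω → S}

omit [MeasurableSpace S] [Countable S] [MeasurableSingletonClass S] m0 in
theorem AHat_apply (φ : S → Fin d → ℝ) (γ lam : ℝ) (X : ℕ → Ω → S) {n : ℕ} (hn : 1 ≤ n) (ω : Ω)
    (i j : Fin d) : AHat φ γ lam X n ω i j =
      ((1 / ((n - 1 : ℕ) : ℝ)) • ∑ k ∈ Finset.Icc 1 (n - 1), tensorVec (eligTrace φ γ lam X k ω)
        (tdIncrement γ (fun j x => φ x j) (fun j x => φ x j) X k ω) :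
          EuclideanSpace ℝ (Fin d × Fin d)) (i, j) := by
  rw [Nat.cast_sub hn, Nat.cast_one]
  simp only [AHat, Matrix.smul_apply, Matrix.sum_apply, Matrix.vecMulVec_apply, Pi.sub_apply,
    Pi.smul_apply, smul_eq_mul, WithLp.ofLp_smul, WithLp.ofLp_sum, Finset.sum_apply, tensorVec,
    tdIncrement]

omit [Countable S] [MeasurableSingletonClass S] [IsMarkovKernel P] [IsProbabilityMeasure μ] m0 in
theorem sqrt_sum_sq_AHat_sub (φ : S → Fin d → ℝ) (γ lam : ℝ) (X : ℕ → Ω → S) {n : ℕ} (hn : 1 ≤ n)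
    (ω : Ω) : Real.sqrt (∑ i, ∑ j,
        (AHat φ γ lam X n ω - stationaryMatrix P μ φ γ (lam * γ)) i j ^ 2) =
      ‖(1 / ((n - 1 : ℕ) : ℝ)) • ∑ k ∈ Finset.Icc 1 (n - 1),
        tensorVec (eligTrace φ γ lam X k ω)
          (tdIncrement γ (fun j x => φ x j) (fun j x => φ x j) X k ω) -
        traceMean P μ φ γ (lam * γ) (fun j x => φ x j) (fun j x => φ x j)‖ := by
  rw [EuclideanSpace.norm_eq, Fintype.sum_prod_type]
  congr 1
  refine Finset.sum_congr rfl fun i _ => Finset.sum_congr rfl fun j _ => ?_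
  rw [Real.norm_eq_abs, sq_abs, Matrix.sub_apply, AHat_apply φ γ lam X hn]
  rfl

omit m0 in
theorem sqrt_dotProduct_residual (hq : lam * γ ∈ Set.Ico (0 : ℝ) 1) (hφ : ∀ x j, |φ x j| ≤ L)
    (hr : IsBdd r) {θ : Fin d → ℝ}
    (hθ : stationaryMatrix P μ φ γ (lam * γ) *ᵥ θ = stationaryVector P μ φ r γ (lam * γ))
    (X : ℕ → Ω → S) {n : ℕ} (hn : 1 ≤ n) (ω : Ω) :
    Real.sqrt ((AHat φ γ lam X n ω *ᵥ θ - bHat φ r γ lam X n ω) ⬝ᵥ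
      (AHat φ γ lam X n ω *ᵥ θ - bHat φ r γ lam X n ω)) =
      ‖(1 / ((n - 1 : ℕ) : ℝ)) • ∑ k ∈ Finset.Icc 1 (n - 1),
        tensorVec (eligTrace φ γ lam X k ω)
          (tdIncrement γ (fun (_ : Unit) x => φ x ⬝ᵥ θ - r x) (fun _ x => φ x ⬝ᵥ θ) X k ω) -
        traceMean P μ φ γ (lam * γ) (fun (_ : Unit) x => φ x ⬝ᵥ θ - r x)
          (fun _ x => φ x ⬝ᵥ θ)‖ := by
  have hb := isBdd_dotProduct hφ θ
  rw [EuclideanSpace.norm_eq, Fintype.sum_prod_type, dotProduct]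
  congr 1
  refine Finset.sum_congr rfl fun a _ => ?_
  rw [Fintype.sum_unique, Real.norm_eq_abs, sq_abs, sq]
  have hmean : traceCorr P μ γ (lam * γ) (fun x => φ x a) (fun x => φ x ⬝ᵥ θ - r x)
      (fun x => φ x ⬝ᵥ θ) = 0 := by
    rw [traceCorr_sub_right hq (isBdd_feature hφ a) hb hr hb, ← stationaryMatrix_mulVec hq hφ, hθ]
    exact sub_self _
  have hcoord : (AHat φ γ lam X n ω *ᵥ θ - bHat φ r γ lam X n ω) a =
      ((1 / ((n - 1 : ℕ) : ℝ)) • ∑ k ∈ Finset.Icc 1 (n - 1),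
        tensorVec (eligTrace φ γ lam X k ω)
          (tdIncrement γ (fun (_ : Unit) x => φ x ⬝ᵥ θ - r x) (fun _ x => φ x ⬝ᵥ θ) X k ω) -
        traceMean P μ φ γ (lam * γ) (fun (_ : Unit) x => φ x ⬝ᵥ θ - r x)
          (fun _ x => φ x ⬝ᵥ θ) : EuclideanSpace ℝ (Fin d × Unit)) (a, default) := by
    have hN : ((n - 1 : ℕ) : ℝ) = (n : ℝ) - 1 := by rw [Nat.cast_sub hn, Nat.cast_one]
    have hm0 : (traceMean P μ φ γ (lam * γ) (fun (_ : Unit) x => φ x ⬝ᵥ θ - r x)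
          (fun _ x => φ x ⬝ᵥ θ) : EuclideanSpace ℝ (Fin d × Unit)) (a, default) = 0 := hmean
    rw [WithLp.ofLp_sub, Pi.sub_apply, Pi.sub_apply, hm0, sub_zero, hN]
    simp only [AHat, bHat, Matrix.smul_mulVec, Matrix.sum_mulVec, Pi.smul_apply,
      smul_eq_mul, WithLp.ofLp_smul, WithLp.ofLp_sum, Finset.sum_apply, tensorVec, tdIncrement,
      Matrix.vecMulVec_mulVec]
    rw [← mul_sub, ← Finset.sum_sub_distrib]
    congr 1
    refine Finset.sum_congr rfl fun k _ => ?_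
    simp only [smul_eq_mul, MulOpposite.smul_eq_mul_unop, MulOpposite.unop_op,
      sub_dotProduct, smul_dotProduct]
    ring
  rw [hcoord]

set_option maxHeartbeats 1000000 in
/-- For a single sample size, the estimation error bound holds with high probability. -/
theorem measureReal_not_estimate_le (hγ : γ ∈ Set.Ioo (0 : ℝ) 1) (hlam : lam ∈ Set.Ioo (0 : ℝ) 1)
    (hβbar : 0 < βbar) (hb : 0 < b) (hκ : 0 < κ) (hδ : δ ∈ Set.Ioo (0 : ℝ) 1)
    (hμ : Kernel.Invariant P μ)
    (hr : ∀ x, |r x| ≤ Rmax) (hφ : ∀ x j, |φ x j| ≤ L)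
    (hν : IsLeast (spectrum ℝ (gramMatrix μ φ)) ν) (hν0 : 0 < ν)
    (hX : IsMarkovChain Pr P μ X)
    (hmix : ∀ i : ℕ, 1 ≤ i →
      betaCoeff Pr X i ≤ ENNReal.ofReal (βbar * Real.exp (-b * (i : ℝ) ^ κ)))
    {θ : Fin d → ℝ}
    (hθ : stationaryMatrix P μ φ γ (lam * γ) *ᵥ θ = stationaryVector P μ φ r γ (lam * γ))
    {n : ℕ} (hn : 2 ≤ n) (hburn : burnInLHS d L γ lam ν βbar b κ δ n < 1) :
    Pr.real {ω | ¬ (IsUnit (AHat φ γ lam X n ω) ∧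
      muNorm μ (fun x => φ x ⬝ᵥ θ - vHat φ r γ lam X n ω x) ≤
        leadingTerm d L Rmax γ lam ν βbar b κ δ n +
          errorRemainder d L Rmax γ lam ν βbar b κ n δ)} ≤
      δ / (4 * ((n - 1 : ℕ) : ℝ) ^ 2) := by
  have hq0 : 0 < lam * γ := mul_pos hlam.1 hγ.1
  have hqγ : lam * γ ≤ γ := by nlinarith [hlam.2, hγ.1]
  have hq1 : lam * γ < 1 := hqγ.trans_lt hγ.2
  have hq : lam * γ ∈ Set.Ico (0 : ℝ) 1 := ⟨hq0.le, hq1⟩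
  obtain ⟨m, hm, hmN⟩ := exists_nat_eq_truncLen ⟨hq0, hq1⟩ hn
  have hN : ((n - 1 : ℕ) : ℝ) = (n : ℝ) - 1 := by
    rw [Nat.cast_sub (by omega), Nat.cast_one]
  set N : ℕ := n - 1
  have hN1 : 1 ≤ N := by omega
  have hN1' : (1 : ℝ) ≤ N := by exact_mod_cast hN1
  have hN0 : (0 : ℝ) < N := by linarith
  obtain ⟨x0⟩ : Nonempty S := nonempty_of_isProbabilityMeasure μ
  have hR : 0 ≤ Rmax := (abs_nonneg _).trans (hr x0)
  have hγ1 : 0 < 1 - γ := by linarith [hγ.2]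
  set V := Rmax / (1 - γ) with hV
  have hV0 : 0 ≤ V := div_nonneg hR hγ1.le
  set D := (d : ℝ) * L ^ 2 with hD
  have hD0 : 0 ≤ D := by positivity
  have hνD : ν ≤ D := gram_eigenvalue_le hφ hν
  have hsν : 0 < Real.sqrt ν := Real.sqrt_pos.mpr hν0
  have hsD : 0 ≤ Real.sqrt D := Real.sqrt_nonneg _
  have hsνD : 1 ≤ Real.sqrt D / Real.sqrt ν := by
    rw [one_le_div hsν]; exact Real.sqrt_le_sqrt hνD
  have hrb : IsBdd r := ⟨Rmax, hr⟩
  have hvb := isBdd_dotProduct hφ θ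
  have hvV : muNorm μ (fun x => φ x ⬝ᵥ θ) ≤ V := muNorm_lstd_le hγ hlam hμ hφ hr hθ
  have hvsup : ∀ x, |φ x ⬝ᵥ θ| ≤ Real.sqrt D / Real.sqrt ν * V := by
    intro x
    refine (abs_dotProduct_feature_le hφ θ x).trans ?_
    rw [div_mul_eq_mul_div, mul_div_assoc]
    refine mul_le_mul_of_nonneg_left ?_ hsD
    exact (dotProduct_self_le_of_muNorm_le hφ hν hν0 θ).trans
      (div_le_div_of_nonneg_right hvV hsν.le)
  set τ := devLevel βbar b κ δ m N with hτ
  have hτ0 : 0 ≤ τ := by simp only [hτ, devLevel]; positivity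
  set G := τ + 2 * m / N with hG
  have hG0 : 0 ≤ G := by positivity
  set ρ := burnInLHS d L γ lam ν βbar b κ δ n with hρ
  have hdev : 2 / Real.sqrt ((n : ℝ) - 1) *
      Real.sqrt ((truncLen γ lam n + 1) * mixI βbar b κ ((n : ℝ) - 1) δ) = τ := by
    rw [hτ, devLevel, hm, hN]
  have hρG : 2 * D / ((1 - γ) * ν) * G ≤ ρ := by
    rw [hρ, burnInLHS, hdev, hm, ← hN, hG]
    have h1 : 0 ≤ 1 / ((N : ℝ) * (1 - lam * γ)) := by
      have : 0 < 1 - lam * γ := by linarith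
      positivity
    have e : 2 / (N : ℝ) * m = 2 * m / N := by ring
    rw [e, hD, ← mul_assoc]
    refine mul_le_mul_of_nonneg_left (by linarith) (by positivity)
  have hlead : leadingTerm d L Rmax γ lam ν βbar b κ δ n = errorCoef d L Rmax γ ν * τ := by
    rw [leadingTerm, errorCoef, ← hdev, ← hV, add_comm 1 (truncLen γ lam n)]
    have : 0 < Real.sqrt ((n : ℝ) - 1) := Real.sqrt_pos.mpr (by rw [← hN]; exact hN0)
    field_simp
    ring
  have hBA : ∀ x y, ∑ j, (φ x j - γ * φ y j) ^ 2 ≤ (2 * Real.sqrt D) ^ 2 := by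
    intro x y
    rw [mul_pow, Real.sq_sqrt hD0]
    calc ∑ j, (φ x j - γ * φ y j) ^ 2 ≤ ∑ _j : Fin d, 2 ^ 2 * L ^ 2 :=
          Finset.sum_le_sum fun j _ => sq_sub_mul_le hγ (hφ x j) (hφ y j)
      _ = 2 ^ 2 * D := by rw [hD]; simp; ring
  have hBη : ∀ x y, ∑ _j : Unit, ((φ x ⬝ᵥ θ - r x) - γ * (φ y ⬝ᵥ θ)) ^ 2 ≤
      (2 * Real.sqrt D * V / Real.sqrt ν) ^ 2 := by
    intro x y
    rw [Fintype.sum_unique]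
    have e : 2 * Real.sqrt D * V / Real.sqrt ν = 2 * (Real.sqrt D / Real.sqrt ν * V) := by ring
    rw [e]
    refine sq_sub_sub_mul_le hγ (hvsup x) (hvsup y) ((hr x).trans ?_)
    have e2 : Rmax = V * (1 - γ) := by rw [hV]; field_simp
    rw [e2]
    exact mul_le_mul_of_nonneg_right (le_mul_of_one_le_left hV0 hsνD) hγ1.le
  have hA := measureReal_trace_deviation_le hX hμ hβbar hb hκ hδ hmix hq hφ
    (B := 2 * Real.sqrt D) (by positivity) (f := fun j x => φ x j) (g := fun j x => φ x j) hBA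
    (isBdd_feature hφ) (isBdd_feature hφ) hN1 hmN
  have hη := measureReal_trace_deviation_le hX hμ hβbar hb hκ hδ hmix hq hφ
    (B := 2 * Real.sqrt D * V / Real.sqrt ν) (by positivity)
    (f := fun (_ : Unit) x => φ x ⬝ᵥ θ - r x) (g := fun _ x => φ x ⬝ᵥ θ) hBη
    (fun _ => hvb.sub hrb) (fun _ => hvb) hN1 hmN
  have hsum : δ / (4 * (N : ℝ) ^ 2) = δ / (8 * N ^ 2) + δ / (8 * N ^ 2) := by
    field_simp; ring
  rw [hsum]
  refine le_trans (measureReal_mono ?_ (measure_ne_top _ _))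
    ((measureReal_union_le _ _).trans (add_le_add hA hη))
  intro ω hω
  rw [Set.mem_ofPred_eq] at hω
  by_contra hcon
  rw [Set.mem_union, not_or] at hcon
  obtain ⟨h1, h2⟩ := hcon
  rw [Set.mem_ofPred_eq, not_lt, ← sqrt_sum_sq_AHat_sub φ γ lam X (by omega)] at h1
  rw [Set.mem_ofPred_eq, not_lt, ← sqrt_dotProduct_residual hq hφ hrb hθ X (by omega)] at h2
  apply hω
  have h1q : 0 < 1 - lam * γ := by linarith
  rw [← hD, ← hτ, ← hG] at h1 h2
  have key := isUnit_and_muNorm_sub_le (H := errorCoef d L Rmax γ ν * G) hμ hγ.2 hq0.le hqγ hφ hν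
    hν0 hburn (M := AHat φ γ lam X n ω) (c := bHat φ r γ lam X n ω) (θ := θ) (h1.trans ?_)
    (h2.trans ?_)
  · refine ⟨key.1, key.2.trans (le_of_eq ?_)⟩
    rw [errorRemainder, hlead, ← hρ, hm, ← hN, hG]
    have : 1 - ρ ≠ 0 := by linarith
    field_simp
    ring
  · have e : Real.sqrt D * (2 * Real.sqrt D) / (1 - lam * γ) * G =
        (2 * D / ((1 - γ) * ν) * G) * ((1 - γ) / (1 - lam * γ) * ν) := by
      have := Real.mul_self_sqrt hD0
      field_simp
      rw [sq, this]; ring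
    rw [e]
    exact mul_le_mul_of_nonneg_right hρG (by positivity)
  · refine le_of_eq ?_
    rw [errorCoef, ← hV]
    have e1 := Real.mul_self_sqrt hD0
    have e2 := Real.mul_self_sqrt hν0.le
    have e3 : 2 * V * d * L ^ 2 / ((1 - γ) * ν) = 2 * V * D / ((1 - γ) * ν) := by
      rw [hD]; ring
    rw [e3]
    have e4 : 2 * V * D / ((1 - γ) * ν) = 2 * V * (Real.sqrt D * Real.sqrt D) /
        ((1 - γ) * (Real.sqrt ν * Real.sqrt ν)) := by rw [e1, e2]
    rw [e4]
    field_simp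

end PerSample

theorem tsum_ofReal_div_sq_le {δ : ℝ} (hδ : 0 < δ) :
    ∑' k : ℕ, ENNReal.ofReal (δ / (4 * ((k + 1 : ℕ) : ℝ) ^ 2)) ≤ ENNReal.ofReal δ := by
  have hz := (hasSum_nat_add_iff' 1).mpr hasSum_zeta_two
  simp only [Finset.sum_range_one, Nat.cast_zero, ne_eq, OfNat.ofNat_ne_zero, not_false_eq_true,
    zero_pow, div_zero, sub_zero] at hz
  have h := hz.mul_left (δ / 4)
  have e : (fun k : ℕ => δ / 4 * (1 / ((k + 1 : ℕ) : ℝ) ^ 2)) =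
      fun k : ℕ => δ / (4 * ((k + 1 : ℕ) : ℝ) ^ 2) := by
    ext k; field_simp
  rw [e] at h
  rw [← ENNReal.ofReal_tsum_of_nonneg (fun k => by positivity) h.summable, h.tsum_eq]
  refine ENNReal.ofReal_le_ofReal ?_
  have hpi : Real.pi ^ 2 ≤ 16 := by nlinarith [Real.pi_le_four, Real.pi_pos]
  nlinarith

/-- `f` grows at most like a power of the logarithm. -/
def IsPolylog (f : ℕ → ℝ) : Prop :=
  ∃ k : ℕ, f =O[atTop] fun n : ℕ => Real.log n ^ k

theorem tendsto_log_natCast_atTop : Tendsto (fun n : ℕ => Real.log n) atTop atTop :=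
  Real.tendsto_log_atTop.comp tendsto_natCast_atTop_atTop

theorem isBigO_log_pow_of_le {j k : ℕ} (h : j ≤ k) :
    (fun n : ℕ => Real.log n ^ j) =O[atTop] fun n : ℕ => Real.log n ^ k := by
  refine Asymptotics.IsBigO.of_bound 1 ?_
  filter_upwards [tendsto_log_natCast_atTop.eventually_ge_atTop 1] with n hn
  rw [one_mul, norm_pow, norm_pow, Real.norm_of_nonneg (by linarith)]
  exact pow_le_pow_right₀ hn h

namespace IsPolylog

variable {f g : ℕ → ℝ}

theorem const (c : ℝ) : IsPolylog fun _ => c :=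
  ⟨0, by simpa using Asymptotics.isBigO_const_const c (one_ne_zero : (1 : ℝ) ≠ 0) atTop⟩

theorem log : IsPolylog fun n : ℕ => Real.log n :=
  ⟨1, by simpa using Asymptotics.isBigO_refl _ _⟩

theorem add (hf : IsPolylog f) (hg : IsPolylog g) : IsPolylog fun n => f n + g n := by
  obtain ⟨j, hj⟩ := hf
  obtain ⟨k, hk⟩ := hg
  exact ⟨max j k, (hj.trans (isBigO_log_pow_of_le (le_max_left _ _))).add
    (hk.trans (isBigO_log_pow_of_le (le_max_right _ _)))⟩

theorem mul (hf : IsPolylog f) (hg : IsPolylog g) : IsPolylog fun n => f n * g n := by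
  obtain ⟨j, hj⟩ := hf
  obtain ⟨k, hk⟩ := hg
  refine ⟨j + k, ?_⟩
  simp only [pow_add]
  exact hj.mul hk

theorem pow (hf : IsPolylog f) (p : ℕ) : IsPolylog fun n => f n ^ p := by
  obtain ⟨k, hk⟩ := hf
  refine ⟨k * p, ?_⟩
  simp only [pow_mul]
  exact hk.pow p

theorem abs (hf : IsPolylog f) : IsPolylog fun n => |f n| :=
  hf.imp fun _ h => h.abs_left

theorem of_isBigO (hg : IsPolylog g) (h : f =O[atTop] g) : IsPolylog f :=
  hg.imp fun _ hk => h.trans hk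

theorem mono (hg : IsPolylog g) (h : ∀ᶠ n in atTop, |f n| ≤ g n) : IsPolylog f :=
  hg.of_isBigO (Asymptotics.IsBigO.of_bound 1 (h.mono fun n hn => by
    rw [one_mul]; exact hn.trans (le_abs_self _)))

theorem sqrt (hf : IsPolylog f) : IsPolylog fun n => Real.sqrt (f n) := by
  refine ((const 1).add hf.abs).mono (Eventually.of_forall fun n => ?_)
  rw [abs_of_nonneg (Real.sqrt_nonneg _)]
  refine Real.sqrt_le_iff.mpr ⟨by positivity, ?_⟩
  nlinarith [le_abs_self (f n), abs_nonneg (f n)]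

theorem max (hf : IsPolylog f) (hg : IsPolylog g) : IsPolylog fun n => max (f n) (g n) := by
  refine (hf.abs.add hg.abs).mono (Eventually.of_forall fun n => ?_)
  refine abs_max_le_max_abs_abs.trans (max_le ?_ ?_)
  · linarith [abs_nonneg (g n)]
  · linarith [abs_nonneg (f n)]

theorem rpow_const (hf : IsPolylog f) (h1 : ∀ n, 1 ≤ f n) (p : ℝ) :
    IsPolylog fun n => f n ^ p := by
  refine (hf.pow ⌈p⌉₊).mono (Eventually.of_forall fun n => ?_)
  rw [abs_of_nonneg (Real.rpow_nonneg (by linarith [h1 n]) _), ← Real.rpow_natCast]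
  exact Real.rpow_le_rpow_of_exponent_le (h1 n) (Nat.le_ceil p)

theorem tendsto_mul_inv_sqrt (hf : IsPolylog f) :
    Tendsto (fun n : ℕ => f n * (1 / Real.sqrt ((n : ℝ) - 1))) atTop (nhds 0) := by
  obtain ⟨k, hk⟩ := hf
  have h1 : (fun n : ℕ => 1 / Real.sqrt ((n : ℝ) - 1)) =O[atTop]
      fun n : ℕ => (((n : ℝ)) ^ (1 / 2 : ℝ))⁻¹ := by
    refine Asymptotics.IsBigO.of_bound 2 ?_
    filter_upwards [eventually_ge_atTop 2] with n hn
    have hn' : (2 : ℝ) ≤ n := by exact_mod_cast hn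
    rw [← Real.sqrt_eq_rpow, Real.norm_of_nonneg (by positivity),
      Real.norm_of_nonneg (by positivity), ← div_eq_mul_inv,
      div_le_div_iff₀ (Real.sqrt_pos.mpr (by linarith)) (Real.sqrt_pos.mpr (by linarith)), one_mul]
    refine Real.sqrt_le_iff.mpr ⟨by positivity, ?_⟩
    rw [mul_pow, Real.sq_sqrt (by linarith)]
    linarith
  have h2 : (fun n : ℕ => Real.log n ^ k) =o[atTop] fun n : ℕ => (n : ℝ) ^ (1 / 2 : ℝ) := by
    have h := (isLittleO_log_rpow_rpow_atTop (k : ℝ)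
      (by norm_num : (0 : ℝ) < 1 / 2)).comp_tendsto (tendsto_natCast_atTop_atTop (R := ℝ))
    simpa [Function.comp_def, Real.rpow_natCast] using h
  have h3 := (hk.trans_isLittleO h2).mul_isBigO h1
  refine (Asymptotics.isLittleO_one_iff ℝ).mp (h3.trans_isBigO ?_)
  refine Asymptotics.IsBigO.of_bound 1 ?_
  filter_upwards [eventually_ge_atTop 1] with n hn
  have : (0 : ℝ) < (n : ℝ) ^ (1 / 2 : ℝ) := Real.rpow_pos_of_pos (by exact_mod_cast hn) _
  rw [mul_inv_cancel₀ this.ne', one_mul]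

theorem log_sub_one : IsPolylog fun n : ℕ => Real.log ((n : ℝ) - 1) := by
  refine log.mono ?_
  filter_upwards [eventually_ge_atTop 2] with n hn
  have hn' : (2 : ℝ) ≤ n := by exact_mod_cast hn
  rw [abs_of_nonneg (Real.log_nonneg (by linarith))]
  exact Real.log_le_log (by linarith) (by linarith)

theorem truncLen (γ lam : ℝ) : IsPolylog (truncLen γ lam) := by
  refine ((log_sub_one.mul (const (1 / Real.log (1 / (lam * γ))))).abs.add (const 1)).mono
    (Eventually.of_forall fun n => ?_)
  rw [mul_one_div]
  set x := Real.log ((n : ℝ) - 1) / Real.log (1 / (lam * γ)) with hx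
  have h1 := Int.le_ceil x
  have h2 := Int.ceil_lt_add_one x
  change |((⌈x⌉ : ℤ) : ℝ)| ≤ |x| + 1
  rw [abs_le]
  constructor <;> linarith [neg_abs_le x, le_abs_self x]

theorem mixLambda {βbar δ : ℝ} (hβ : 0 < βbar) (hδ : 0 < δ) :
    IsPolylog fun n : ℕ => mixLambda βbar ((n : ℝ) - 1) δ := by
  have h1 : IsPolylog fun n : ℕ => Real.log (8 * ((n : ℝ) - 1) ^ 2 / δ) := by
    refine ((const (Real.log (8 / δ))).add ((const 2).mul log_sub_one)).of_isBigO
      (Filter.EventuallyEq.isBigO ?_)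
    filter_upwards [eventually_ge_atTop 2] with n hn
    have hn' : (2 : ℝ) ≤ n := by exact_mod_cast hn
    have hp : (0 : ℝ) < (n : ℝ) - 1 := by linarith
    rw [mul_div_right_comm, Real.log_mul (by positivity) (by positivity), Real.log_pow]
    norm_num
  refine h1.add ?_
  set A := 4 * Real.exp 1 ^ 2 with hA
  have hA1 : 1 ≤ A := by nlinarith [Real.add_one_le_exp (1 : ℝ)]
  refine ((const (Real.log (A + βbar))).add log_sub_one).mono ?_
  filter_upwards [eventually_ge_atTop 2] with n hn
  have hn' : (2 : ℝ) ≤ n := by exact_mod_cast hn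
  have hp : (1 : ℝ) ≤ (n : ℝ) - 1 := by linarith
  have hm : 1 ≤ Max.max A (((n : ℝ) - 1) * βbar) := le_max_of_le_left hA1
  rw [abs_of_nonneg (Real.log_nonneg hm), ← Real.log_mul (by positivity) (by positivity)]
  refine Real.log_le_log (by linarith) (max_le ?_ ?_) <;> nlinarith

theorem mixI {βbar b κ δ : ℝ} (hβ : 0 < βbar) (hδ : 0 < δ) :
    IsPolylog fun n : ℕ => mixI βbar b κ ((n : ℝ) - 1) δ :=
  ((const 32).mul (mixLambda hβ hδ)).mul
    (rpow_const ((((mixLambda hβ hδ).mul (const (1 / b))).max (const 1)).of_isBigO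
      (Asymptotics.isBigO_of_le _ fun n => by rw [mul_one_div]))
      (fun _ => le_max_right _ _) _)

end IsPolylog

section Asymptotics

variable {d : ℕ} {L Rmax γ lam ν βbar b κ δ : ℝ}

theorem isPolylog_inv_sqrt : IsPolylog fun n : ℕ => 1 / Real.sqrt ((n : ℝ) - 1) := by
  refine (IsPolylog.const 1).mono ?_
  filter_upwards [eventually_ge_atTop 2] with n hn
  have hn' : (2 : ℝ) ≤ n := by exact_mod_cast hn
  have h : 1 ≤ Real.sqrt ((n : ℝ) - 1) := Real.one_le_sqrt.mpr (by linarith)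
  rw [abs_of_nonneg (by positivity)]
  exact (div_le_one (by positivity)).mpr h

theorem exists_burnInLHS_eq (d : ℕ) (L γ lam ν b κ : ℝ) (hβ : 0 < βbar) (hδ : 0 < δ) :
    ∃ F : ℕ → ℝ, IsPolylog F ∧ ∀ n : ℕ, 2 ≤ n →
      burnInLHS d L γ lam ν βbar b κ δ n = F n * (1 / Real.sqrt ((n : ℝ) - 1)) := by
  refine ⟨fun n => 2 * d * L ^ 2 / ((1 - γ) * ν) *
    (2 * Real.sqrt ((truncLen γ lam n + 1) * mixI βbar b κ ((n : ℝ) - 1) δ)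
      + 1 / Real.sqrt ((n : ℝ) - 1) * (1 / (1 - lam * γ))
      + 2 * (1 / Real.sqrt ((n : ℝ) - 1)) * truncLen γ lam n), ?_, fun n hn => ?_⟩
  · exact (IsPolylog.const _).mul ((((IsPolylog.const 2).mul
      (((IsPolylog.truncLen γ lam).add (IsPolylog.const 1)).mul (IsPolylog.mixI hβ hδ)).sqrt).add
      (isPolylog_inv_sqrt.mul (IsPolylog.const _))).add
      (((IsPolylog.const 2).mul isPolylog_inv_sqrt).mul (IsPolylog.truncLen γ lam)))
  · have hn' : (2 : ℝ) ≤ n := by exact_mod_cast hn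
    have e : 1 / ((n : ℝ) - 1) =
        1 / Real.sqrt ((n : ℝ) - 1) * (1 / Real.sqrt ((n : ℝ) - 1)) := by
      rw [one_div_mul_one_div, Real.mul_self_sqrt (by linarith)]
    have e1 : 1 / (((n : ℝ) - 1) * (1 - lam * γ)) = 1 / ((n : ℝ) - 1) * (1 / (1 - lam * γ)) :=
      (one_div_mul_one_div _ _).symm
    have e2 : 2 / ((n : ℝ) - 1) = 2 * (1 / ((n : ℝ) - 1)) := by ring
    rw [burnInLHS, e1, e2, e]
    ring

theorem tendsto_burnInLHS (d : ℕ) (L γ lam ν b κ : ℝ) (hβ : 0 < βbar) (hδ : 0 < δ) :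
    Tendsto (burnInLHS d L γ lam ν βbar b κ δ) atTop (nhds 0) := by
  obtain ⟨F, hF, h⟩ := exists_burnInLHS_eq d L γ lam ν b κ hβ hδ
  refine hF.tendsto_mul_inv_sqrt.congr' ?_
  filter_upwards [eventually_ge_atTop 2] with n hn using (h n hn).symm

theorem burnIn_spec (d : ℕ) (L γ lam ν b κ : ℝ) (hβ : 0 < βbar) (hδ : 0 < δ) :
    2 ≤ burnIn d L γ lam ν βbar b κ δ ∧ ∀ n ≥ burnIn d L γ lam ν βbar b κ δ,
      burnInLHS d L γ lam ν βbar b κ δ n < 1 := by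
  obtain ⟨N, hN⟩ := eventually_atTop.mp
    ((tendsto_burnInLHS d L γ lam ν b κ hβ hδ).eventually_lt_const zero_lt_one)
  exact Nat.sInf_mem (s := {N : ℕ | 2 ≤ N ∧ ∀ n ≥ N, burnInLHS d L γ lam ν βbar b κ δ n < 1})
    ⟨max 2 N, le_max_left _ _, fun n hn => hN n ((le_max_right _ _).trans hn)⟩

theorem isSoftO_errorRemainder (d : ℕ) (L Rmax γ lam ν b κ : ℝ) (hβ : 0 < βbar) (hδ : 0 < δ) :
    IsSoftO (fun n => errorRemainder d L Rmax γ lam ν βbar b κ n δ) fun n => 1 / (n : ℝ) := by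
  obtain ⟨F, hF, h⟩ := exists_burnInLHS_eq d L γ lam ν b κ hβ hδ
  have hlim := tendsto_burnInLHS d L γ lam ν b κ hβ hδ
  have hinv : IsPolylog fun n => 1 / (1 - burnInLHS d L γ lam ν βbar b κ δ n) := by
    exact (IsPolylog.const 1).of_isBigO
      (((tendsto_const_nhds (x := (1 : ℝ))).div
        ((tendsto_const_nhds (x := (1 : ℝ))).sub hlim) (by norm_num)).isBigO_one ℝ)
  have hmain : IsPolylog fun n : ℕ =>
      (4 * (Rmax / (1 - γ)) * d * L ^ 2 / ((1 - γ) * ν) *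
        Real.sqrt ((1 + truncLen γ lam n) * mixI βbar b κ ((n : ℝ) - 1) δ) * F n +
        errorCoef d L Rmax γ ν * 2 * truncLen γ lam n) *
        (1 / (1 - burnInLHS d L γ lam ν βbar b κ δ n)) :=
    ((((IsPolylog.const _).mul (((IsPolylog.const 1).add (IsPolylog.truncLen γ lam)).mul
      (IsPolylog.mixI hβ hδ)).sqrt).mul hF).add
      ((IsPolylog.const _).mul (IsPolylog.truncLen γ lam))).mul hinv
  obtain ⟨k, hk⟩ := hmain
  have h1 : (fun n : ℕ => 1 / ((n : ℝ) - 1)) =O[atTop] fun n : ℕ => 1 / (n : ℝ) := by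
    refine Asymptotics.IsBigO.of_bound 2 ?_
    filter_upwards [eventually_ge_atTop 2] with n hn
    have hn' : (2 : ℝ) ≤ n := by exact_mod_cast hn
    have hp : (0 : ℝ) < (n : ℝ) - 1 := by linarith
    rw [Real.norm_of_nonneg (by positivity), Real.norm_of_nonneg (by positivity), mul_one_div,
      div_le_div_iff₀ hp (by linarith)]
    linarith
  refine ⟨k, ((h1.mul hk).congr' ?_ EventuallyEq.rfl).trans (Asymptotics.isBigO_of_le _ fun n => ?_)⟩
  · filter_upwards [eventually_ge_atTop 2] with n hn
    have hn' : (2 : ℝ) ≤ n := by exact_mod_cast hn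
    have e : 1 / ((n : ℝ) - 1) =
        1 / Real.sqrt ((n : ℝ) - 1) * (1 / Real.sqrt ((n : ℝ) - 1)) := by
      rw [one_div_mul_one_div, Real.mul_self_sqrt (by linarith)]
    have e1 : leadingTerm d L Rmax γ lam ν βbar b κ δ n =
        4 * (Rmax / (1 - γ)) * d * L ^ 2 / ((1 - γ) * ν) *
        Real.sqrt ((1 + truncLen γ lam n) * mixI βbar b κ ((n : ℝ) - 1) δ) *
        (1 / Real.sqrt ((n : ℝ) - 1)) := by
      rw [leadingTerm, mul_assoc (Real.sqrt _), ← div_div, div_right_comm]; ring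
    have e2 : 2 * truncLen γ lam n / ((n : ℝ) - 1) = 2 * truncLen γ lam n * (1 / ((n : ℝ) - 1)) := by
      ring
    have e3 : errorRemainder d L Rmax γ lam ν βbar b κ n δ =
        (leadingTerm d L Rmax γ lam ν βbar b κ δ n *
          (F n * (1 / Real.sqrt ((n : ℝ) - 1))) +
          errorCoef d L Rmax γ ν * (2 * truncLen γ lam n / ((n : ℝ) - 1))) *
          (1 / (1 - burnInLHS d L γ lam ν βbar b κ δ n)) := by
      rw [← h n hn, errorRemainder, mul_one_div]
    rw [e3, e1, e2, e]
    ring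
  · simp only [one_div, Real.log_inv]
    rw [norm_mul, norm_mul, norm_pow, norm_pow, norm_neg]

end Asymptotics

theorem theorem1 (d : ℕ) (L Rmax γ lam ν βbar b κ : ℝ)
    (hγ : γ ∈ Set.Ioo (0 : ℝ) 1) (hlam : lam ∈ Set.Ioo (0 : ℝ) 1)
    (hβbar : 0 < βbar) (hb : 0 < b) (hκ : 0 < κ) :
    -- the remainder `h(n, δ) = Õ(1/n)` depends on the parameters above only
    ∃ h : ℕ → ℝ → ℝ,
      (∀ δ ∈ Set.Ioo (0 : ℝ) 1, IsSoftO (fun n => h n δ) (fun n => 1 / (n : ℝ))) ∧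
      ∀ (S : Type*) [Countable S] [MeasurableSpace S] [MeasurableSingletonClass S]
        (P : Kernel S S) [IsMarkovKernel P] (μ : Measure S) [IsProbabilityMeasure μ]
        (φ : S → Fin d → ℝ) (r : S → ℝ)
        (Ω : Type*) [MeasurableSpace Ω] (Pr : Measure Ω) [IsProbabilityMeasure Pr]
        (X : ℕ → Ω → S),
        IsErgodicKernel P →
        Kernel.Invariant P μ →
        (∀ x, |r x| ≤ Rmax) →
        (∀ x j, |φ x j| ≤ L) →
        LinearIndependent ℝ (fun (j : Fin d) (x : S) => φ x j) →
        IsLeast (spectrum ℝ (gramMatrix μ φ)) ν →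
        IsMarkovChain Pr P μ X →
        (∀ i : ℕ, 1 ≤ i →
          betaCoeff Pr X i ≤ ENNReal.ofReal (βbar * Real.exp (-b * (i : ℝ) ^ κ))) →
        ∃ v : S → ℝ,
          -- `v = v_LSTD(λ)` is the unique solution of `v = Π T^λ v`
          (∀ w : S → ℝ, IsLSTDLimit P μ φ r γ lam w ↔ w = v) ∧
          ∀ δ ∈ Set.Ioo (0 : ℝ) 1,
            ENNReal.ofReal (1 - δ) ≤
              Pr {ω | ∀ n : ℕ, burnIn d L γ lam ν βbar b κ δ ≤ n →
                IsUnit (AHat φ γ lam X n ω) ∧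
                muNorm μ (fun x => v x - vHat φ r γ lam X n ω x) ≤
                  leadingTerm d L Rmax γ lam ν βbar b κ δ n + h n δ} := by
  refine ⟨fun n δ => errorRemainder d L Rmax γ lam ν βbar b κ n δ,
    fun δ hδ => isSoftO_errorRemainder d L Rmax γ lam ν b κ hβbar hδ.1, ?_⟩
  intro S _ _ _ P _ μ _ φ r Ω _ Pr _ X hP hμ hr hφ hlin hν hX hmix
  have hν0 : 0 < ν := gram_eigenvalue_pos hP hμ hφ hlin hν
  obtain ⟨θ, hθ, hθu⟩ := exists_unique_lstd_parameter hγ hlam hP hμ hφ hlin (r := r) ⟨Rmax, hr⟩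
  refine ⟨fun x => φ x ⬝ᵥ θ, hθu, fun δ hδ => ?_⟩
  obtain ⟨hb2, hburn⟩ := burnIn_spec d L γ lam ν b κ hβbar hδ.1
  set n0 := burnIn d L γ lam ν βbar b κ δ
  set good : ℕ → Ω → Prop := fun n ω => IsUnit (AHat φ γ lam X n ω) ∧
    muNorm μ (fun x => φ x ⬝ᵥ θ - vHat φ r γ lam X n ω x) ≤
      leadingTerm d L Rmax γ lam ν βbar b κ δ n + errorRemainder d L Rmax γ lam ν βbar b κ n δ
  set E : Set Ω := {ω | ∀ n : ℕ, n0 ≤ n → good n ω}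
  have hsub : Eᶜ ⊆ ⋃ k : ℕ, {ω | n0 ≤ k + 2 ∧ ¬ good (k + 2) ω} := by
    intro ω hω
    simp only [E, Set.mem_compl_iff, Set.mem_ofPred_eq, not_forall] at hω
    obtain ⟨n, hn, hbad⟩ := hω
    obtain ⟨k, rfl⟩ := Nat.exists_eq_add_of_le' (hb2.trans hn)
    exact Set.mem_iUnion.mpr ⟨k, hn, hbad⟩
  have hterm : ∀ k : ℕ, Pr {ω | n0 ≤ k + 2 ∧ ¬ good (k + 2) ω} ≤
      ENNReal.ofReal (δ / (4 * ((k + 1 : ℕ) : ℝ) ^ 2)) := by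
    intro k
    by_cases hk : n0 ≤ k + 2
    · have h := measureReal_not_estimate_le hγ hlam hβbar hb hκ hδ hμ hr hφ hν hν0 hX hmix hθ
        (by omega) (hburn _ hk)
      rw [measureReal_def, ← ENNReal.le_ofReal_iff_toReal_le (measure_ne_top _ _)
        (div_nonneg hδ.1.le (by positivity))] at h
      simp only [hk, true_and]
      exact h
    · simp [hk]
  have hEc : Pr Eᶜ ≤ ENNReal.ofReal δ :=
    (measure_mono hsub).trans ((measure_iUnion_le _).trans
      ((ENNReal.tsum_le_tsum hterm).trans (tsum_ofReal_div_sq_le hδ.1)))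
  have h1 : 1 ≤ Pr E + ENNReal.ofReal δ := by
    calc (1 : ℝ≥0∞) = Pr (E ∪ Eᶜ) := by rw [Set.union_compl_self, measure_univ]
      _ ≤ Pr E + Pr Eᶜ := measure_union_le _ _
      _ ≤ _ := by gcongr
  rw [ENNReal.ofReal_sub _ hδ.1.le, ENNReal.ofReal_one]
  exact tsub_le_iff_right.mpr h1
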